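/- Let $\Sigma=\{1,\dots,q\}$ be a finite alphabet. A set-string of length $n$ over $\Sigma$ is a sequence $\mathcal S[1..n]$ of subsets of $\Sigma$; its size is $\sum_i|\mathcal S[i]|$. Two set-strings $\mathcal S_1,\mathcal S_2$ of the same length $m$ set-parameterized match if there is a bijection $\pi:\Sigma\to\Sigma$ with $\pi(\mathcal S_1[i])=\mathcal S_2[i]$ for all $i\in[1..m]$. Theorem. There is a Monte Carlo randomized algorithm (a program for the randomized word RAM, with words of $w\ge k\log_2(n+m+N+M+q+1)$ bits for a constant $k$, unit-cost arithmetic modulo $2^w$, and an instruction that draws a uniformly random word) that, given a set-string text $\mathcal T[1..n]$ with $n\ge 1$ and a set-string pattern $\mathcal P[1..m]$ over $\Sigma$ of total sizes $N=\sum_{i=1}^n|\mathcal T[i]|$ and $M=\sum_{j=1}^m|\mathcal P[j]|$, halts almost surely and has the following properties. 1. Whenever it halts, it has reported every position $i\in[1..n-m+1]$ such that $\mathcal P$ set-parameterized matches $\mathcal T[i..i+m-1]$. 2. The probability that it reports anything else (a false positive) is at most $1/n$. 3. It runs in time $O(n+m+N+M)$ with high probability, and this is $O(N+M)$ when $n\le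 N$ and $m\le M$ (for instance, when no set is empty): for every $a\in\mathbb N$ there is a constant $C$, independent of the input and of $w$, such that the algorithm halts within $C\,(n+m+N+M)$ steps with probability at least $1-(n+m+N+M)^{-a}$, and, if $n\le N$ and $m\le M$, within $C\,(N+M)$ steps with probability at least $1-(N+M)^{-a}$. -/

import Mathlib

/-! ### Set-strings and set-parameterized matching -/

/-- A set-string of length `n` over the alphabet `α`; index `i : Fin n` stands for position `i + 1`. -/
abbrev SetString (α : Type) (n : ℕ) : Type := Fin n → Finset α

namespace SetString

/-- The size of a set-string: the total number of character occurrences. -/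
def size {α : Type} {n : ℕ} (S : SetString α n) : ℕ := ∑ i, (S i).card

/-- Two set-strings of equal length set-parameterized match if one bijection of the whole alphabet
maps the first one to the second one, position by position. -/
def PMatch {α : Type} {m : ℕ} (S₁ S₂ : SetString α m) : Prop :=
  ∃ π : Equiv.Perm α, ∀ i, (S₁ i).map π.toEmbedding = S₂ i

/-- The window of length `m` of `T` after its first `j` positions, that is `T[j+1 .. j+m]`. -/
def window {α : Type} {n : ℕ} (T : SetString α n) (m j : ℕ) (h : j + m ≤ n) : SetString α m :=
  fun i => T ⟨j + i, by have := i.isLt; omega⟩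

/-- The positions `i` of `[1 .. n-m+1]` such that `P` set-parameterized matches `T[i .. i+m-1]`. -/
def matchPositions {α : Type} {n m : ℕ} (T : SetString α n) (P : SetString α m) : Set ℕ :=
  {i | ∃ (j : ℕ) (h : j + m ≤ n), i = j + 1 ∧ PMatch P (T.window m j h)}

/-- `t` lists the characters of every set of `S`, each one once, in an arbitrary order. -/
def Enumerates {α : Type} {n : ℕ} (t : Fin n → List α) (S : SetString α n) : Prop :=
  ∀ i, (t i).Nodup ∧ ∀ a, a ∈ t i ↔ a ∈ S i

/-- A set-string as a sequence of numbers: for every position, the number of characters there,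
followed by these characters. The alphabet with `q` letters is `{1, …, q}`. -/
def encode {q n : ℕ} (t : Fin n → List (Fin q)) : List ℕ :=
  (List.ofFn t).flatMap fun l => l.length :: l.map fun σ => (σ : ℕ) + 1

/-- The input of the matching problem: the two lengths and the alphabet size, then the text, then
the pattern. -/
def encodeInput {q n m : ℕ} (t : Fin n → List (Fin q)) (p : Fin m → List (Fin q)) : List ℕ :=
  [n, m, q] ++ encode t ++ encode p

end SetString

/-! ### Randomized word RAM

Structured programs over registers and a random access memory, all of whose cells hold `w`-bit
words. A program is a fixed finite text that does not depend on `w` or on the input. -/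

namespace WordRAM

/-- Binary operations on words. -/
inductive Op : Type
  | add | sub | mul | div | mod | lt | eq

/-- Arithmetic is modulo `2 ^ w`; comparisons return `1` or `0`. -/
def Op.eval (w : ℕ) : Op → ℕ → ℕ → ℕ
  | .add, a, b => (a + b) % 2 ^ w
  | .sub, a, b => (a + 2 ^ w - b) % 2 ^ w
  | .mul, a, b => (a * b) % 2 ^ w
  | .div, a, b => (a / b) % 2 ^ w
  | .mod, a, b => (a % b) % 2 ^ w
  | .lt, a, b => (if a < b then 1 else 0) % 2 ^ w
  | .eq, a, b => (if a = b then 1 else 0) % 2 ^ w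

/-- Instructions; `d`, `a`, `b` are names of registers. -/
inductive Instr : Type
  /-- do nothing -/
  | skip
  /-- `d := c` -/
  | const (d c : ℕ)
  /-- `d := o a b` -/
  | binop (o : Op) (d a b : ℕ)
  /-- `d := memory[a]` -/
  | load (d a : ℕ)
  /-- `memory[a] := b` -/
  | store (a b : ℕ)
  /-- `d :=` a fresh uniformly random word -/
  | rand (d : ℕ)
  /-- report the content of `a` -/
  | emit (a : ℕ)

/-- Structured programs; a test on a register succeeds when its content is not zero. -/
inductive Prog : Type
  | instr (i : Instr)
  | seq (p₁ p₂ : Prog)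
  | ite (r : ℕ) (p₁ p₂ : Prog)
  | loop (r : ℕ) (p : Prog)

/-- A machine state: registers, memory, number of random words drawn so far, and the list of
reported words. -/
structure State : Type where
  reg : ℕ → ℕ
  mem : ℕ → ℕ
  drawn : ℕ
  out : List ℕ

/-- Write a register. -/
def State.setReg (s : State) (d v : ℕ) : State := { s with reg := Function.update s.reg d v }

/-- The effect of an instruction on a machine with word size `w` whose successive random words are
`ω 0, ω 1, …`. -/
def Instr.exec (w : ℕ) (ω : ℕ → Fin (2 ^ w)) : Instr → State → State
  | .skip, s => s
  | .const d c, s => s.setReg d (c % 2 ^ w)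
  | .binop o d a b, s => s.setReg d (o.eval w (s.reg a) (s.reg b))
  | .load d a, s => s.setReg d (s.mem (s.reg a))
  | .store a b, s => { s with mem := Function.update s.mem (s.reg a) (s.reg b) }
  | .rand d, s => { s.setReg d (ω s.drawn) with drawn := s.drawn + 1 }
  | .emit a, s => { s with out := s.out ++ [s.reg a] }

/-- `Exec w ω p s t s'`: started in state `s`, the program `p` halts in state `s'` after exactly `t`
steps. Every instruction and every test costs one step. -/
inductive Exec (w : ℕ) (ω : ℕ → Fin (2 ^ w)) : Prog → State → ℕ → State → Prop
  | instr (i : Instr) (s : State) : Exec w ω (.instr i) s 1 (i.exec w ω s)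
  | seq {p₁ p₂ : Prog} {s s₁ s₂ : State} {t₁ t₂ : ℕ} :
      Exec w ω p₁ s t₁ s₁ → Exec w ω p₂ s₁ t₂ s₂ → Exec w ω (.seq p₁ p₂) s (t₁ + t₂) s₂
  | ite_true {r : ℕ} {p₁ p₂ : Prog} {s s' : State} {t : ℕ} :
      s.reg r ≠ 0 → Exec w ω p₁ s t s' → Exec w ω (.ite r p₁ p₂) s (t + 1) s'
  | ite_false {r : ℕ} {p₁ p₂ : Prog} {s s' : State} {t : ℕ} :
      s.reg r = 0 → Exec w ω p₂ s t s' → Exec w ω (.ite r p₁ p₂) s (t + 1) s'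
  | loop_stop {r : ℕ} {p : Prog} {s : State} :
      s.reg r = 0 → Exec w ω (.loop r p) s 1 s
  | loop_step {r : ℕ} {p : Prog} {s s₁ s₂ : State} {t₁ t₂ : ℕ} :
      s.reg r ≠ 0 → Exec w ω p s t₁ s₁ → Exec w ω (.loop r p) s₁ t₂ s₂ →
      Exec w ω (.loop r p) s (t₁ + t₂ + 1) s₂

/-- For fixed random words, the running time and the final state are unique. -/
theorem Exec.deterministic {w : ℕ} {ω : ℕ → Fin (2 ^ w)} {p : Prog} {s s' s'' : State} {t t' : ℕ}
    (h : Exec w ω p s t s') (h' : Exec w ω p s t' s'') : t = t' ∧ s' = s'' := by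
  induction h generalizing t' s'' with
  | instr i s => cases h'; exact ⟨rfl, rfl⟩
  | seq _ _ ih₁ ih₂ =>
    cases h' with
    | seq a b =>
      obtain ⟨rfl, rfl⟩ := ih₁ a
      obtain ⟨rfl, rfl⟩ := ih₂ b
      exact ⟨rfl, rfl⟩
  | ite_true hr _ ih =>
    cases h' with
    | ite_true _ a => obtain ⟨rfl, rfl⟩ := ih a; exact ⟨rfl, rfl⟩
    | ite_false hr' _ => exact absurd hr' hr
  | ite_false hr _ ih =>
    cases h' with
    | ite_true hr' _ => exact absurd hr hr'
    | ite_false _ a => obtain ⟨rfl, rfl⟩ := ih a; exact ⟨rfl, rfl⟩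
  | loop_stop hr =>
    cases h' with
    | loop_stop _ => exact ⟨rfl, rfl⟩
    | loop_step hr' _ _ => exact absurd hr hr'
  | loop_step hr _ _ ih₁ ih₂ =>
    cases h' with
    | loop_stop hr' => exact absurd hr' hr
    | loop_step _ a b =>
      obtain ⟨rfl, rfl⟩ := ih₁ a
      obtain ⟨rfl, rfl⟩ := ih₂ b
      exact ⟨rfl, rfl⟩

/-- The initial state: the input stands in the first memory cells; everything else is zero. -/
def initState (w : ℕ) (input : List ℕ) : State where
  reg := fun _ => 0
  mem := fun a => input.getD a 0 % 2 ^ w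
  drawn := 0
  out := []

/-- On this input and these random words, the program halts within `B` steps. -/
def HaltsWithin (p : Prog) (w : ℕ) (input : List ℕ) (ω : ℕ → Fin (2 ^ w)) (B : ℕ) : Prop :=
  ∃ t ≤ B, ∃ s, Exec w ω p (initState w input) t s

/-- On this input and these random words, the program halts and has reported the list `out`. -/
def Outputs (p : Prog) (w : ℕ) (input : List ℕ) (ω : ℕ → Fin (2 ^ w)) (out : List ℕ) : Prop :=
  ∃ t s, Exec w ω p (initState w input) t s ∧ s.out = out

/-- The law of the random words: independent and uniformly distributed on `{0, …, 2 ^ w - 1}`. -/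
noncomputable def coinMeasure (w : ℕ) : MeasureTheory.Measure (ℕ → Fin (2 ^ w)) :=
  MeasureTheory.Measure.infinitePi fun _ => (PMF.uniformOfFintype (Fin (2 ^ w))).toMeasure

end WordRAM

set_option linter.constructorNameAsVariable false
set_option linter.unusedSectionVars false

/-!
### Overview

The program below is deterministic and makes no errors. The memory of the word RAM is zero at the
start and has polynomially many addressable cells, so it provides direct-address tables, and a trie
over the shapes of the pattern replaces random fingerprints.

The shape of a character in a window is the set of the distances from its last occurrence back to
the earlier ones. Two windows of the same length match if and only if, position by position, the
characters there have the same multiset of shapes. All shapes that occur in the pattern are stored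
in a trie with failure links, like the automaton of Aho and Corasick, and the search for the pattern
follows Knuth, Morris and Pratt: a window over the text is extended while it matches a prefix of the
pattern, and it is otherwise moved to the next border of this prefix.
-/

/-! ### Commands over variables and arrays, compiled to the word RAM -/

/-! Why it is true. For matching, all that counts about a character is the set of its occurrences in
the window: two windows match if and only if these sets, taken over the whole alphabet, form the
same multiset (`pMatchAt_iff_map`). If two windows of length `l` match already, cancellation in this
equality shows that the match extends by one position exactly when the characters of the two next
sets have the same multiset of shapes (`PMatchAt.succ_iff`). Matching is an equivalence relation
that passes to subwindows, which is all that the method of Knuth, Morris and Pratt needs. The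
pattern is put in front of the text, and a single search runs over the joint sequence from position
1 on: as long as the end of the window is in the pattern it discovers the borders, and afterwards it
uses them on the text (`SearchOk`).

Shapes are handled through node numbers. A new occurrence at distance `g` from the previous one
shifts the shape by `g` and adds 0, so the shapes of the pattern form a trie with edges labelled by
distances. When the window loses its first set, the shapes of the characters there lose their
largest element. For every character the algorithm keeps the longest initial part of its shape that
is in the trie, and one removal costs at most one failure link (`CharOk.drop`). Whenever the window
matches a prefix of the pattern, its shapes are shapes of the pattern, and the part that is kept is
the whole shape (`CharOk.exact`). Multisets of shapes are then compared by counting node numbers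
(`perm_iff_pMatchAt_succ`).

Why the time is linear. The transition table has quadratically many cells, but they are zero at the
start and only few of them are touched. The trie is built in order of depth; the search for failure
links is paid by the depth of the failure links, which grows by at most one along an edge
(`Trie.card_fail_trans_le`). In the search, the danger is that a large set is compared many times.
Sets of different sizes are rejected in constant time. After a shift by `d` to a border of length
`f`, the next comparison costs at most the size of the set at `f`, and by periodicity this is the
size of one of the `d` sets that the shift removes (`exists_card_eq_of_border`,
`searchPotential_shift`).

No random word is drawn. The bounds hold for every outcome, the exceptional events are empty, and
the lower bound on the word size only makes room for the tables (`main_correct`). -/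

namespace WordRAM

/-- Program variables. -/
inductive Var : Type
  | n | m | len | stride | blk | blk' | i | j | k | pos | x | y | node | gap | f | s | c | l | hd | tl
  | nodes | bad
  deriving DecidableEq

/-- Program arrays. -/
inductive Arr : Type
  | ptr | succ | queue | gap | lastEv | lastPos | par | child | depth | fail | label | cnt | cur | last
  | num | border | next
  deriving DecidableEq

def Var.idx : Var → ℕ
  | .n => 0 | .m => 1 | .len => 2 | .stride => 3 | .blk => 4 | .blk' => 5 | .i => 6 | .j => 7
  | .k => 8 | .pos => 9 | .x => 10 | .y => 11 | .node => 12 | .gap => 13 | .f => 14 | .s => 15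
  | .c => 16 | .l => 17 | .hd => 18 | .tl => 19 | .nodes => 20 | .bad => 21

def Arr.idx : Arr → ℕ
  | .ptr => 0 | .succ => 1 | .queue => 2 | .gap => 3 | .lastEv => 4 | .lastPos => 5 | .par => 6
  | .child => 7 | .depth => 8 | .fail => 9 | .label => 10 | .cnt => 11 | .cur => 12 | .last => 13
  | .num => 14 | .border => 15 | .next => 16

theorem Var.idx_injective : Function.Injective Var.idx := by
  intro a b h
  cases a <;> cases b <;> first | rfl | simp [Var.idx] at h

theorem Arr.idx_injective : Function.Injective Arr.idx := by
  intro a b h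
  cases a <;> cases b <;> first | rfl | simp [Arr.idx] at h

theorem Arr.idx_lt (k : Arr) : k.idx < 32 := by cases k <;> simp [Arr.idx]

/-- The register of a variable. -/
def Var.reg (x : Var) : ℕ := 2 * x.idx

/-- The `t`-th register for intermediate results. -/
def temp (t : ℕ) : ℕ := 2 * t + 1

theorem Var.reg_ne_temp (x : Var) (t : ℕ) : x.reg ≠ temp t := by
  unfold Var.reg temp; omega

/-- A word RAM together with its input and the capacity of the arrays. -/
structure Machine : Type where
  w : ℕ
  ω : ℕ → Fin (2 ^ w)
  inp : ℕ → ℕ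
  len : ℕ
  cap : ℕ
  fits : 32 * cap + len < 2 ^ w
  inp_lt : ∀ i < len, inp i < 2 ^ w
  one_lt : 1 < 2 ^ w

/-- Values of the variables and of the arrays, and the reported words. -/
structure Store : Type where
  v : Var → ℕ
  a : Arr → ℕ → ℕ
  out : List ℕ

namespace Store

def set (h : Store) (x : Var) (u : ℕ) : Store := { h with v := Function.update h.v x u }

def put (h : Store) (k : Arr) (i u : ℕ) : Store :=
  { h with a := Function.update h.a k (Function.update (h.a k) i u) }

def emit (h : Store) (u : ℕ) : Store := { h with out := h.out ++ [u] }

variable (h : Store) (x y : Var) (k k' : Arr) (i u : ℕ)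

@[simp] theorem set_v_same : (h.set x u).v x = u := by simp [set]
@[simp] theorem set_v_of_ne (hxy : y ≠ x) : (h.set x u).v y = h.v y := by simp [set, hxy]
@[simp] theorem set_a : (h.set x u).a = h.a := rfl
@[simp] theorem set_out : (h.set x u).out = h.out := rfl
@[simp] theorem put_v : (h.put k i u).v = h.v := rfl
@[simp] theorem put_out : (h.put k i u).out = h.out := rfl
@[simp] theorem put_a_same : (h.put k i u).a k = Function.update (h.a k) i u := by simp [put]
@[simp] theorem put_a_of_ne (hk : k' ≠ k) : (h.put k i u).a k' = h.a k' := by simp [put, hk]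
@[simp] theorem emit_v : (h.emit u).v = h.v := rfl
@[simp] theorem emit_a : (h.emit u).a = h.a := rfl
@[simp] theorem emit_out : (h.emit u).out = h.out ++ [u] := rfl

end Store

/-- Expressions. -/
inductive Expr : Type
  | var (x : Var)
  | lit (c : ℕ)
  | bin (o : Op) (e f : Expr)
  | get (k : Arr) (e : Expr)
  | inp (e : Expr)

/-- Operations on natural numbers, without overflow. -/
def Op.val : Op → ℕ → ℕ → ℕ
  | .add, a, b => a + b
  | .sub, a, b => a - b
  | .mul, a, b => a * b
  | .div, a, b => a / b
  | .mod, a, b => a % b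
  | .lt, a, b => if a < b then 1 else 0
  | .eq, a, b => if a = b then 1 else 0

/-- The operation neither overflows nor truncates. -/
def Op.safe (W : ℕ) : Op → ℕ → ℕ → Prop
  | .add, a, b => a + b < W
  | .sub, a, b => b ≤ a
  | .mul, a, b => a * b < W
  | _, _, _ => True

theorem Op.val_lt {W : ℕ} (hW : 1 < W) {o : Op} {a b : ℕ} (ha : a < W) (h : o.safe W a b) :
    o.val a b < W := by
  cases o <;> simp only [Op.safe, Op.val] at * <;> try split_ifs
  all_goals first
    | omega
    | exact lt_of_le_of_lt (Nat.div_le_self _ _) ha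
    | exact lt_of_le_of_lt (Nat.mod_le _ _) ha

theorem Op.eval_eq {w : ℕ} (hW : 1 < 2 ^ w) {o : Op} {a b : ℕ} (ha : a < 2 ^ w)
    (h : o.safe (2 ^ w) a b) : o.eval w a b = o.val a b := by
  have hv := Op.val_lt hW ha h
  cases o
  case sub =>
    simp only [Op.safe, Op.val, Op.eval] at *
    rw [show a + 2 ^ w - b = (a - b) + 2 ^ w by omega, Nat.add_mod_right, Nat.mod_eq_of_lt hv]
  all_goals simp only [Op.safe, Op.val, Op.eval] at *; exact Nat.mod_eq_of_lt hv

namespace Expr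

def eval (I : ℕ → ℕ) (h : Store) : Expr → ℕ
  | var x => h.v x
  | lit c => c
  | bin o e f => o.val (e.eval I h) (f.eval I h)
  | get k e => h.a k (e.eval I h)
  | inp e => I (e.eval I h)

/-- Evaluation stays within the bounds of the machine. -/
def ok (M : Machine) (h : Store) : Expr → Prop
  | var _ => True
  | lit c => c < 2 ^ M.w
  | bin o e f => e.ok M h ∧ f.ok M h ∧ o.safe (2 ^ M.w) (e.eval M.inp h) (f.eval M.inp h)
  | get _ e => e.ok M h ∧ e.eval M.inp h < M.cap
  | inp e => e.ok M h ∧ e.eval M.inp h < M.len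

def cost : Expr → ℕ
  | var _ => 1 + 1
  | lit _ => 1
  | bin _ e f => e.cost + (f.cost + 1)
  | get _ e => e.cost + ((1 + (1 + (1 + (1 + (1 + 1))))) + 1)
  | inp e => e.cost + 1

end Expr

/-- Turn the index in `temp t` into the address of this entry of array `k`. -/
def addrCode (k : Arr) (t : ℕ) : Prog :=
  .seq (.instr (.const (temp (t + 1)) 32)) <|
  .seq (.instr (.binop .mul (temp t) (temp t) (temp (t + 1)))) <|
  .seq (.instr (.const (temp (t + 1)) (k.idx + 1))) <|
  .seq (.instr (.binop .add (temp t) (temp t) (temp (t + 1)))) <|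
  .seq (.instr (.const (temp (t + 1)) 0)) <|
  .instr (.binop .sub (temp t) (temp (t + 1)) (temp t))

/-- Compute the expression into `temp t`. -/
def Expr.code : Expr → ℕ → Prog
  | var x, t => .seq (.instr (.const (temp t) 0)) (.instr (.binop .add (temp t) (temp t) x.reg))
  | lit c, t => .instr (.const (temp t) c)
  | bin o e f, t => .seq (e.code t) (.seq (f.code (t + 1))
      (.instr (.binop o (temp t) (temp t) (temp (t + 1)))))
  | get k e, t => .seq (e.code t) (.seq (addrCode k t) (.instr (.load (temp t) (temp t))))
  | inp e, t => .seq (e.code t) (.instr (.load (temp t) (temp t)))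

/-- The machine state represents the store. -/
structure Rel (M : Machine) (h : Store) (s : State) : Prop where
  reg : ∀ x : Var, s.reg x.reg = h.v x
  v_lt : ∀ x, h.v x < 2 ^ M.w
  arr : ∀ k, ∀ i < M.cap, s.mem (2 ^ M.w - (32 * i + k.idx + 1)) = h.a k i
  a_lt : ∀ k, ∀ i < M.cap, h.a k i < 2 ^ M.w
  inp : ∀ i < M.len, s.mem i = M.inp i
  out : s.out = h.out

/-- Only the registers `temp t, temp (t + 1), …` may differ. -/
structure AgreeBelow (t : ℕ) (s s' : State) : Prop where
  reg : ∀ r, (∀ t' ≥ t, r ≠ temp t') → s'.reg r = s.reg r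
  mem : s'.mem = s.mem
  out : s'.out = s.out

theorem AgreeBelow.rel {M : Machine} {h : Store} {s s' : State} {t : ℕ} (hs : AgreeBelow t s s')
    (hr : Rel M h s) : Rel M h s' where
  reg x := by rw [hs.reg _ fun t' _ => x.reg_ne_temp t', hr.reg]
  v_lt := hr.v_lt
  arr := by rw [hs.mem]; exact hr.arr
  a_lt := hr.a_lt
  inp := by rw [hs.mem]; exact hr.inp
  out := by rw [hs.out]; exact hr.out

theorem AgreeBelow.trans {s s' s'' : State} {t t' : ℕ} (h : AgreeBelow t s s')
    (h' : AgreeBelow t' s' s'') (ht : t ≤ t') : AgreeBelow t s s'' where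
  reg r hr := by rw [h'.reg r fun u hu => hr u (ht.trans hu), h.reg r hr]
  mem := h'.mem.trans h.mem
  out := h'.out.trans h.out

theorem AgreeBelow.setReg (s : State) (t v : ℕ) : AgreeBelow t s (s.setReg (temp t) v) where
  reg r hr := by simp [State.setReg, hr t le_rfl]
  mem := rfl
  out := rfl

theorem temp_ne_of_lt {t t' : ℕ} (h : t < t') : temp t ≠ temp t' := by unfold temp; omega

/-- Subtraction from 0 wraps around, so the arrays are interleaved with period 32 and grow downwards
from the top of the memory, away from the input at the bottom. -/
theorem addrCode_exec (M : Machine) (k : Arr) (t i : ℕ) (hi : i < M.cap) (s : State)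
    (hs : s.reg (temp t) = i) : ∃ s', Exec M.w M.ω (addrCode k t) s (1 + (1 + (1 + (1 + (1 + 1))))) s' ∧
      AgreeBelow t s s' ∧ s'.reg (temp t) = 2 ^ M.w - (32 * i + k.idx + 1) := by
  refine ⟨_, .seq (.instr _ _) (.seq (.instr _ _) (.seq (.instr _ _) (.seq (.instr _ _)
    (.seq (.instr _ _) (.instr _ _))))), ⟨?_, rfl, rfl⟩, ?_⟩
  · intro r hr
    have h1 := hr t le_rfl
    have h2 := hr (t + 1) (Nat.le_succ t)
    simp [Instr.exec, State.setReg, h1, h2]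
  · have hk := k.idx_lt
    have hf := M.fits
    have hne : temp t ≠ temp (t + 1) := temp_ne_of_lt (Nat.lt_succ_self t)
    have e1 : 32 % 2 ^ M.w = 32 := Nat.mod_eq_of_lt (by omega)
    have e2 : i * 32 % 2 ^ M.w = i * 32 := Nat.mod_eq_of_lt (by omega)
    have e3 : (k.idx + 1) % 2 ^ M.w = k.idx + 1 := Nat.mod_eq_of_lt (by omega)
    have e4 : (i * 32 + (k.idx + 1)) % 2 ^ M.w = i * 32 + (k.idx + 1) :=
      Nat.mod_eq_of_lt (by omega)
    have e5 : (2 ^ M.w - (i * 32 + (k.idx + 1))) % 2 ^ M.w = 2 ^ M.w - (i * 32 + (k.idx + 1)) :=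
      Nat.mod_eq_of_lt (by omega)
    simp [Instr.exec, State.setReg, Op.eval, hne, hs, e1, e2, e3, e4, e5]
    omega

/-- The second operand is computed with temporaries from `t + 1` on, so the value of the first one
survives in `temp t`. -/
theorem Expr.exec (M : Machine) (h : Store) (e : Expr) : ∀ (t : ℕ) (s : State), Rel M h s →
    e.ok M h → ∃ s', Exec M.w M.ω (e.code t) s e.cost s' ∧ AgreeBelow t s s' ∧
      s'.reg (temp t) = e.eval M.inp h ∧ e.eval M.inp h < 2 ^ M.w := by
  induction e with
  | var x =>
    intro t s hr _
    refine ⟨_, .seq (.instr _ _) (.instr _ _),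
      (AgreeBelow.setReg s t _).trans (AgreeBelow.setReg _ t _) le_rfl, ?_, hr.v_lt x⟩
    simp [State.setReg, Op.eval, Instr.exec, Function.update_of_ne (x.reg_ne_temp t), hr.reg,
      Nat.mod_eq_of_lt (hr.v_lt x), Expr.eval]
  | lit c =>
    intro t s hr hc
    refine ⟨_, .instr _ _, AgreeBelow.setReg s t _, ?_, hc⟩
    simp only [Expr.ok] at hc
    simp [Instr.exec, State.setReg, Nat.mod_eq_of_lt hc, Expr.eval]
  | bin o e f ihe ihf =>
    rintro t s hr ⟨he, hf, hs⟩
    obtain ⟨s1, x1, a1, v1, l1⟩ := ihe t s hr he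
    obtain ⟨s2, x2, a2, v2, l2⟩ := ihf (t + 1) s1 (a1.rel hr) hf
    refine ⟨_, .seq x1 (.seq x2 (.instr _ _)),
      (a1.trans a2 (Nat.le_succ t)).trans (AgreeBelow.setReg _ t _) le_rfl, ?_,
      Op.val_lt M.one_lt l1 hs⟩
    have : s2.reg (temp t) = e.eval M.inp h := by
      rw [a2.reg _ fun t' ht' => temp_ne_of_lt ht', v1]
    simp [Instr.exec, State.setReg, this, v2, Expr.eval, Op.eval_eq M.one_lt l1 hs]
  | get k e ih =>
    rintro t s hr ⟨he, hi⟩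
    obtain ⟨s1, x1, a1, v1, -⟩ := ih t s hr he
    obtain ⟨s2, x2, a2, v2⟩ := addrCode_exec M k t _ hi s1 v1
    have a12 := a1.trans a2 le_rfl
    refine ⟨_, .seq x1 (.seq x2 (.instr _ _)), a12.trans (AgreeBelow.setReg _ t _) le_rfl, ?_,
      hr.a_lt k _ hi⟩
    simp [Instr.exec, State.setReg, v2, Expr.eval, (a12.rel hr).arr k _ hi]
  | inp e ih =>
    rintro t s hr ⟨he, hi⟩
    obtain ⟨s1, x1, a1, v1, -⟩ := ih t s hr he
    refine ⟨_, .seq x1 (.instr _ _), a1.trans (AgreeBelow.setReg _ t _) le_rfl, ?_,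
      M.inp_lt _ hi⟩
    simp [Instr.exec, State.setReg, v1, Expr.eval, (a1.rel hr).inp _ hi]

/-- Commands. -/
inductive Cmd : Type
  | skip
  | set (x : Var) (e : Expr)
  | put (k : Arr) (i e : Expr)
  | emit (e : Expr)
  | seq (p q : Cmd)
  | ite (e : Expr) (p q : Cmd)
  | loop (e : Expr) (p : Cmd)

namespace Cmd

def code : Cmd → Prog
  | skip => .instr .skip
  | set x e => .seq (e.code 0) (.seq (.instr (.const x.reg 0))
      (.instr (.binop .add x.reg x.reg (temp 0))))
  | put k i e => .seq (i.code 0) (.seq (addrCode k 0) (.seq (e.code 1)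
      (.instr (.store (temp 0) (temp 1)))))
  | emit e => .seq (e.code 0) (.instr (.emit (temp 0)))
  | seq p q => .seq p.code q.code
  | ite e p q => .seq (e.code 0) (.ite (temp 0) p.code q.code)
  | loop e p => .seq (e.code 0) (.loop (temp 0) (.seq p.code (e.code 0)))

end Cmd

/-! ### A program logic with time credits -/

/-- Started in the store `h` with `b` time credits, the command halts, and the final store and
some lower bound on the remaining credits satisfy `Q`. -/
def wp (M : Machine) (p : Cmd) (Q : Store → ℕ → Prop) (h : Store) (b : ℕ) : Prop :=
  ∀ s, Rel M h s → ∃ t s' h' b', Exec M.w M.ω p.code s t s' ∧ Rel M h' s' ∧ b' + t ≤ b ∧ Q h' b'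

theorem wp_mono {M : Machine} {p : Cmd} {Q Q' : Store → ℕ → Prop} {h : Store} {b : ℕ}
    (hp : wp M p Q h b) (hQ : ∀ h' b', Q h' b' → Q' h' b') : wp M p Q' h b := by
  intro s hs
  obtain ⟨t, s', h', b', h1, h2, h3, h4⟩ := hp s hs
  exact ⟨t, s', h', b', h1, h2, h3, hQ _ _ h4⟩

/-- A sufficient condition for `wp`, by symbolic execution up to the loops. -/
def vc (M : Machine) : Cmd → (Store → ℕ → Prop) → Store → ℕ → Prop
  | .skip, Q, h, b => 1 ≤ b ∧ Q h (b - 1)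
  | .set x e, Q, h, b => e.ok M h ∧ e.cost + 2 ≤ b ∧
      Q (h.set x (e.eval M.inp h)) (b - (e.cost + 2))
  | .put k i e, Q, h, b => i.ok M h ∧ i.eval M.inp h < M.cap ∧ e.ok M h ∧
      i.cost + e.cost + 7 ≤ b ∧
      Q (h.put k (i.eval M.inp h) (e.eval M.inp h)) (b - (i.cost + e.cost + 7))
  | .emit e, Q, h, b => e.ok M h ∧ e.cost + 1 ≤ b ∧ Q (h.emit (e.eval M.inp h)) (b - (e.cost + 1))
  | .seq p q, Q, h, b => vc M p (vc M q Q) h b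
  | .ite e p q, Q, h, b => e.ok M h ∧ e.cost + 1 ≤ b ∧
      (e.eval M.inp h ≠ 0 → vc M p Q h (b - (e.cost + 1))) ∧
      (e.eval M.inp h = 0 → vc M q Q h (b - (e.cost + 1)))
  | .loop e p, Q, h, b => wp M (.loop e p) Q h b

theorem vc_mono {M : Machine} {p : Cmd} {Q Q' : Store → ℕ → Prop} {h : Store} {b : ℕ}
    (hp : vc M p Q h b) (hQ : ∀ h' b', Q h' b' → Q' h' b') : vc M p Q' h b := by
  induction p generalizing Q Q' h b with
  | skip => exact ⟨hp.1, hQ _ _ hp.2⟩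
  | set x e => exact ⟨hp.1, hp.2.1, hQ _ _ hp.2.2⟩
  | put k i e => exact ⟨hp.1, hp.2.1, hp.2.2.1, hp.2.2.2.1, hQ _ _ hp.2.2.2.2⟩
  | emit e => exact ⟨hp.1, hp.2.1, hQ _ _ hp.2.2⟩
  | seq p q ihp ihq => exact ihp hp fun h' b' h => ihq h hQ
  | ite e p q ihp ihq =>
    exact ⟨hp.1, hp.2.1, fun h => ihp (hp.2.2.1 h) hQ, fun h => ihq (hp.2.2.2 h) hQ⟩
  | loop e p => exact wp_mono hp hQ

/-- All array cells lie strictly above the input, so that writing to an array never destroys it. -/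
theorem addr_lt {M : Machine} {k : Arr} {i : ℕ} (hi : i < M.cap) :
    32 * i + k.idx + 1 < 2 ^ M.w - M.len := by
  have := k.idx_lt
  have := M.fits
  omega

theorem Rel.set {M : Machine} {h : Store} {s : State} (hr : Rel M h s) (x : Var) {u : ℕ}
    (hu : u < 2 ^ M.w) {s' : State} (hreg : ∀ y : Var, s'.reg y.reg = if y = x then u else s.reg y.reg)
    (hmem : s'.mem = s.mem) (hout : s'.out = s.out) : Rel M (h.set x u) s' where
  reg y := by
    rw [hreg]
    split_ifs with hy
    · subst hy; simp
    · simp [hy, hr.reg]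
  v_lt y := by
    by_cases hy : y = x
    · subst hy; simpa
    · simpa [hy] using hr.v_lt y
  arr := by rw [hmem]; exact hr.arr
  a_lt := hr.a_lt
  inp := by rw [hmem]; exact hr.inp
  out := by rw [hout]; exact hr.out

/-- Array numbers are less than 32, hence different entries have different addresses. -/
theorem Rel.put {M : Machine} {h : Store} {s : State} (hr : Rel M h s) (k : Arr) {i u : ℕ}
    (hi : i < M.cap) (hu : u < 2 ^ M.w) : Rel M (h.put k i u)
      { s with mem := Function.update s.mem (2 ^ M.w - (32 * i + k.idx + 1)) u } where
  reg := hr.reg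
  v_lt := hr.v_lt
  arr k' i' hi' := by
    have h1 := addr_lt (k := k) hi
    have h2 := addr_lt (k := k') hi'
    have h3 := k.idx_lt
    have h4 := k'.idx_lt
    by_cases hk : k' = k
    · subst hk
      by_cases hii : i' = i
      · subst hii; simp
      · have : 2 ^ M.w - (32 * i' + k'.idx + 1) ≠ 2 ^ M.w - (32 * i + k'.idx + 1) := by omega
        simp [this, hii, hr.arr k' i' hi']
    · have : k'.idx ≠ k.idx := fun e => hk (Arr.idx_injective e)
      have : 2 ^ M.w - (32 * i' + k'.idx + 1) ≠ 2 ^ M.w - (32 * i + k.idx + 1) := by omega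
      simp [this, hk, hr.arr k' i' hi']
  a_lt k' i' hi' := by
    by_cases hk : k' = k
    · subst hk
      by_cases hii : i' = i
      · subst hii; simpa
      · simpa [hii] using hr.a_lt k' i' hi'
    · simpa [hk] using hr.a_lt k' i' hi'
  inp i' hi' := by
    have h1 := addr_lt (k := k) hi
    have : i' ≠ 2 ^ M.w - (32 * i + k.idx + 1) := by omega
    simp [this, hr.inp i' hi']
  out := hr.out

theorem wp_seq {M : Machine} {p q : Cmd} {Q : Store → ℕ → Prop} {h : Store} {b : ℕ}
    (hp : wp M p (wp M q Q) h b) : wp M (.seq p q) Q h b := by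
  intro s hs
  obtain ⟨t1, s1, h1, b1, x1, r1, l1, q1⟩ := hp s hs
  obtain ⟨t2, s2, h2, b2, x2, r2, l2, q2⟩ := q1 s1 r1
  exact ⟨_, _, _, _, .seq x1 x2, r2, by omega, q2⟩

theorem wp_ite {M : Machine} {e : Expr} {p q : Cmd} {Q : Store → ℕ → Prop} {h : Store} {b : ℕ}
    (h1 : e.ok M h) (h2 : e.cost + 1 ≤ b)
    (h3 : e.eval M.inp h ≠ 0 → wp M p Q h (b - (e.cost + 1)))
    (h4 : e.eval M.inp h = 0 → wp M q Q h (b - (e.cost + 1))) : wp M (.ite e p q) Q h b := by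
  intro s hs
  obtain ⟨s1, x1, a1, v1, l1⟩ := e.exec M h 0 s hs h1
  by_cases h0 : e.eval M.inp h = 0
  · obtain ⟨t2, s2, h', b2, x2, r2, l2, q2⟩ := h4 h0 s1 (a1.rel hs)
    exact ⟨_, _, _, _, .seq x1 (.ite_false (by rw [v1, h0]) x2), r2, by omega, q2⟩
  · obtain ⟨t2, s2, h', b2, x2, r2, l2, q2⟩ := h3 h0 s1 (a1.rel hs)
    exact ⟨_, _, _, _, .seq x1 (.ite_true (by rwa [v1]) x2), r2, by omega, q2⟩

theorem wp_of_vc {M : Machine} {p : Cmd} {Q : Store → ℕ → Prop} {h : Store} {b : ℕ}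
    (hp : vc M p Q h b) : wp M p Q h b := by
  induction p generalizing Q h b with
  | skip => exact fun s hs => ⟨1, s, h, b - 1, .instr _ _, hs, by have := hp.1; omega, hp.2⟩
  | set x e =>
    intro s hs
    obtain ⟨h1, h2, h3⟩ := hp
    obtain ⟨s1, x1, a1, v1, l1⟩ := e.exec M h 0 s hs h1
    refine ⟨_, _, _, _, .seq x1 (.seq (.instr _ _) (.instr _ _)), (a1.rel hs).set x l1 ?_ rfl rfl,
      by omega, h3⟩
    intro y
    by_cases hy : y = x
    · subst hy
      simp [Instr.exec, State.setReg, Op.eval, (y.reg_ne_temp 0).symm, v1, Nat.mod_eq_of_lt l1]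
    · have : y.reg ≠ x.reg := fun h' => hy (Var.idx_injective (by unfold Var.reg at h'; omega))
      simp [Instr.exec, State.setReg, hy, this]
  | put k i e =>
    intro s hs
    obtain ⟨h1, h2, h3, h4, h5⟩ := hp
    obtain ⟨s1, x1, a1, v1, l1⟩ := i.exec M h 0 s hs h1
    obtain ⟨s2, x2, a2, v2⟩ := addrCode_exec M k 0 _ h2 s1 v1
    have a12 := a1.trans a2 le_rfl
    obtain ⟨s3, x3, a3, v3, l3⟩ := e.exec M h 1 s2 (a12.rel hs) h3
    have v2' : s3.reg (temp 0) = _ := (a3.reg _ fun t' ht' => temp_ne_of_lt ht').trans v2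
    refine ⟨_, _, _, _, .seq x1 (.seq x2 (.seq x3 (.instr _ _))), ?_, ?_, h5⟩
    · simp only [Instr.exec, v2', v3]
      exact ((a12.trans a3 (Nat.zero_le _)).rel hs).put k h2 l3
    · omega
  | emit e =>
    intro s hs
    obtain ⟨h1, h2, h3⟩ := hp
    obtain ⟨s1, x1, a1, v1, l1⟩ := e.exec M h 0 s hs h1
    have hr := a1.rel hs
    exact ⟨_, _, h.emit _, _, .seq x1 (.instr _ _), ⟨hr.reg, hr.v_lt, hr.arr, hr.a_lt, hr.inp,
      by simp [Instr.exec, hr.out, v1]⟩, by omega, h3⟩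
  | seq p q ihp ihq => exact wp_seq (wp_mono (ihp hp) fun _ _ => ihq)
  | ite e p q ihp ihq =>
    exact wp_ite hp.1 hp.2.1 (fun h => ihp (hp.2.2.1 h)) fun h => ihq (hp.2.2.2 h)
  | loop e p => exact hp

/-- The loop rule: every round consumes credits, so the loop halts. -/
theorem wp_loop {M : Machine} {e : Expr} {p : Cmd} {Q : Store → ℕ → Prop} {h : Store} {b : ℕ}
    (I : Store → ℕ → Prop) (h0 : I h b)
    (step : ∀ h b, I h b → e.ok M h ∧ e.cost + 1 ≤ b ∧
      (e.eval M.inp h ≠ 0 → vc M p I h (b - (e.cost + 1))) ∧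
      (e.eval M.inp h = 0 → Q h (b - (e.cost + 1)))) :
    wp M (.loop e p) Q h b := by
  induction b using Nat.strong_induction_on generalizing h with
  | _ b ih =>
    intro s hs
    obtain ⟨h1, h2, h3, h4⟩ := step h b h0
    obtain ⟨s1, x1, a1, v1, l1⟩ := e.exec M h 0 s hs h1
    by_cases hz : e.eval M.inp h = 0
    · exact ⟨_, _, _, _, .seq x1 (Exec.loop_stop (by rw [v1, hz])), a1.rel hs, by omega, h4 hz⟩
    · obtain ⟨t2, s2, h', b2, x2, r2, l2, q2⟩ := wp_of_vc (h3 hz) s1 (a1.rel hs)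
      obtain ⟨t3, s3, h3, b3, x3, r3, l3, q3⟩ := ih b2 (by omega) q2 s2 r2
      -- The induction hypothesis concerns the whole command, whose code begins with the test. Its
      -- run is split so that this evaluation becomes the end of the present round.
      cases x3 with
      | seq y1 y2 =>
        exact ⟨_, _, _, _, .seq x1 (.loop_step (by rwa [v1]) (.seq x2 y1) y2), r3, by omega, q3⟩

end WordRAM

/-! ### Windows, shapes and borders -/

namespace SetMatch

open Finset

variable {α : Type} [DecidableEq α] (X : ℕ → Finset α)

/-- The windows of length `l` at `a` and at `b` set-parameterized match. -/
def PMatchAt (a b l : ℕ) : Prop :=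
  ∃ π : Equiv.Perm α, ∀ i < l, (X (a + i)).map π.toEmbedding = X (b + i)

/-- The distances from `c` back to the positions of `s, …, c` with character `σ`. -/
def shape (σ : α) (s c : ℕ) : Finset ℕ := (range (c + 1 - s)).filter fun d => σ ∈ X (c - d)

/-- The occurrences of `σ` in the window of length `l` at `a`, relative to `a`. -/
def occ (a l : ℕ) (σ : α) : Finset ℕ := (range l).filter fun i => σ ∈ X (a + i)

variable {X}

theorem mem_shape {σ : α} {s c d : ℕ} : d ∈ shape X σ s c ↔ d < c + 1 - s ∧ σ ∈ X (c - d) := by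
  simp [shape]

theorem mem_occ {σ : α} {a l i : ℕ} : i ∈ occ X a l σ ↔ i < l ∧ σ ∈ X (a + i) := by
  simp [occ]

/-- Together with transitivity, restriction and shifting below, this is everything that the theory
of borders uses about matching. -/
theorem PMatchAt.symm {a b l : ℕ} (h : PMatchAt X a b l) : PMatchAt X b a l := by
  obtain ⟨π, hπ⟩ := h
  refine ⟨π.symm, fun i hi => ?_⟩
  rw [← hπ i hi, map_map]
  ext; simp

theorem PMatchAt.trans {a b c l : ℕ} (h : PMatchAt X a b l) (h' : PMatchAt X b c l) :
    PMatchAt X a c l := by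
  obtain ⟨π, hπ⟩ := h
  obtain ⟨ρ, hρ⟩ := h'
  refine ⟨π.trans ρ, fun i hi => ?_⟩
  rw [← hρ i hi, ← hπ i hi, map_map]
  rfl

theorem PMatchAt.mono {a b l l' : ℕ} (h : PMatchAt X a b l) (hl : l' ≤ l) : PMatchAt X a b l' := by
  obtain ⟨π, hπ⟩ := h
  exact ⟨π, fun i hi => hπ i (by omega)⟩

theorem PMatchAt.shift {a b l : ℕ} (h : PMatchAt X a b l) (d : ℕ) :
    PMatchAt X (a + d) (b + d) (l - d) := by
  obtain ⟨π, hπ⟩ := h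
  exact ⟨π, fun i hi => by simpa [add_assoc] using hπ (d + i) (by omega)⟩

theorem pMatchAt_zero (a b : ℕ) : PMatchAt X a b 0 := ⟨1, fun i hi => by omega⟩

theorem PMatchAt.card_eq {a b l : ℕ} (h : PMatchAt X a b l) {i : ℕ} (hi : i < l) :
    (X (a + i)).card = (X (b + i)).card := by
  obtain ⟨π, hπ⟩ := h
  rw [← hπ i hi, card_map]

/-- The incidence relation between positions and characters is read by columns instead of rows. -/
theorem pMatchAt_iff_occ {a b l : ℕ} :
    PMatchAt X a b l ↔ ∃ π : Equiv.Perm α, ∀ σ, occ X b l (π σ) = occ X a l σ := by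
  constructor
  · rintro ⟨π, hπ⟩
    refine ⟨π, fun σ => ?_⟩
    ext i
    simp only [mem_occ]
    refine and_congr_right fun hi => ?_
    rw [← hπ i hi]
    simp
  · rintro ⟨π, hπ⟩
    refine ⟨π, fun i hi => ?_⟩
    ext τ
    obtain ⟨σ, rfl⟩ := π.surjective τ
    have := Finset.ext_iff.1 (hπ σ) i
    simp only [mem_occ, hi, true_and] at this
    simp [this]

/-- Two functions with the same multiset of values differ by a permutation. -/
theorem map_univ_eq_iff_exists_perm {β : Type} [Fintype α] [DecidableEq β] {f g : α → β} :
    univ.val.map f = univ.val.map g ↔ ∃ π : Equiv.Perm α, ∀ σ, g (π σ) = f σ := by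
  constructor
  · intro h
    -- Equal multiplicities make corresponding fibres equinumerous; bijections between the fibres
    -- are then glued together.
    have hc : ∀ y, Nonempty ({x // f x = y} ≃ {x // g x = y}) := by
      intro y
      have h1 := congrArg (Multiset.count y) h
      simp only [Multiset.count_map] at h1
      refine ⟨Fintype.equivOfCardEq ?_⟩
      simp only [Fintype.card_subtype]
      simpa [Finset.card_def, Finset.filter_val, eq_comm] using h1
    refine ⟨(Equiv.sigmaFiberEquiv f).symm.trans
      ((Equiv.sigmaCongrRight fun y => (hc y).some).trans (Equiv.sigmaFiberEquiv g)), fun σ => ?_⟩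
    simpa [Equiv.sigmaFiberEquiv] using ((hc (f σ)).some ⟨σ, rfl⟩).2
  · rintro ⟨π, hπ⟩
    have : f = g ∘ π := funext fun σ => (hπ σ).symm
    rw [this, ← Multiset.map_map, Multiset.map_univ_val_equiv]

/-- This removes the permutation: matching becomes an equality of multisets, in which terms can be
cancelled. -/
theorem pMatchAt_iff_map [Fintype α] {a b l : ℕ} :
    PMatchAt X a b l ↔ univ.val.map (occ X a l) = univ.val.map (occ X b l) := by
  rw [pMatchAt_iff_occ, map_univ_eq_iff_exists_perm]

theorem occ_succ (a l : ℕ) (σ : α) :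
    occ X a (l + 1) σ = if σ ∈ X (a + l) then insert l (occ X a l σ) else occ X a l σ := by
  ext i
  split_ifs with h <;> simp only [mem_insert, mem_occ, Nat.lt_succ_iff_lt_or_eq]
  · constructor
    · rintro ⟨h1 | rfl, h2⟩
      · exact .inr ⟨h1, h2⟩
      · exact .inl rfl
    · rintro (rfl | ⟨h1, h2⟩)
      · exact ⟨.inr rfl, h⟩
      · exact ⟨.inl h1, h2⟩
  · constructor
    · rintro ⟨h1 | rfl, h2⟩
      · exact ⟨h1, h2⟩
      · exact absurd h2 h
    · exact fun h' => ⟨.inl h'.1, h'.2⟩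

/-- The reflection `i ↦ l - i` exchanges positions counted from the start of the window and
distances counted from its end. It is an involution on `0, …, l`, whence the converse below. -/
theorem shape_eq_image_occ (a l : ℕ) (σ : α) :
    shape X σ a (a + l) = (occ X a (l + 1) σ).image (l - ·) := by
  ext d
  simp only [mem_shape, mem_image, mem_occ]
  constructor
  · rintro ⟨h1, h2⟩
    exact ⟨l - d, ⟨by omega, by rwa [← Nat.add_sub_assoc (by omega)]⟩, by omega⟩
  · rintro ⟨i, ⟨h1, h2⟩, rfl⟩
    exact ⟨by omega, by rwa [show a + l - (l - i) = a + i by omega]⟩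

theorem occ_eq_image_shape (a l : ℕ) (σ : α) :
    occ X a (l + 1) σ = (shape X σ a (a + l)).image (l - ·) := by
  ext i
  simp only [mem_shape, mem_image, mem_occ]
  constructor
  · rintro ⟨h1, h2⟩
    exact ⟨l - i, ⟨by omega, by rwa [show a + l - (l - i) = a + i by omega]⟩, by omega⟩
  · rintro ⟨d, ⟨h1, h2⟩, rfl⟩
    exact ⟨by omega, by rwa [← Nat.add_sub_assoc (by omega)]⟩

/-- Windows that match can be extended if the next sets have the same multiset of shapes. -/
theorem PMatchAt.succ_iff [Fintype α] {a b l : ℕ} (h : PMatchAt X a b l) :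
    PMatchAt X a b (l + 1) ↔ (X (a + l)).val.map (fun σ => shape X σ a (a + l)) =
      (X (b + l)).val.map fun σ => shape X σ b (b + l) := by
  constructor
  · intro h'
    obtain ⟨π, hπ⟩ := h'
    have hπ' : ∀ σ, occ X b (l + 1) (π σ) = occ X a (l + 1) σ := by
      intro σ
      ext i
      simp only [mem_occ]
      refine and_congr_right fun hi => ?_
      rw [← hπ i hi]
      simp
    rw [← hπ l (Nat.lt_succ_self l), map_val, Multiset.map_map]
    refine Multiset.map_congr rfl fun σ _ => ?_
    simp [shape_eq_image_occ, hπ']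
  · intro h'
    have h1 : (X (a + l)).val.map (occ X a (l + 1)) = (X (b + l)).val.map (occ X b (l + 1)) := by
      have := congrArg (Multiset.map fun D : Finset ℕ => D.image (l - ·)) h'
      simpa only [Multiset.map_map, Function.comp_def, ← occ_eq_image_shape] using this
    have key : ∀ c, (univ.filter (· ∈ X (c + l))).val = (X (c + l)).val := by
      intro c; congr 1; ext; simp
    -- The alphabet is split into the characters of the next set and the others. On the former, the
    -- old occurrence sets arise from the new ones by erasing `l`, so by `h1` these parts agree for
    -- `a` and `b` and cancel in `h`. On the latter, old and new occurrence sets coincide.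
    have h2 : ∀ c, (X (c + l)).val.map (occ X c l) =
        ((X (c + l)).val.map (occ X c (l + 1))).map fun D => D.erase l := by
      intro c
      rw [Multiset.map_map]
      refine Multiset.map_congr rfl fun σ hσ => ?_
      have : l ∉ occ X c l σ := by simp [mem_occ]
      simp [occ_succ, mem_def.2 hσ, this]
    have h3 : ∀ (c : ℕ) (F : α → Finset ℕ), univ.val.map F = (X (c + l)).val.map F +
        (univ.filter (· ∉ X (c + l))).val.map F := by
      intro c F
      rw [← key, ← Multiset.map_add]
      congr 1
      exact (Multiset.filter_add_not _ _).symm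
    have h4 : ∀ c, (univ.filter (· ∉ X (c + l))).val.map (occ X c (l + 1)) =
        (univ.filter (· ∉ X (c + l))).val.map (occ X c l) := by
      intro c
      refine Multiset.map_congr rfl fun σ hσ => ?_
      have : σ ∉ X (c + l) := by simpa using mem_def.2 hσ
      simp [occ_succ, this]
    rw [pMatchAt_iff_map] at h ⊢
    rw [h3 a, h3 b, h2, h2, h1] at h
    rw [h3 a, h3 b, h4, h4, h1, add_left_cancel h]

/-! ### Initial parts and extensions of shapes -/

/-- `E` consists of the smallest elements of `D`. -/
def Low (E D : Finset ℕ) : Prop := E ⊆ D ∧ ∀ x ∈ E, ∀ y ∈ D, y ≤ x → y ∈ E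

/-- The shape `D` after one more occurrence at distance `g`. -/
def child (D : Finset ℕ) (g : ℕ) : Finset ℕ := insert 0 (D.image (· + g))

theorem mem_child {D : Finset ℕ} {g x : ℕ} : x ∈ child D g ↔ x = 0 ∨ ∃ y ∈ D, y + g = x := by
  simp [child]

theorem Low.refl (D : Finset ℕ) : Low D D := ⟨Subset.rfl, fun _ _ _ h _ => h⟩

theorem low_empty (D : Finset ℕ) : Low ∅ D := ⟨empty_subset _, fun _ h => by simp at h⟩

theorem Low.trans {E D F : Finset ℕ} (h : Low E D) (h' : Low D F) : Low E F :=
  ⟨h.1.trans h'.1, fun x hx y hy hyx => h.2 x hx y (h'.2 x (h.1 hx) y hy hyx) hyx⟩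

/-- Initial parts of one set form a chain, so inclusion between them is decided by cardinality. The
program can therefore work with depths alone. -/
theorem Low.total {E F D : Finset ℕ} (hE : Low E D) (hF : Low F D) : E ⊆ F ∨ F ⊆ E := by
  by_contra! hcon
  obtain ⟨x, hx, hx'⟩ := not_subset.1 hcon.1
  obtain ⟨y, hy, hy'⟩ := not_subset.1 hcon.2
  rcases le_total x y with h | h
  · exact hx' (hF.2 y hy x (hE.1 hx) h)
  · exact hy' (hE.2 x hx y (hF.1 hy) h)

theorem Low.subset_of_card_le {E F D : Finset ℕ} (hE : Low E D) (hF : Low F D)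
    (h : E.card ≤ F.card) : E ⊆ F := by
  rcases hE.total hF with h' | h'
  · exact h'
  · rw [eq_of_subset_of_card_le h' h]

theorem Low.of_subset {E F D : Finset ℕ} (hE : Low E D) (hF : Low F D) (h : E ⊆ F) : Low E F :=
  ⟨h, fun x hx y hy hyx => hE.2 x hx y (hF.1 hy) hyx⟩

theorem Low.card_lt {E D : Finset ℕ} (h : Low E D) (hne : E ≠ D) : E.card < D.card :=
  card_lt_card (h.1.ssubset_of_ne hne)

theorem child_empty (g : ℕ) : child ∅ g = {0} := by simp [child]

theorem child_nonempty (D : Finset ℕ) (g : ℕ) : child D g ≠ ∅ := by simp [child]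

theorem child_injective {D E : Finset ℕ} {g : ℕ} (hg : 0 < g) (h : child D g = child E g) :
    D = E := by
  ext x
  have := Finset.ext_iff.1 h (x + g)
  simpa [mem_child, hg.ne'] using this

theorem card_child {D : Finset ℕ} {g : ℕ} (hg : 0 < g) : (child D g).card = D.card + 1 := by
  rw [child, card_insert_of_notMem (by simp [hg.ne']),
    card_image_of_injective _ (add_left_injective g)]

theorem Low.child {E D : Finset ℕ} (h : Low E D) {g : ℕ} (hg : 0 < g) :
    Low (child E g) (child D g) := by
  refine ⟨insert_subset_insert _ (image_subset_image h.1), fun x hx y hy hyx => ?_⟩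
  rw [mem_child] at *
  rcases hy with rfl | ⟨y, hy, rfl⟩
  · exact .inl rfl
  · rcases hx with rfl | ⟨x, hx, rfl⟩
    · omega
    · exact .inr ⟨y, h.2 x hx y hy (by omega), rfl⟩

/-- A nonempty initial part contains 0, and the rest can be shifted back by `g`. Hence the failure
link of a child is to be sought among the children of initial parts of its parent. -/
theorem Low.exists_child {F D : Finset ℕ} {g : ℕ} (h : Low F (SetMatch.child D g))
    (hF : F ≠ ∅) : ∃ E, Low E D ∧ F = SetMatch.child E g := by
  obtain ⟨z, hz⟩ := nonempty_iff_ne_empty.2 hF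
  have h0 : 0 ∈ F := h.2 z hz 0 (by simp [mem_child]) (Nat.zero_le _)
  refine ⟨D.filter fun d => d + g ∈ F, ⟨filter_subset _ _, fun x hx y hy hyx => ?_⟩, ?_⟩
  · rw [mem_filter] at *
    exact ⟨hy, h.2 _ hx.2 _ (mem_child.2 (.inr ⟨y, hy, rfl⟩)) (by omega)⟩
  · ext x
    rw [mem_child]
    constructor
    · intro hx
      rcases mem_child.1 (h.1 hx) with rfl | ⟨y, hy, rfl⟩
      · exact .inl rfl
      · exact .inr ⟨y, mem_filter.2 ⟨hy, hx⟩, rfl⟩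
    · rintro (rfl | ⟨y, hy, rfl⟩)
      · exact h0
      · exact (mem_filter.1 hy).2

theorem zero_mem_shape {σ : α} {s c : ℕ} (h : σ ∈ X c) (hs : s ≤ c) : 0 ∈ shape X σ s c :=
  mem_shape.2 ⟨by omega, by simpa⟩

theorem shape_eq_empty {σ : α} {s c : ℕ} (h : c < s) : shape X σ s c = ∅ := by
  simp [shape, show c + 1 - s = 0 by omega]

/-- The shape at `c`, if the occurrences before `c` are those up to `c'`. -/
theorem shape_eq_child {σ : α} {s c c' : ℕ} (hσ : σ ∈ X c) (hs : s ≤ c) (hc : c' < c)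
    (hno : ∀ i, s ≤ i → c' < i → i < c → σ ∉ X i) :
    shape X σ s c = child (shape X σ s c') (c - c') := by
  ext d
  rw [mem_child]
  constructor
  · intro hd
    rw [mem_shape] at hd
    rcases Nat.eq_zero_or_pos d with rfl | hpos
    · exact .inl rfl
    · refine .inr ⟨d - (c - c'), mem_shape.2 ?_, ?_⟩
      all_goals
        have : ¬ c' < c - d := fun h' => hno (c - d) (by omega) h' (by omega) hd.2
      · exact ⟨by omega, by rw [show c' - (d - (c - c')) = c - d by omega]; exact hd.2⟩
      · omega
  · rintro (rfl | ⟨e, he, rfl⟩)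
    · exact zero_mem_shape hσ hs
    · rw [mem_shape] at he ⊢
      exact ⟨by omega, by rw [show c - (e + (c - c')) = c' - e by omega]; exact he.2⟩

theorem shape_succ_of_notMem {σ : α} {s c : ℕ} (h : σ ∉ X s) :
    shape X σ (s + 1) c = shape X σ s c := by
  ext d
  rw [mem_shape, mem_shape]
  refine ⟨fun h' => ⟨by omega, h'.2⟩, fun h' => ⟨?_, h'.2⟩⟩
  by_contra hd
  exact h (by rw [show s = c - d by omega]; exact h'.2)

/-- Moving the start of the window forward can only remove the largest distance. -/
theorem low_shape_succ {σ : α} {s c : ℕ} : Low (shape X σ (s + 1) c) (shape X σ s c) := by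
  refine ⟨fun d hd => ?_, fun x hx y hy hyx => ?_⟩
  · rw [mem_shape] at *; exact ⟨by omega, hd.2⟩
  · rw [mem_shape] at *; exact ⟨by omega, hy.2⟩

theorem card_shape_succ_of_mem {σ : α} {s c : ℕ} (h : σ ∈ X s) (hs : s ≤ c) :
    (shape X σ s c).card = (shape X σ (s + 1) c).card + 1 := by
  have : shape X σ s c = insert (c - s) (shape X σ (s + 1) c) := by
    ext d
    rw [mem_insert, mem_shape, mem_shape]
    constructor
    · intro h'
      by_cases hd : d = c - s
      · exact .inl hd
      · exact .inr ⟨by omega, h'.2⟩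
    · rintro (rfl | h')
      · exact ⟨by omega, by rwa [show c - (c - s) = s by omega]⟩
      · exact ⟨by omega, h'.2⟩
  rw [this, card_insert_of_notMem]
  rw [mem_shape]; omega

/-- The shapes of the occurrences in the prefix of length `m`, and the trivial shapes. -/
def InTrie (X : ℕ → Finset α) (m : ℕ) (D : Finset ℕ) : Prop :=
  D = ∅ ∨ D = {0} ∨ ∃ e < m, ∃ τ ∈ X e, D = shape X τ 0 e

theorem InTrie.zero_mem {m : ℕ} {D : Finset ℕ} (h : InTrie X m D) (hD : D ≠ ∅) : 0 ∈ D := by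
  rcases h with rfl | rfl | ⟨e, -, τ, hτ, rfl⟩
  · exact absurd rfl hD
  · simp
  · exact zero_mem_shape hτ (Nat.zero_le _)

/-- If `child E g` is the shape at `e` and `0 ∈ E`, then `g` is the distance to the preceding
occurrence, and `E` is the shape at `e - g`. -/
theorem InTrie.of_child {m : ℕ} {E : Finset ℕ} {g : ℕ} (h : InTrie X m (child E g))
    (hE : E = ∅ ∨ 0 ∈ E) (hg : 0 < g) : InTrie X m E := by
  rcases hE with rfl | hE
  · exact .inl rfl
  have hgm : g ∈ child E g := mem_child.2 (.inr ⟨0, hE, by simp⟩)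
  rcases h with h | h | ⟨e, he, τ, hτ, h⟩
  · exact absurd h (child_nonempty _ _)
  · rw [h, mem_singleton] at hgm; omega
  · have h1 := hgm
    rw [h, mem_shape] at h1
    refine .inr (.inr ⟨e - g, by omega, τ, h1.2, child_injective hg ?_⟩)
    rw [h, shape_eq_child hτ (Nat.zero_le _) (show e - g < e by omega),
      show e - (e - g) = g by omega]
    intro i _ hi hie hmem
    have : e - i ∈ child E g := by
      rw [h, mem_shape]; exact ⟨by omega, by rwa [show e - (e - i) = i by omega]⟩
    rcases mem_child.1 this with h2 | ⟨y, -, h2⟩ <;> omega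

/-- In a window that matches a prefix, the shapes are shapes of the prefix. -/
theorem PMatchAt.inTrie {s l m last : ℕ} (h : PMatchAt X 0 s l) (hl : l ≤ m) {σ : α}
    (hσ : s ≤ last → σ ∈ X last) (hlast : last < s + l) : InTrie X m (shape X σ s last) := by
  by_cases hs : s ≤ last
  · obtain ⟨π, hπ⟩ := h
    have key : ∀ i < l, ∀ τ, τ ∈ X i ↔ π τ ∈ X (s + i) := by
      intro i hi τ
      rw [← hπ i hi]; simp
    refine .inr (.inr ⟨last - s, by omega, π.symm σ, ?_, ?_⟩)
    · rw [key _ (by omega), Equiv.apply_symm_apply, show s + (last - s) = last by omega]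
      exact hσ hs
    · ext d
      rw [mem_shape, mem_shape]
      constructor
      · rintro ⟨h1, h2⟩
        refine ⟨by omega, ?_⟩
        rw [key _ (by omega), Equiv.apply_symm_apply, show s + (last - s - d) = last - d by omega]
        exact h2
      · rintro ⟨h1, h2⟩
        refine ⟨by omega, ?_⟩
        rw [key _ (by omega), Equiv.apply_symm_apply,
          show s + (last - s - d) = last - d by omega] at h2
        exact h2
  · exact .inl (shape_eq_empty (by omega))

/-- If the prefix of length `d + f` has a border of length `f`, the set at `f` has the size of some
set at one of the first `d` positions. -/
theorem exists_card_eq_of_border {d f : ℕ} (hd : 0 < d) (h : PMatchAt X 0 d f) :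
    ∃ r < d, (X r).card = (X f).card := by
  -- The border makes the sizes of the sets periodic with period `d`; subtract `d` until the
  -- position is less than `d`.
  have key : ∀ j, j < d + f → ∃ r < d, (X r).card = (X j).card := by
    intro j
    induction j using Nat.strong_induction_on with
    | _ j ih =>
      intro hj
      by_cases hjd : j < d
      · exact ⟨j, hjd, rfl⟩
      · obtain ⟨r, hr, he⟩ := ih (j - d) (by omega) (by omega)
        refine ⟨r, hr, he.trans ?_⟩
        have := h.card_eq (show j - d < f by omega)
        rwa [zero_add, show d + (j - d) = j by omega] at this
  exact key f (by omega)

/-- `f` is the length of the longest proper border of the prefix of length `l`. -/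
def IsBorder (X : ℕ → Finset α) (l f : ℕ) : Prop :=
  f < l ∧ PMatchAt X 0 (l - f) f ∧ ∀ s, 0 < s → s < l - f → ¬ PMatchAt X 0 s (l - s)

/-- No match that starts strictly between `s` and the next candidate can reach `c`. -/
theorem IsBorder.not_pMatchAt {l f s s' : ℕ} (hf : IsBorder X l f) (h : PMatchAt X 0 s l)
    (h1 : s < s') (h2 : s' < s + (l - f)) : ¬ PMatchAt X 0 s' (s + l - s') := by
  intro h'
  refine hf.2.2 (s' - s) (by omega) (by omega) ?_
  have h3 := h.shift (s' - s)
  rw [zero_add, show s + (s' - s) = s' by omega] at h3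
  rw [show s + l - s' = l - (s' - s) by omega] at h'
  exact h'.trans h3.symm

theorem IsBorder.pMatchAt {l f s : ℕ} (hf : IsBorder X l f) (h : PMatchAt X 0 s l) :
    PMatchAt X 0 (s + (l - f)) f := by
  have h3 := h.shift (l - f)
  rw [zero_add, show l - (l - f) = f by have := hf.1; omega] at h3
  exact hf.2.1.trans h3

end SetMatch

/-! ### The first passes over the input -/

namespace SetMatch

open Finset WordRAM

attribute [simp] vc Expr.eval Expr.ok Expr.cost Op.val Op.safe

instance : Coe Var Expr := ⟨.var⟩

infixl:65 " +ₑ " => Expr.bin Op.add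
infixl:65 " -ₑ " => Expr.bin Op.sub
infixl:70 " *ₑ " => Expr.bin Op.mul
infix:50 " <ₑ " => Expr.bin Op.lt
infix:50 " =ₑ " => Expr.bin Op.eq
infixr:30 " ;; " => Cmd.seq

theorem eval_lt_ne_zero {I : ℕ → ℕ} {h : Store} {e f : Expr} :
    (e <ₑ f).eval I h ≠ 0 ↔ e.eval I h < f.eval I h := by
  show (if e.eval I h < f.eval I h then 1 else 0) ≠ 0 ↔ _
  split_ifs with hlt <;> simp [hlt]

theorem eval_lt_eq_zero {I : ℕ → ℕ} {h : Store} {e f : Expr} :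
    (e <ₑ f).eval I h = 0 ↔ f.eval I h ≤ e.eval I h := by
  rw [← not_iff_not, not_le]
  exact eval_lt_ne_zero

/-- Only the variables in `vs` and the arrays in `as` may differ. -/
structure Frame (vs : List Var) (as : List Arr) (h h' : Store) : Prop where
  v : ∀ y ∉ vs, h'.v y = h.v y
  a : ∀ k ∉ as, h'.a k = h.a k

namespace Frame

variable {vs : List Var} {as : List Arr} {h h' h'' : Store}

theorem refl (vs : List Var) (as : List Arr) (h : Store) : Frame vs as h h :=
  ⟨fun _ _ => rfl, fun _ _ => rfl⟩

theorem trans (h1 : Frame vs as h h') (h2 : Frame vs as h' h'') : Frame vs as h h'' :=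
  ⟨fun y hy => (h2.v y hy).trans (h1.v y hy), fun k hk => (h2.a k hk).trans (h1.a k hk)⟩

theorem mono {vs' : List Var} {as' : List Arr} (h1 : Frame vs as h h') (hv : vs ⊆ vs')
    (ha : as ⊆ as') : Frame vs' as' h h' :=
  ⟨fun y hy => h1.v y fun h => hy (hv h), fun k hk => h1.a k fun h => hk (ha h)⟩

theorem set (h1 : Frame vs as h h') {x : Var} (hx : x ∈ vs) (u : ℕ) : Frame vs as h (h'.set x u) :=
  ⟨fun y hy => by rw [Store.set_v_of_ne _ _ _ _ (fun e => hy (by rwa [e])), h1.v y hy], h1.a⟩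

theorem put (h1 : Frame vs as h h') {k : Arr} (hk : k ∈ as) (i u : ℕ) :
    Frame vs as h (h'.put k i u) :=
  ⟨h1.v, fun y hy => by rw [Store.put_a_of_ne _ _ _ _ _ (fun e => hy (by rwa [e])), h1.a y hy]⟩

end Frame

/-- Record the addresses of `cnt` consecutive sets, the first one at `blk`, in the array `ptr`. -/
def ptrLoop (base : Expr) (cnt : Var) : Cmd :=
  .set .i (.lit 0) ;;
  .loop (.var .i <ₑ cnt)
    (.put .ptr (base +ₑ Var.i) Var.blk ;;
     .set .blk (.var .blk +ₑ .inp Var.blk +ₑ .lit 1) ;;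
     .set .i (.var .i +ₑ .lit 1))

/-- The invariant of `ptrLoop`. -/
structure PtrInv (cnt : Var) (b0 : ℕ) (ad : ℕ → ℕ) (h : Store) (b : ℕ) (h' : Store) (b' : ℕ) :
    Prop where
  le : h'.v .i ≤ h.v cnt
  blk : h'.v .blk = ad (h'.v .i)
  frame : Frame [.i, .blk] [.ptr] h h'
  out : h'.out = h.out
  ptr : ∀ x, h'.a .ptr x = if b0 ≤ x ∧ x < b0 + h'.v .i then ad (x - b0) else h.a .ptr x
  spent : b ≤ b' + 60 * h'.v .i + 3
  credit : 60 * (h.v cnt - h'.v .i) + 7 ≤ b'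

/-- In the memory the text precedes the pattern, in `ptr` it follows it. The loop is therefore used
twice: with base `m` for the text, then with base 0 for the pattern. The first use leaves `blk` at
the start of the pattern. -/
theorem ptrLoop_spec {M : Machine} {base : Expr} {cnt : Var} {h : Store} {b b0 : ℕ}
    {ad : ℕ → ℕ} (hcnt : cnt ≠ .i ∧ cnt ≠ .blk)
    (hbase : base = .var .m ∧ h.v .m = b0 ∨ base = .lit 0 ∧ b0 = 0)
    (hblk : h.v .blk = ad 0)
    (had : ∀ i < h.v cnt, ad (i + 1) = ad i + M.inp (ad i) + 1)
    (hlen : ∀ i < h.v cnt, ad (i + 1) ≤ M.len) (hcap : b0 + h.v cnt + M.len < M.cap)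
    (hb : 60 * h.v cnt + 10 ≤ b) :
    wp M (ptrLoop base cnt) (fun h' b' => b ≤ b' + 60 * h.v cnt + 10 ∧
      Frame [.i, .blk] [.ptr] h h' ∧ h'.out = h.out ∧ h'.v .blk = ad (h.v cnt) ∧
      ∀ x, h'.a .ptr x = if b0 ≤ x ∧ x < b0 + h.v cnt then ad (x - b0) else h.a .ptr x) h b := by
  have hfits := M.fits
  have hw : M.w ≠ 0 := by have := M.one_lt; intro h0; simp [h0] at this
  apply wp_of_vc
  unfold ptrLoop
  simp only [vc, Expr.ok, Expr.cost, Expr.eval]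
  refine ⟨by omega, by omega, wp_loop (PtrInv cnt b0 ad h b) ?_ ?_⟩
  · refine ⟨by simp, by simpa using hblk, (Frame.refl _ _ _).set (by simp) _, rfl, ?_, by simp; omega,
      by simp; omega⟩
    intro x
    rw [if_neg (by simp)]; rfl
  · rintro h' b' hI
    have hc : h'.v cnt = h.v cnt := hI.frame.v _ (by simp [hcnt])
    have hb' := hI.credit
    refine ⟨by simp, by simp only [Expr.cost]; omega, ?_, ?_⟩
    · intro hlt
      have hlt : h'.v .i < h.v cnt := by simpa [hc] using hlt
      have h1 := had _ hlt
      have h2 := hlen _ hlt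
      have h3 : base.ok M h' ∧ base.eval M.inp h' = b0 ∧ base.cost ≤ 2 := by
        rcases hbase with ⟨rfl, h4⟩ | ⟨rfl, h4⟩
        · exact ⟨trivial, by rw [← h4]; exact hI.frame.v _ (by simp), le_rfl⟩
        · exact ⟨by simp, by simp [h4], by simp⟩
      simp [h3, hI.blk, hw]
      constructorm* _ ∧ _
      all_goals try omega
      refine ⟨by simp; omega, by simp [h1], ?_, hI.out, ?_, ?_, by simp; omega⟩
      · exact ((hI.frame.put (by simp) _ _).set (by simp) _).set (by simp) _
      · intro x
        simp only [Store.set_a, Store.put_a_same, Store.set_v_same, Function.update_apply]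
        split_ifs with h5 h6 h6
        · subst h5; simp
        · omega
        · rw [hI.ptr, if_pos (by omega)]
        · rw [hI.ptr, if_neg (by omega)]
      · have := hI.spent
        simp; omega
    · intro hge
      have h1 : h'.v .i = h.v cnt := by
        have : ¬ h'.v .i < h.v cnt := by simpa [hc] using hge
        have := hI.le
        omega
      have h2 := hI.spent
      have h3 := hI.ptr
      have h4 := hI.blk
      rw [h1] at h2 h3 h4
      exact ⟨by simp; omega, hI.frame, hI.out, h4, h3⟩

/-! ### The input in memory and the occurrences in the pattern -/

/-- The layout of the input in the memory: the sets `xs 0, …, xs (m - 1)` of the pattern and the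
sets `xs m, …, xs (m + n - 1)` of the text, where `pt i` is the address of the size of `xs i`. -/
structure Layout (M : Machine) (q m n : ℕ) (xs : ℕ → List (Fin q)) (pt : ℕ → ℕ) : Prop where
  nodup : ∀ i, (xs i).Nodup
  inp_pt : ∀ i < m + n, M.inp (pt i) = (xs i).length
  inp_chr : ∀ i < m + n, ∀ j (hj : j < (xs i).length), M.inp (pt i + 1 + j) = (xs i)[j] + 1
  pt_le : ∀ i < m + n, pt i + 1 + (xs i).length ≤ M.len
  pt_mono : ∀ i j, i < j → j < m → pt i + 1 + (xs i).length ≤ pt j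
  len_ge : 3 + m + n ≤ M.len
  cap_ge : (M.len + q + 4) * (M.len + q + 4) ≤ M.cap

/-- The number of positions and characters in `[a, b)`. -/
def wt {q : ℕ} (xs : ℕ → List (Fin q)) (a b : ℕ) : ℕ := ∑ i ∈ Ico a b, ((xs i).length + 1)

section wt

variable {q : ℕ} {xs : ℕ → List (Fin q)} {a b : ℕ}

@[simp] theorem wt_self : wt xs a a = 0 := by simp [wt]

theorem wt_succ (h : a ≤ b) : wt xs a (b + 1) = wt xs a b + ((xs b).length + 1) := by
  simp [wt, sum_Ico_succ_top h]

theorem wt_eq_add (h : a < b) : wt xs a b = (xs a).length + 1 + wt xs (a + 1) b := by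
  simp [wt, sum_eq_sum_Ico_succ_bot h]

theorem wt_add {c : ℕ} (h : a ≤ b) (h' : b ≤ c) : wt xs a b + wt xs b c = wt xs a c := by
  simp [wt, sum_Ico_consecutive _ h h']

theorem length_lt_wt {i : ℕ} (h : a ≤ i) (h' : i < b) : (xs i).length < wt xs a b :=
  lt_of_lt_of_le (Nat.lt_succ_self _)
    (single_le_sum (f := fun i => (xs i).length + 1) (fun _ _ => Nat.zero_le _)
      (mem_Ico.2 ⟨h, h'⟩))

end wt

/-- The character of the pattern at address `B` is `σ`, in the set `xs e`. -/
def Ev {q : ℕ} (m : ℕ) (xs : ℕ → List (Fin q)) (pt : ℕ → ℕ) (B e : ℕ) (σ : Fin q) : Prop :=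
  e < m ∧ ∃ j, (xs e)[j]? = some σ ∧ B = pt e + 1 + j

namespace Layout

variable {M : Machine} {q m n : ℕ} {xs : ℕ → List (Fin q)} {pt : ℕ → ℕ}
  (C : Layout M q m n xs pt)

include C

theorem cap_bound : 4 * (M.len + q + 4) ≤ M.cap :=
  (Nat.mul_le_mul_right _ (by omega)).trans C.cap_ge

theorem pow_bound : 128 * (M.len + q + 4) < 2 ^ M.w := by
  have := C.cap_bound
  have := M.fits
  omega

theorem ev_lt {B B' e e' : ℕ} {σ τ : Fin q} (h : Ev m xs pt B e σ) (h' : Ev m xs pt B' e' τ)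
    (he : e < e') : B < B' := by
  obtain ⟨-, j, hj, rfl⟩ := h
  obtain ⟨he', j', -, rfl⟩ := h'
  have := (List.getElem?_eq_some_iff.1 hj).1
  have := C.pt_mono e e' he he'
  omega

theorem ev_unique {B e e' : ℕ} {σ τ : Fin q} (h : Ev m xs pt B e σ) (h' : Ev m xs pt B e' τ) :
    e = e' ∧ σ = τ := by
  rcases lt_trichotomy e e' with he | rfl | he
  · exact absurd (C.ev_lt h h' he) (lt_irrefl _)
  · obtain ⟨-, j, hj, rfl⟩ := h
    obtain ⟨-, j', hj', hB⟩ := h'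
    obtain rfl : j = j' := by omega
    rw [hj] at hj'
    exact ⟨rfl, Option.some_injective _ hj'⟩
  · exact absurd (C.ev_lt h' h he) (lt_irrefl _)

theorem ev_eq {B B' e : ℕ} {σ : Fin q} (h : Ev m xs pt B e σ) (h' : Ev m xs pt B' e σ) :
    B = B' := by
  obtain ⟨-, j, hj, rfl⟩ := h
  obtain ⟨-, j', hj', rfl⟩ := h'
  have h1 := List.getElem?_eq_some_iff.1 hj
  have h2 := List.getElem?_eq_some_iff.1 hj'
  have := (C.nodup e).getElem_inj_iff.1 (h1.2.trans h2.2.symm)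
  omega

theorem ev_pos_lt {B B' e e' : ℕ} {σ : Fin q} (h : Ev m xs pt B e σ) (h' : Ev m xs pt B' e' σ)
    (hB : B < B') : e < e' := by
  rcases lt_trichotomy e e' with he | rfl | he
  · exact he
  · exact absurd (C.ev_eq h h') hB.ne
  · exact absurd (C.ev_lt h' h he) (by omega)

/-- Positivity matters because the content 0 of `lastEv` and `succ` means that there is no such
occurrence. -/
theorem ev_bound {B e : ℕ} {σ : Fin q} (h : Ev m xs pt B e σ) : 0 < B ∧ B < M.len := by
  obtain ⟨he, j, hj, rfl⟩ := h
  have h1 := (List.getElem?_eq_some_iff.1 hj).1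
  have := C.pt_le e (by omega)
  omega

omit C in
theorem ev_mem {B e : ℕ} {σ : Fin q} (h : Ev m xs pt B e σ) : σ ∈ xs e := by
  obtain ⟨he, j, hj, rfl⟩ := h
  exact List.mem_of_getElem? hj

omit C in
theorem exists_ev {e : ℕ} {σ : Fin q} (he : e < m) (h : σ ∈ xs e) : ∃ B, Ev m xs pt B e σ := by
  obtain ⟨j, hj⟩ := List.mem_iff_getElem?.1 h
  exact ⟨_, he, j, hj, rfl⟩

end Layout

/-- `σ` does not occur strictly between the positions `e` and `e'`. -/
def NoneBetween {q : ℕ} (xs : ℕ → List (Fin q)) (σ : Fin q) (e e' : ℕ) : Prop :=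
  ∀ i, e < i → i < e' → σ ∉ xs i

/-- The arrays after the characters of the pattern at the addresses below `Z` have been scanned:
`succ` links every occurrence to the next one of the same character, `gap` is its distance from the
previous one, and `queue` holds the first occurrences. -/
structure Scanned {q : ℕ} (m : ℕ) (xs : ℕ → List (Fin q)) (pt : ℕ → ℕ) (Z : ℕ)
    (lastEv lastPos succ gap queue : ℕ → ℕ) (tl : ℕ) : Prop where
  last : ∀ σ : Fin q, (lastEv (σ + 1) = 0 ∧ ∀ B e, Ev m xs pt B e σ → Z ≤ B) ∨
    (Ev m xs pt (lastEv (σ + 1)) (lastPos (σ + 1)) σ ∧ lastEv (σ + 1) < Z ∧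
      ∀ B e, Ev m xs pt B e σ → B < Z → B ≤ lastEv (σ + 1))
  nxt : ∀ B e B' e' σ, Ev m xs pt B e σ → Ev m xs pt B' e' σ → B' < Z → e < e' →
    NoneBetween xs σ e e' → succ B = B' ∧ gap B' = e' - e
  succ_ne : ∀ B e σ, Ev m xs pt B e σ → succ B ≠ 0 → ∃ e', Ev m xs pt (succ B) e' σ ∧
    succ B < Z ∧ e < e' ∧ NoneBetween xs σ e e'
  queue_mem : ∀ i < tl, ∃ e σ, Ev m xs pt (queue i) e σ ∧ queue i < Z ∧ ∀ i < e, σ ∉ xs i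
  queue_all : ∀ B e σ, Ev m xs pt B e σ → B < Z → (∀ i < e, σ ∉ xs i) → ∃ i < tl, queue i = B
  queue_inj : ∀ i < tl, ∀ j < tl, queue i = queue j → i = j
  gap_le : ∀ B, gap B ≤ m

section Scanned

variable {M : Machine} {q m n : ℕ} {xs : ℕ → List (Fin q)} {pt : ℕ → ℕ}
  (C : Layout M q m n xs pt) {Z tl : ℕ} {lastEv lastPos succ gap queue : ℕ → ℕ}

/-- Cells without a character of the pattern, such as those that hold the size of a set, are passed
without any change. -/
theorem Scanned.mono (h : Scanned m xs pt Z lastEv lastPos succ gap queue tl) {Z' : ℕ}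
    (hZ : Z ≤ Z') (hno : ∀ B e σ, Ev m xs pt B e σ → B < Z' → B < Z) :
    Scanned m xs pt Z' lastEv lastPos succ gap queue tl where
  last σ := by
    rcases h.last σ with ⟨h1, h2⟩ | ⟨h1, h2, h3⟩
    · refine .inl ⟨h1, fun B e hB => ?_⟩
      by_contra hlt
      have := hno _ _ _ hB (by omega)
      have := h2 B e hB
      omega
    · exact .inr ⟨h1, by omega, fun B e hB hlt => h3 B e hB (hno _ _ _ hB hlt)⟩
  nxt B e B' e' σ h1 h2 h3 := h.nxt B e B' e' σ h1 h2 (hno _ _ _ h2 h3)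
  succ_ne B e σ h1 h2 := by
    obtain ⟨e', h3, h4, h5⟩ := h.succ_ne B e σ h1 h2
    exact ⟨e', h3, by omega, h5⟩
  queue_mem i hi := by
    obtain ⟨e, σ, h3, h4, h5⟩ := h.queue_mem i hi
    exact ⟨e, σ, h3, by omega, h5⟩
  queue_all B e σ h1 h2 := h.queue_all B e σ h1 (hno _ _ _ h1 h2)
  queue_inj := h.queue_inj
  gap_le := h.gap_le

include C

theorem Scanned.last_update (h : Scanned m xs pt Z lastEv lastPos succ gap queue tl) {e : ℕ}
    {σ : Fin q} (hZ : Ev m xs pt Z e σ) (τ : Fin q) :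
    (Function.update lastEv (σ + 1) Z (τ + 1) = 0 ∧ ∀ B e, Ev m xs pt B e τ → Z + 1 ≤ B) ∨
    (Ev m xs pt (Function.update lastEv (σ + 1) Z (τ + 1))
        (Function.update lastPos (σ + 1) e (τ + 1)) τ ∧
      Function.update lastEv (σ + 1) Z (τ + 1) < Z + 1 ∧
      ∀ B e, Ev m xs pt B e τ → B < Z + 1 → B ≤ Function.update lastEv (σ + 1) Z (τ + 1)) := by
  by_cases hτ : τ = σ
  · subst hτ
    right
    simp only [Function.update_self]
    exact ⟨hZ, by omega, fun B _ _ hB => by omega⟩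
  · have hne : (τ : ℕ) + 1 ≠ σ + 1 := fun e => hτ (Fin.ext (by omega))
    simp only [Function.update_of_ne hne]
    have hBne : ∀ B e', Ev m xs pt B e' τ → B ≠ Z := by
      rintro B e' hB rfl
      exact hτ (C.ev_unique hB hZ).2
    rcases h.last τ with ⟨h1, h2⟩ | ⟨h1, h2, h3⟩
    · exact .inl ⟨h1, fun B e' hB => by have := hBne B e' hB; have := h2 B e' hB; omega⟩
    · exact .inr ⟨h1, by omega, fun B e' hB hlt =>
        h3 B e' hB (by have := hBne B e' hB; omega)⟩

/-- An earlier occurrence would have a smaller address, hence would have been scanned and recorded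
in `lastEv` by a nonzero address. -/
theorem Scanned.first (h : Scanned m xs pt Z lastEv lastPos succ gap queue tl) {e : ℕ}
    {σ : Fin q} (hZ : Ev m xs pt Z e σ) (h0 : lastEv (σ + 1) = 0) : ∀ i < e, σ ∉ xs i := by
  intro i hi hmem
  obtain ⟨B, hB⟩ := Layout.exists_ev (pt := pt) (hi.trans hZ.1) hmem
  rcases h.last σ with ⟨h1, h2⟩ | ⟨h1, h2, h3⟩
  · have := C.ev_lt hB hZ hi
    have := h2 B i hB
    omega
  · have := (C.ev_bound h1).1; omega

theorem Scanned.step_first (h : Scanned m xs pt Z lastEv lastPos succ gap queue tl) {e : ℕ}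
    {σ : Fin q} (hZ : Ev m xs pt Z e σ) (h0 : lastEv (σ + 1) = 0) :
    Scanned m xs pt (Z + 1) (Function.update lastEv (σ + 1) Z) (Function.update lastPos (σ + 1) e)
      succ gap (Function.update queue tl Z) (tl + 1) where
  last := h.last_update C hZ
  nxt B e₁ B' e' τ h1 h2 h3 h4 h5 := by
    rcases Nat.lt_succ_iff_lt_or_eq.1 h3 with h6 | rfl
    · exact h.nxt B e₁ B' e' τ h1 h2 h6 h4 h5
    · obtain ⟨rfl, rfl⟩ := C.ev_unique h2 hZ
      exact absurd (Layout.ev_mem h1) (h.first C hZ h0 _ h4)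
  succ_ne B e σ h1 h2 := by
    obtain ⟨e', h3, h4, h5⟩ := h.succ_ne B e σ h1 h2
    exact ⟨e', h3, by omega, h5⟩
  queue_mem i hi := by
    by_cases hit : i = tl
    · subst hit
      simp only [Function.update_self]
      exact ⟨e, σ, hZ, by omega, h.first C hZ h0⟩
    · obtain ⟨e', σ', h3, h4, h5⟩ := h.queue_mem i (by omega)
      simp only [Function.update_of_ne hit]
      exact ⟨e', σ', h3, by omega, h5⟩
  queue_all B e₁ τ h1 h2 h3 := by
    rcases Nat.lt_succ_iff_lt_or_eq.1 h2 with h6 | rfl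
    · obtain ⟨i, hi, hq⟩ := h.queue_all B e₁ τ h1 h6 h3
      exact ⟨i, by omega, by rw [Function.update_of_ne hi.ne, hq]⟩
    · exact ⟨tl, by omega, by simp⟩
  queue_inj i hi j hj hij := by
    have key : ∀ i < tl, queue i ≠ Z := fun i hi => by
      obtain ⟨_, _, _, h4, _⟩ := h.queue_mem i hi; omega
    rw [Function.update_apply, Function.update_apply] at hij
    split_ifs at hij with h1 h2 h2
    · omega
    · exact absurd hij.symm (key j (by omega))
    · exact absurd hij (key i (by omega))
    · exact h.queue_inj i (by omega) j (by omega) hij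
  gap_le := h.gap_le

/-- Addresses increase with positions in the pattern, so the occurrence recorded last is the
immediately preceding one, and the new link and gap are the required ones. -/
theorem Scanned.step_next (h : Scanned m xs pt Z lastEv lastPos succ gap queue tl) {e : ℕ}
    {σ : Fin q} (hZ : Ev m xs pt Z e σ) (h0 : lastEv (σ + 1) ≠ 0) :
    lastPos (σ + 1) < e ∧
    Scanned m xs pt (Z + 1) (Function.update lastEv (σ + 1) Z) (Function.update lastPos (σ + 1) e)
      (Function.update succ (lastEv (σ + 1)) Z) (Function.update gap Z (e - lastPos (σ + 1)))
      queue tl := by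
  obtain ⟨h1, h2, h3⟩ : Ev m xs pt (lastEv (σ + 1)) (lastPos (σ + 1)) σ ∧ lastEv (σ + 1) < Z ∧
      ∀ B e, Ev m xs pt B e σ → B < Z → B ≤ lastEv (σ + 1) := by
    rcases h.last σ with h' | h'
    · exact absurd h'.1 h0
    · exact h'
  have hlt := C.ev_pos_lt h1 hZ h2
  have hnb : NoneBetween xs σ (lastPos (σ + 1)) e := by
    intro i hi hie hmem
    obtain ⟨B, hB⟩ := Layout.exists_ev (pt := pt) (hie.trans hZ.1) hmem
    have := h3 B i hB (C.ev_lt hB hZ hie)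
    have := C.ev_lt h1 hB hi
    omega
  refine ⟨hlt, h.last_update C hZ, ?_, ?_, ?_, ?_, h.queue_inj, ?_⟩
  · intro B e₁ B' e' τ g1 g2 g3 g4 g5
    rcases Nat.lt_succ_iff_lt_or_eq.1 g3 with h6 | rfl
    · obtain ⟨k1, k2⟩ := h.nxt B e₁ B' e' τ g1 g2 h6 g4 g5
      refine ⟨?_, by rw [Function.update_of_ne h6.ne, k2]⟩
      rw [Function.update_of_ne, k1]
      rintro rfl
      obtain ⟨rfl, rfl⟩ := C.ev_unique g1 h1
      have := h3 B' e' g2 h6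
      have := C.ev_lt g1 g2 g4
      omega
    · obtain ⟨rfl, rfl⟩ := C.ev_unique g2 hZ
      have he : e₁ = lastPos (τ + 1) := by
        rcases lt_trichotomy e₁ (lastPos (τ + 1)) with h6 | h6 | h6
        · exact absurd (Layout.ev_mem h1) (g5 _ h6 hlt)
        · exact h6
        · exact absurd (Layout.ev_mem g1) (hnb _ h6 g4)
      subst he
      rw [C.ev_eq g1 h1]
      simp
  · intro B e₁ τ g1 g2
    by_cases hB : B = lastEv (σ + 1)
    · subst hB
      obtain ⟨rfl, rfl⟩ := C.ev_unique g1 h1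
      simp only [Function.update_self]
      exact ⟨e, hZ, by omega, hlt, hnb⟩
    · rw [Function.update_of_ne hB] at g2 ⊢
      obtain ⟨e', k1, k2, k3⟩ := h.succ_ne B e₁ τ g1 g2
      exact ⟨e', k1, by omega, k3⟩
  · intro i hi
    obtain ⟨e', σ', k1, k2, k3⟩ := h.queue_mem i hi
    exact ⟨e', σ', k1, by omega, k3⟩
  · intro B e₁ τ g1 g2 g3
    rcases Nat.lt_succ_iff_lt_or_eq.1 g2 with h6 | rfl
    · exact h.queue_all B e₁ τ g1 h6 g3
    · obtain ⟨rfl, rfl⟩ := C.ev_unique g1 hZ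
      exact absurd (Layout.ev_mem h1) (g3 _ hlt)
  · intro B
    have := hZ.1
    rw [Function.update_apply]
    split_ifs
    · omega
    · exact h.gap_le B

omit C in
theorem Scanned.zero : Scanned m xs pt 0 (fun _ => 0) (fun _ => 0) (fun _ => 0) (fun _ => 0) queue 0 where
  last _ := .inl ⟨rfl, fun _ _ _ => Nat.zero_le _⟩
  nxt _ _ _ _ _ _ _ h := absurd h (Nat.not_lt_zero _)
  succ_ne _ _ _ _ h := absurd rfl h
  queue_mem _ h := absurd h (Nat.not_lt_zero _)
  queue_all _ _ _ _ h := absurd h (Nat.not_lt_zero _)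
  queue_inj _ h := absurd h (Nat.not_lt_zero _)
  gap_le _ := Nat.zero_le _

/-- The entries of the queue are distinct addresses of input cells. -/
theorem Scanned.tl_le (h : Scanned m xs pt Z lastEv lastPos succ gap queue tl) : tl ≤ M.len := by
  have : (range tl).card ≤ (range M.len).card := by
    refine card_le_card_of_injOn queue (fun i hi => ?_) (fun i hi j hj => ?_)
    · obtain ⟨e, σ, h1, -⟩ := h.queue_mem i (by simpa using hi)
      simpa using (C.ev_bound h1).2
    · exact h.queue_inj i (by simpa using hi) j (by simpa using hj)
  simpa using this

end Scanned

end SetMatch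

/-! ### Linking the occurrences of every character of the pattern -/

namespace SetMatch
open Finset WordRAM

/-- Process the next character of the pattern. -/
def scanChar : Cmd :=
  .set .blk (.var .blk +ₑ .lit 1) ;;
  .set .x (.inp Var.blk) ;;
  .set .y (.get .lastEv Var.x) ;;
  .ite Var.y
    (.put .succ Var.y Var.blk ;; .put .gap Var.blk (.var .pos -ₑ .get .lastPos Var.x))
    (.put .queue Var.tl Var.blk ;; .set .tl (.var .tl +ₑ .lit 1)) ;;
  .put .lastEv Var.x Var.blk ;;
  .put .lastPos Var.x Var.pos ;;
  .set .j (.var .j +ₑ .lit 1)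

/-- Link the occurrences of every character in the pattern, and queue the first ones. -/
def scan : Cmd :=
  .set .pos (.lit 0) ;;
  .set .tl (.lit 0) ;;
  .loop (.var .pos <ₑ Var.m)
    (.set .blk (.get .ptr Var.pos) ;;
     .set .k (.inp Var.blk) ;;
     .set .j (.lit 0) ;;
     .loop (.var .j <ₑ Var.k) scanChar ;;
     .set .pos (.var .pos +ₑ .lit 1))

abbrev ScanFrame : Store → Store → Prop :=
  Frame [.blk, .k, .j, .pos, .x, .y, .tl] [.lastEv, .lastPos, .succ, .gap, .queue]

section

variable {M : Machine} {q m n : ℕ} {xs : ℕ → List (Fin q)} {pt : ℕ → ℕ}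

/-- The arrays of the store are as after scanning up to address `Z`. -/
abbrev StoreScanned (m : ℕ) (xs : ℕ → List (Fin q)) (pt : ℕ → ℕ) (Z : ℕ) (h : Store) : Prop :=
  Scanned m xs pt Z (h.a .lastEv) (h.a .lastPos) (h.a .succ) (h.a .gap) (h.a .queue) (h.v .tl)

/-- The invariant of the inner loop of `scan`. -/
structure ScanCharInv (m : ℕ) (xs : ℕ → List (Fin q)) (pt : ℕ → ℕ) (e : ℕ) (h : Store) (b : ℕ)
    (h' : Store) (b' : ℕ) : Prop where
  pos : h'.v .pos = e
  k : h'.v .k = (xs e).length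
  j : h'.v .j ≤ (xs e).length
  blk : h'.v .blk = pt e + h'.v .j
  scanned : StoreScanned m xs pt (pt e + 1 + h'.v .j) h'
  frame : ScanFrame h h'
  out : h'.out = h.out
  spent : b ≤ b' + 100 * h'.v .j

/-- The invariant of the outer loop of `scan`. -/
structure ScanInv (m : ℕ) (xs : ℕ → List (Fin q)) (pt : ℕ → ℕ) (h : Store) (b : ℕ)
    (h' : Store) (b' : ℕ) : Prop where
  pos : h'.v .pos ≤ m
  scanned : ∃ Z, StoreScanned m xs pt Z h' ∧ (h'.v .pos < m → Z ≤ pt (h'.v .pos)) ∧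
    ∀ B e σ, Ev m xs pt B e σ → (B < Z ↔ e < h'.v .pos)
  frame : ScanFrame h h'
  out : h'.out = h.out
  spent : b ≤ b' + 100 * wt xs 0 (h'.v .pos) + 6

theorem scanChar_spec (C : Layout M q m n xs pt) {e b : ℕ} {h : Store} (he : e < m)
    {h' : Store} {b' : ℕ} (hI : ScanCharInv m xs pt e h b h' b')
    (hj : h'.v .j < (xs e).length) (hb : 100 ≤ b') :
    vc M scanChar (ScanCharInv m xs pt e h b) h' (b' - 6) := by
  have hw : M.w ≠ 0 := by have := M.one_lt; intro h0; simp [h0] at this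
  have hcap := C.cap_bound
  have hpow := C.pow_bound
  have hchr := C.inp_chr e (by omega) _ hj
  have hlen := C.pt_le e (by omega)
  have hge := C.len_ge
  have hEv : Ev m xs pt (pt e + 1 + h'.v .j) e (xs e)[h'.v .j] :=
    ⟨he, _, List.getElem?_eq_getElem hj, rfl⟩
  generalize hσ : (xs e)[h'.v .j] = σ at *
  have hσq := σ.2
  have htl := hI.scanned.tl_le C
  have hblk : h'.v .blk + 1 = pt e + 1 + h'.v .j := by rw [hI.blk]; omega
  have hpos := hI.pos
  have hfr : ScanFrame h h' := hI.frame
  have hlast : h'.a .lastEv (σ + 1) < M.len := by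
    rcases hI.scanned.last σ with h1 | h1
    · omega
    · have := h1.2.1; omega
  have hsp := hI.spent
  unfold scanChar
  simp [hw, hblk, hchr]
  constructorm* _ ∧ _
  all_goals try omega
  · intro h0
    obtain ⟨hlt, hs⟩ := hI.scanned.step_next C hEv h0
    constructorm* _ ∧ _
    all_goals try omega
    refine ⟨by simpa using hpos, by simpa using hI.k, by simp; omega, by simp; omega, ?_, ?_,
      by simpa using hI.out, by simp; omega⟩
    · simp only [hpos]
      simpa [StoreScanned, add_assoc] using hs
    · exact ((((((((hfr.set (by simp) _).set (by simp) _).set (by simp) _).put (by simp) _ _).put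
        (by simp) _ _).put (by simp) _ _).put (by simp) _ _).set (by simp) _)
  · intro h0
    have hs := hI.scanned.step_first C hEv h0
    constructorm* _ ∧ _
    all_goals try omega
    refine ⟨by simpa using hpos, by simpa using hI.k, by simp; omega, by simp; omega, ?_, ?_,
      by simpa using hI.out, by simp; omega⟩
    · simp only [hpos]
      simpa [StoreScanned, add_assoc] using hs
    · exact ((((((((hfr.set (by simp) _).set (by simp) _).set (by simp) _).put (by simp) _ _).set
        (by simp) _).put (by simp) _ _).put (by simp) _ _).set (by simp) _)

theorem scan_spec (C : Layout M q m n xs pt) {b : ℕ} {h : Store} (hm : h.v .m = m)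
    (hptr : ∀ i < m, h.a .ptr i = pt i) (h1 : h.a .lastEv = fun _ => 0)
    (h2 : h.a .lastPos = fun _ => 0) (h3 : h.a .succ = fun _ => 0) (h4 : h.a .gap = fun _ => 0)
    (hb : 100 * wt xs 0 m + 20 ≤ b) :
    wp M scan (fun h' b' => b ≤ b' + 100 * wt xs 0 m + 20 ∧ ScanFrame h h' ∧ h'.out = h.out ∧
      StoreScanned m xs pt M.len h') h b := by
  have hw : M.w ≠ 0 := by have := M.one_lt; intro h0; simp [h0] at this
  have hcap := C.cap_bound
  have hpow := C.pow_bound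
  have hge := C.len_ge
  apply wp_of_vc
  unfold scan
  simp only [vc, Expr.ok, Expr.cost, Expr.eval]
  refine ⟨by omega, by omega, by omega, by omega, wp_loop (ScanInv m xs pt h b) ?_ ?_⟩
  · refine ⟨by simp, ⟨0, ?_, by simp, by simp⟩, ?_, rfl, by simp; omega⟩
    · simp [StoreScanned, h1, h2, h3, h4]
      exact Scanned.zero
    · exact ((Frame.refl _ _ _).set (by simp) _).set (by simp) _
  · intro h' b' hI
    have hm' : h'.v .m = m := by rw [← hm]; exact hI.frame.v _ (by simp)
    have hptr' : h'.a .ptr = h.a .ptr := hI.frame.a _ (by simp)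
    have hsp := hI.spent
    have hwt := wt_add (xs := xs) (Nat.zero_le (h'.v .pos)) hI.pos
    obtain ⟨Z, hZ, hZ1, hZ2⟩ := hI.scanned
    refine ⟨by simp, by simp; omega, ?_, ?_⟩
    · intro hlt
      have hlt : h'.v .pos < m := by simpa [hm'] using hlt
      have hlt' : h'.v .pos < m + n := by omega
      have hwt' := wt_eq_add (xs := xs) hlt
      have e1 := C.inp_pt _ hlt'
      have e2 := C.pt_le _ hlt'
      generalize hpe : h'.v .pos = e at *
      simp only [vc, Expr.ok, Expr.cost, Expr.eval, Op.val, Op.safe, Store.set_v_same, hpe, hptr', hptr e hlt, e1]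
      refine ⟨⟨trivial, by omega⟩, by omega, ⟨trivial, by omega⟩, by omega, by omega, by omega, ?_⟩
      refine wp_loop (ScanCharInv m xs pt e
        (((h'.set .blk (pt e)).set .k (xs e).length).set .j 0) (b' - 6 - 11 - 5 - 3)) ?_ ?_
      · refine ⟨by simpa using hpe, by simp, by simp, by simp, ?_, Frame.refl _ _ _, rfl, by simp⟩
        -- Between the part scanned so far and the first character of the set at `e` there is no
        -- character of the pattern.
        have := hZ.mono (Z' := pt e + 1) (by have := hZ1 hlt; omega) (by
          intro B e' σ hB hlt'
          rw [hZ2 _ _ _ hB]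
          by_contra hcon
          obtain ⟨he', j, -, rfl⟩ := hB
          rcases (show e ≤ e' by omega).lt_or_eq with h6 | rfl
          · have := C.pt_mono _ _ h6 he'; omega
          · omega)
        simpa [StoreScanned] using this
      · intro h₂ b₂ hI₂
        have hsp₂ := hI₂.spent
        have hj := hI₂.j
        refine ⟨by simp, by simp; omega, ?_, ?_⟩
        · intro hlt₂
          have hlt₂ : h₂.v .j < (xs e).length := by simpa [hI₂.k] using hlt₂
          exact scanChar_spec C hlt hI₂ hlt₂ (by omega)
        · intro hge₂
          have hj₂ : h₂.v .j = (xs e).length := by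
            have : ¬ h₂.v .j < (xs e).length := by simpa [hI₂.k] using hge₂
            omega
          have hp₂ := hI₂.pos
          simp [hw]
          constructorm* _ ∧ _
          all_goals try omega
          refine ⟨by simp; omega, ⟨pt e + 1 + h₂.v .j, ?_, ?_, ?_⟩, ?_, ?_, ?_⟩
          · simpa [StoreScanned] using hI₂.scanned
          · simp only [Store.set_v_same, hp₂, hj₂]
            exact fun h6 => C.pt_mono _ _ (Nat.lt_succ_self _) h6
          · intro B e' σ hB
            simp only [Store.set_v_same, hp₂, hj₂]
            obtain ⟨he', j, hj', rfl⟩ := hB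
            have hj'' := (List.getElem?_eq_some_iff.1 hj').1
            rcases lt_trichotomy e e' with h6 | rfl | h6
            · have := C.pt_mono _ _ h6 he'; omega
            · omega
            · have := C.pt_mono _ _ h6 hlt; omega
          · refine ((hI.frame.trans ?_).trans hI₂.frame).set (by simp) _
            exact (((Frame.refl _ _ _).set (by simp) _).set (by simp) _).set (by simp) _
          · exact hI₂.out.trans hI.out
          · simp only [Store.set_v_same, hp₂]
            rw [wt_succ (Nat.zero_le e)]
            omega
    · intro hge
      have hpm : h'.v .pos = m := by
        have : ¬ h'.v .pos < m := by simpa [hm'] using hge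
        have := hI.pos
        omega
      rw [hpm] at hsp hZ2
      refine ⟨by simp; omega, hI.frame, hI.out, ?_⟩
      -- All characters lie below `M.len`, so the bound `Z` may be replaced by `M.len` whichever of
      -- the two is larger.
      rcases le_total Z M.len with hle | hle
      · exact hZ.mono hle fun B e σ hB _ => (hZ2 _ _ _ hB).2 hB.1
      · have h7 := hZ
        have h8 : ∀ B e σ, Ev m xs pt B e σ → B < M.len := fun B e σ hB => (C.ev_bound hB).2
        refine ⟨fun σ => ?_, fun B e B' e' σ g1 g2 g3 => h7.nxt B e B' e' σ g1 g2 (by omega), ?_,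
          ?_, fun B e σ g1 g2 => h7.queue_all B e σ g1 (by omega), h7.queue_inj, h7.gap_le⟩
        · rcases h7.last σ with ⟨g1, g2⟩ | ⟨g1, g2, g3⟩
          · exact .inl ⟨g1, fun B e hB => by have := g2 B e hB; omega⟩
          · exact .inr ⟨g1, h8 _ _ _ g1, fun B e hB g4 => g3 B e hB (by omega)⟩
        · intro B e σ g1 g2
          obtain ⟨e', g3, g4, g5⟩ := h7.succ_ne B e σ g1 g2
          exact ⟨e', g3, h8 _ _ _ g3, g5⟩
        · intro i hi
          obtain ⟨e, σ, g3, g4, g5⟩ := h7.queue_mem i hi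
          exact ⟨e, σ, g3, h8 _ _ _ g3, g5⟩

end

end SetMatch

namespace SetMatch
open Finset WordRAM

/-! ### The trie of the shapes, with failure links -/

/-- The sets of a sequence of lists. -/
abbrev sets {q : ℕ} (xs : ℕ → List (Fin q)) (i : ℕ) : Finset (Fin q) := (xs i).toFinset

/-- The child of node `f` at distance `g`; the root has the same child at every distance. -/
def trans (ch : ℕ → ℕ) (st f g : ℕ) : ℕ := ch (f * st + g) + if f = 0 then 1 else 0

/-- The transition table is stored row by row; different transitions use different cells as long as
distances stay below the row length. -/
theorem index_injective {st f g f' g' : ℕ} (hg : g < st) (hg' : g' < st)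
    (h : f * st + g = f' * st + g') : f = f' ∧ g = g' := by
  have h1 := congrArg (· / st) h
  have h2 := congrArg (· % st) h
  have hst : 0 < st := by omega
  simp only [Nat.add_comm (_ * st), Nat.add_mul_div_right _ _ hst, Nat.div_eq_of_lt hg,
    Nat.div_eq_of_lt hg', Nat.add_mul_mod_self_right, Nat.mod_eq_of_lt hg,
    Nat.mod_eq_of_lt hg'] at h1 h2
  omega

/-- The nodes `0, …, nn` stand for the shapes `S 0, …, S nn`. -/
structure Trie (P : Finset ℕ → Prop) (st nn : ℕ) (S : ℕ → Finset ℕ) (ch depth fail : ℕ → ℕ) :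
    Prop where
  pos : 0 < nn
  zero : S 0 = ∅
  one : S 1 = {0}
  mem : ∀ v ≤ nn, P (S v)
  inj : ∀ v ≤ nn, ∀ v' ≤ nn, S v = S v' → v = v'
  ch_zero : ∀ g < st, ch g = 0
  ch_of_gt : ∀ f > nn, ∀ g < st, ch (f * st + g) = 0
  ch_mem : ∀ f ≤ nn, 0 < f → ∀ g < st, 0 < g → ch (f * st + g) ≠ 0 →
    ch (f * st + g) ≤ nn ∧ S (ch (f * st + g)) = child (S f) g
  ch_eq : ∀ f ≤ nn, 0 < f → ∀ g < st, 0 < g → ∀ v ≤ nn, S v = child (S f) g → ch (f * st + g) = v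
  closed : ∀ v ≤ nn, ∀ D g, S v = child D g → D = ∅ ∨ 0 ∈ D → 0 < g → ∃ f ≤ nn, S f = D
  depth : ∀ v ≤ nn, depth v = (S v).card
  fail_zero : fail 0 = 0
  fail : ∀ v ≤ nn, 0 < v → fail v ≤ nn ∧ Low (S (fail v)) (S v) ∧ S (fail v) ≠ S v ∧
    ∀ F, P F → Low F (S v) → F ≠ S v → F ⊆ S (fail v)

/-- The properties of a family of shapes that the failure links need. -/
structure ShapeFamily (P : Finset ℕ → Prop) : Prop where
  zero_mem : ∀ D, P D → D ≠ ∅ → 0 ∈ D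
  of_child : ∀ E g, P (child E g) → E = ∅ ∨ 0 ∈ E → 0 < g → P E

namespace Trie

variable {P : Finset ℕ → Prop} {st nn : ℕ} {S : ℕ → Finset ℕ} {ch depth fail : ℕ → ℕ}
  (T : Trie P st nn S ch depth fail)

include T

theorem eq_zero_of_empty {v : ℕ} (hv : v ≤ nn) (h : S v = ∅) : v = 0 :=
  T.inj v hv 0 (Nat.zero_le _) (h.trans T.zero.symm)

theorem ne_empty {v : ℕ} (hv : v ≤ nn) (h : 0 < v) : S v ≠ ∅ := fun h' => by
  have := T.eq_zero_of_empty hv h'; omega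

theorem trans_zero {g : ℕ} (hg : g < st) : trans ch st 0 g = 1 := by
  simp [trans, T.ch_zero g hg]

theorem trans_mem {f g : ℕ} (hf : f ≤ nn) (hg : g < st) (h0 : f = 0 ∨ 0 < g)
    (h : trans ch st f g ≠ 0) :
    trans ch st f g ≤ nn ∧ S (trans ch st f g) = child (S f) g := by
  rcases Nat.eq_zero_or_pos f with rfl | hpos
  · rw [T.trans_zero hg, T.one, T.zero, child_empty]
    exact ⟨T.pos, rfl⟩
  · simp only [trans, hpos.ne', if_false, add_zero] at h ⊢
    exact T.ch_mem f hf hpos g hg (by omega) h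

theorem trans_eq {f g v : ℕ} (hf : f ≤ nn) (hg : g < st) (h0 : f = 0 ∨ 0 < g) (hv : v ≤ nn)
    (h : S v = child (S f) g) : trans ch st f g = v := by
  rcases Nat.eq_zero_or_pos f with rfl | hpos
  · rw [T.trans_zero hg]
    refine T.inj _ T.pos _ hv ?_
    rw [h, T.one, T.zero, child_empty]
  · simp only [trans, hpos.ne', if_false, add_zero]
    exact T.ch_eq f hf hpos g hg (by omega) v hv h

theorem fail_le {v : ℕ} (hv : v ≤ nn) : fail v ≤ nn := by
  rcases Nat.eq_zero_or_pos v with rfl | hpos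
  · rw [T.fail_zero]; exact hv
  · exact (T.fail v hv hpos).1

/-- The candidate `f` in the search for the failure link of the child of `u` at distance `g`. -/
structure Candidate (P : Finset ℕ → Prop) (nn : ℕ) (S : ℕ → Finset ℕ) (u g f : ℕ) : Prop where
  le : f ≤ nn
  low : Low (S f) (S u)
  ne : S f ≠ S u
  max : ∀ F, P (child F g) → Low F (S u) → F ≠ S u → F ⊆ S f

/-- If `child F g` belongs to the family then so does `F`; hence the failure link of `u` already
bounds all competitors. -/
theorem candidate_fail (hP : ShapeFamily P) {u g : ℕ} (hu : u ≤ nn) (hu0 : 0 < u) (hg : 0 < g) :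
    Candidate P nn S u g (fail u) := by
  obtain ⟨h1, h2, h3, h4⟩ := T.fail u hu hu0
  refine ⟨h1, h2, h3, fun F hF hlow hne => h4 F (hP.of_child F g hF ?_ hg) hlow hne⟩
  rcases F.eq_empty_or_nonempty with h | ⟨z, hz⟩
  · exact .inl h
  · exact .inr (hlow.2 z hz 0 (hP.zero_mem _ (T.mem u hu) (T.ne_empty hu hu0)) (Nat.zero_le _))

/-- By `hcomp` the shape `child (S f) g`, being no larger than `S u`, would have a node if it were
in the family. So a missing transition excludes `S f` itself, and the remaining competitors are
proper initial parts of `S f`, bounded by its failure link. The root has all transitions, so the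
search stops there at the latest. -/
theorem candidate_step (hP : ShapeFamily P) {u g f : ℕ} (hu : u ≤ nn) (hu0 : 0 < u) (hg : 0 < g)
    (hgst : g < st) (hcomp : ∀ D, P D → D.card ≤ (S u).card → ∃ v ≤ nn, S v = D)
    (hf : Candidate P nn S u g f) (h0 : trans ch st f g = 0) :
    Candidate P nn S u g (fail f) ∧ (S (fail f)).card < (S f).card := by
  have hf0 : 0 < f := by
    by_contra hcon
    obtain rfl : f = 0 := by omega
    rw [T.trans_zero hgst] at h0
    omega
  obtain ⟨h1, h2, h3, h4⟩ := T.fail f hf.le hf0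
  have hlt := h2.card_lt h3
  refine ⟨⟨h1, h2.trans hf.low, fun h => ?_, fun F hF hlow hne => ?_⟩, hlt⟩
  · have := hf.low.card_lt hf.ne
    rw [h] at hlt
    omega
  · have hsub := hf.max F hF hlow hne
    by_cases hFf : F = S f
    · subst hFf
      obtain ⟨v, hv, hvS⟩ := hcomp _ hF (by
        rw [card_child hg]; exact hf.low.card_lt hf.ne)
      have := T.trans_eq hf.le hgst (.inr hg) hv hvS
      rw [h0] at this
      rw [← this, T.zero] at hvS
      exact absurd hvS.symm (child_nonempty _ _)
    · refine h4 F (hP.of_child F g hF ?_ hg) (hlow.of_subset hf.low hsub) hFf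
      rcases F.eq_empty_or_nonempty with h | ⟨z, hz⟩
      · exact .inl h
      · exact .inr (hlow.2 z hz 0 (hP.zero_mem _ (T.mem u hu) (T.ne_empty hu hu0)) (Nat.zero_le _))

omit T in
-- The distance can be recovered from the child as its least positive element.
theorem gap_eq_of_child_eq {D E : Finset ℕ} {g g' : ℕ} (hg : 0 < g) (hg' : 0 < g')
    (h : child D g' = child E g) (hD : 0 ∈ D) (hE : 0 ∈ E) : g' = g := by
  have h1 : g' ∈ child E g := h ▸ mem_child.2 (.inr ⟨0, hD, by simp⟩)
  have h2 : g ∈ child D g' := h ▸ mem_child.2 (.inr ⟨0, hE, by simp⟩)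
  rcases mem_child.1 h1 with h | ⟨z, -, h⟩ <;> rcases mem_child.1 h2 with h | ⟨z, -, h⟩ <;> omega

/-- Add a node. -/
theorem insert (hP : ShapeFamily P) {u g x : ℕ} (hu : u ≤ nn) (hu0 : 0 < u) (hg : 0 < g) (hgst : g < st)
    (hPc : P (child (S u) g)) (h0 : trans ch st u g = 0)
    (hx : Candidate P nn S u g x) (hx0 : trans ch st x g ≠ 0) :
    Trie P st (nn + 1) (Function.update S (nn + 1) (child (S u) g))
      (Function.update ch (u * st + g) (nn + 1)) (Function.update depth (nn + 1) (depth u + 1))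
      (Function.update fail (nn + 1) (trans ch st x g)) := by
  have hS : ∀ v ≤ nn, Function.update S (nn + 1) (child (S u) g) v = S v := fun v hv =>
    Function.update_of_ne (by omega) _ _
  have hnew : ∀ v ≤ nn, S v ≠ child (S u) g := fun v hv h => by
    have := T.trans_eq hu hgst (.inr hg) hv h
    rw [h0] at this
    rw [← this, T.zero] at h
    exact absurd h.symm (child_nonempty _ _)
  have hch : ∀ f g', g' < st → (f ≠ u ∨ g' ≠ g) →
      Function.update ch (u * st + g) (nn + 1) (f * st + g') = ch (f * st + g') := by
    intro f g' hg' hne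
    refine Function.update_of_ne (fun h => ?_) _ _
    have := index_injective hg' hgst h
    omega
  have hSu := hP.zero_mem _ (T.mem u hu) (T.ne_empty hu hu0)
  obtain ⟨hx1, hx2⟩ := T.trans_mem hx.le hgst (.inr hg) hx0
  refine ⟨by omega, by rw [hS _ (Nat.zero_le _), T.zero], by rw [hS _ T.pos, T.one], ?_, ?_, ?_, ?_,
    ?_, ?_, ?_, ?_, ?_, ?_⟩
  · intro v hv
    rcases Nat.lt_succ_iff_lt_or_eq.1 (Nat.lt_succ_of_le hv) with h | rfl
    · rw [hS v (by omega)]; exact T.mem v (by omega)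
    · simpa using hPc
  · intro v hv v' hv' h
    rcases Nat.lt_succ_iff_lt_or_eq.1 (Nat.lt_succ_of_le hv) with h1 | rfl <;>
    rcases Nat.lt_succ_iff_lt_or_eq.1 (Nat.lt_succ_of_le hv') with h2 | rfl
    · rw [hS v (by omega), hS v' (by omega)] at h
      exact T.inj v (by omega) v' (by omega) h
    · rw [hS v (by omega), Function.update_self] at h
      exact absurd h (hnew v (by omega))
    · rw [hS v' (by omega), Function.update_self] at h
      exact absurd h.symm (hnew v' (by omega))
    · rfl
  · intro g' hg'
    have := hch 0 g' hg' (.inl (by omega))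
    simp only [zero_mul, zero_add] at this
    rw [this, T.ch_zero g' hg']
  · intro f hf g' hg'
    rw [hch f g' hg' (.inl (by omega)), T.ch_of_gt f (by omega) g' hg']
  · intro f hf hf0 g' hg' hg'0 hne
    by_cases h : f = u ∧ g' = g
    · obtain ⟨rfl, rfl⟩ := h
      simp [hS f hu]
    · rw [hch f g' hg' (by omega)] at hne ⊢
      rcases Nat.lt_succ_iff_lt_or_eq.1 (Nat.lt_succ_of_le hf) with h1 | rfl
      · obtain ⟨h2, h3⟩ := T.ch_mem f (by omega) hf0 g' hg' hg'0 hne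
        exact ⟨by omega, by rw [hS _ h2, hS f (by omega), h3]⟩
      · exact absurd (T.ch_of_gt _ (Nat.lt_succ_self _) g' hg') hne
  · intro f hf hf0 g' hg' hg'0 v hv hvS
    rcases Nat.lt_succ_iff_lt_or_eq.1 (Nat.lt_succ_of_le hf) with h1 | rfl
    · rw [hS f (by omega)] at hvS
      rcases Nat.lt_succ_iff_lt_or_eq.1 (Nat.lt_succ_of_le hv) with h2 | rfl
      · rw [hS v (by omega)] at hvS
        have hne : f ≠ u ∨ g' ≠ g := by
          by_contra! hcon
          obtain ⟨rfl, rfl⟩ := hcon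
          exact hnew v (by omega) hvS
        rw [hch f g' hg' hne, T.ch_eq f (by omega) hf0 g' hg' hg'0 v (by omega) hvS]
      · rw [Function.update_self] at hvS
        have hf1 := hP.zero_mem _ (T.mem f (by omega)) (T.ne_empty (by omega) hf0)
        obtain rfl := gap_eq_of_child_eq hg hg'0 hvS.symm hf1 hSu
        obtain rfl := T.inj u hu f (by omega) (child_injective hg'0 hvS)
        simp
    · rw [Function.update_self] at hvS
      rcases Nat.lt_succ_iff_lt_or_eq.1 (Nat.lt_succ_of_le hv) with h2 | rfl
      · rw [hS v (by omega)] at hvS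
        -- An old node cannot be a child of the new one: the trie is closed under parents, so the
        -- new shape would have had a node already.
        obtain ⟨f, hf, hfS⟩ := T.closed v (by omega) _ _ hvS (.inr (by simp [child])) hg'0
        exact absurd hfS (hnew f hf)
      · rw [Function.update_self] at hvS
        have := congrArg card hvS
        rw [card_child hg'0] at this
        omega
  · intro v hv D g' hvS hD hg'0
    rcases Nat.lt_succ_iff_lt_or_eq.1 (Nat.lt_succ_of_le hv) with h2 | rfl
    · rw [hS v (by omega)] at hvS
      obtain ⟨f, hf, hfS⟩ := T.closed v (by omega) _ _ hvS hD hg'0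
      exact ⟨f, by omega, by rw [hS f hf, hfS]⟩
    · rw [Function.update_self] at hvS
      rcases hD with rfl | hD
      · exact ⟨0, by omega, by rw [hS 0 (by omega), T.zero]⟩
      · obtain rfl := gap_eq_of_child_eq hg hg'0 hvS.symm hD hSu
        exact ⟨u, by omega, by rw [hS u hu, child_injective hg'0 hvS]⟩
  · intro v hv
    rcases Nat.lt_succ_iff_lt_or_eq.1 (Nat.lt_succ_of_le hv) with h2 | rfl
    · rw [hS v (by omega), Function.update_of_ne (by omega), T.depth v (by omega)]
    · simp only [Function.update_self]
      rw [T.depth u hu, card_child hg]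
  · rw [Function.update_of_ne (by omega), T.fail_zero]
  · intro v hv hv0
    rcases Nat.lt_succ_iff_lt_or_eq.1 (Nat.lt_succ_of_le hv) with h2 | rfl
    · obtain ⟨h3, h4⟩ := T.fail v (by omega) hv0
      rw [hS v (by omega), Function.update_of_ne (by omega), hS _ h3]
      exact ⟨by omega, h4⟩
    · simp only [Function.update_self]
      rw [hS _ hx1, hx2]
      refine ⟨by omega, hx.low.child hg, fun h => hx.ne (child_injective hg h), ?_⟩
      intro F hF hlow hne
      by_cases hFe : F = ∅
      · rw [hFe]; exact empty_subset _
      · obtain ⟨E, hE, rfl⟩ := hlow.exists_child hFe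
        have := hx.max E hF hE fun h => hne (by rw [h])
        exact insert_subset_insert _ (image_subset_image this)

end Trie

end SetMatch

/-! ### The queue that orders the construction of the trie -/

namespace SetMatch
open Finset WordRAM

theorem shapeFamily_inTrie {α : Type} [DecidableEq α] (X : ℕ → Finset α) (m : ℕ) :
    ShapeFamily (InTrie X m) :=
  ⟨fun _ h hD => h.zero_mem hD, fun _ _ h hE hg => h.of_child hE hg⟩

/-- The transitions of the root all lead to the shape `{0}`, so this node exists from the beginning.
This is why `InTrie` contains `∅` and `{0}` even if the pattern has no character. -/
theorem Trie.init {P : Finset ℕ → Prop} (h0 : P ∅) (h1 : P {0}) (st : ℕ) :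
    Trie P st 1 (fun v => if v = 1 then {0} else ∅) (fun _ => 0)
      (Function.update (fun _ => 0) 1 1) (fun _ => 0) where
  pos := one_pos
  zero := by simp
  one := by simp
  mem v hv := by split_ifs <;> assumption
  inj v hv v' hv' h := by
    split_ifs at h with h2 h3 h3
    · omega
    · simp at h
    · simp at h
    · omega
  ch_zero _ _ := rfl
  ch_of_gt _ _ _ _ := rfl
  ch_mem _ _ _ _ _ _ h := absurd rfl h
  ch_eq f hf hf0 g hg hg0 v hv h := by
    obtain rfl : f = 1 := by omega
    have := congrArg card h
    rw [card_child hg0, if_pos rfl] at this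
    split_ifs at this <;> simp at this
  closed v hv D g h hD hg := by
    refine ⟨0, by omega, ?_⟩
    have := congrArg card h
    rw [card_child hg] at this
    simp only [zero_ne_one, if_false]
    split_ifs at this
    · exact (card_eq_zero.1 (by simpa using this.symm)).symm
    · simp at this
  depth v hv := by
    rw [Function.update_apply]
    split_ifs <;> simp
  fail_zero := rfl
  fail v hv hv0 := by
    obtain rfl : v = 1 := by omega
    refine ⟨by omega, by simp [low_empty], by simp, fun F _ hF hne => ?_⟩
    simp only [if_true] at hF hne
    rcases subset_singleton_iff.1 hF.1 with h | h
    · simp [h]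
    · exact absurd h hne

/-- The failure shape of a child, if not empty, is itself a child, namely of a proper initial part
of the parent's shape; and this part is contained in the failure shape of the parent. -/
theorem Trie.card_fail_trans_le {P : Finset ℕ → Prop} {st nn : ℕ} {S : ℕ → Finset ℕ}
    {ch depth fail : ℕ → ℕ} (T : Trie P st nn S ch depth fail) (hP : ShapeFamily P) {u g : ℕ}
    (hu : u ≤ nn) (hg : g < st) (hug : u = 0 ∨ 0 < g) (h0 : trans ch st u g ≠ 0) :
    (S (fail (trans ch st u g))).card ≤ (S (fail u)).card + 1 := by
  obtain ⟨h1, h2⟩ := T.trans_mem hu hg hug h0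
  obtain ⟨h3, h4, h5, -⟩ := T.fail _ h1 (Nat.pos_of_ne_zero h0)
  rcases Nat.eq_zero_or_pos u with rfl | hpos
  · have := h4.card_lt h5
    rw [h2, T.zero, child_empty, card_singleton] at this
    omega
  · by_cases he : S (fail (trans ch st u g)) = ∅
    · rw [he]; simp
    · rw [h2] at h4 h5
      obtain ⟨E, hE, hE'⟩ := h4.exists_child he
      have hg0 : 0 < g := by omega
      rw [hE'] at h5 ⊢
      have := (T.candidate_fail hP hu hpos hg0).max E (hE' ▸ T.mem _ h3) hE
        fun h => h5 (by rw [h])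
      rw [card_child hg0]
      exact Nat.succ_le_succ (card_le_card this)

/-- The number of occurrences of `σ` up to position `e`. -/
abbrev rank {q : ℕ} (xs : ℕ → List (Fin q)) (σ : Fin q) (e : ℕ) : ℕ := (shape (sets xs) σ 0 e).card

/-- The state of the queue: its first `hd` entries have been assigned a node in `label`. -/
structure Queued {q : ℕ} (m : ℕ) (xs : ℕ → List (Fin q)) (pt succ gap : ℕ → ℕ)
    (nn : ℕ) (S : ℕ → Finset ℕ) (hd tl : ℕ) (queue par label : ℕ → ℕ) : Prop where
  hd_le : hd ≤ tl
  ev : ∀ i < tl, ∃ e σ, Ev m xs pt (queue i) e σ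
  inj : ∀ i < tl, ∀ j < tl, queue i = queue j → i = j
  sorted : ∀ i j, i ≤ j → j < tl → ∀ e σ e' σ', Ev m xs pt (queue i) e σ →
    Ev m xs pt (queue j) e' σ' → rank xs σ e ≤ rank xs σ' e'
  near : ∀ i < tl, hd < tl → ∀ e σ e' σ', Ev m xs pt (queue hd) e σ →
    Ev m xs pt (queue i) e' σ' → rank xs σ' e' ≤ rank xs σ e + 1
  first : ∀ B e σ, Ev m xs pt B e σ → (∀ i < e, σ ∉ xs i) → ∃ i < tl, queue i = B
  pushed : ∀ i < hd, succ (queue i) ≠ 0 → ∃ j < tl, queue j = succ (queue i)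
  pred : ∀ j < tl, ∀ e' σ B e, Ev m xs pt (queue j) e' σ → Ev m xs pt B e σ → e < e' →
    NoneBetween xs σ e e' → ∃ i < hd, queue i = B
  par_first : ∀ B e σ, Ev m xs pt B e σ → (∀ i < e, σ ∉ xs i) → par B = 0
  par : ∀ j < tl, ∀ e σ, Ev m xs pt (queue j) e σ → par (queue j) ≤ nn ∧
    (par (queue j) = 0 ∨ 0 < gap (queue j)) ∧
    child (S (par (queue j))) (gap (queue j)) = shape (sets xs) σ 0 e
  label : ∀ i < hd, ∀ e σ, Ev m xs pt (queue i) e σ → label (queue i) ≤ nn ∧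
    S (label (queue i)) = shape (sets xs) σ 0 e

section

variable {M : Machine} {q m n : ℕ} {xs : ℕ → List (Fin q)} {pt : ℕ → ℕ}

theorem shape_first {σ : Fin q} {e : ℕ} (h : σ ∈ xs e) (hno : ∀ i < e, σ ∉ xs i) :
    shape (sets xs) σ 0 e = {0} := by
  ext d
  rw [mem_shape, mem_singleton]
  constructor
  · rintro ⟨h1, h2⟩
    by_contra hd
    exact hno (e - d) (by omega) (by simpa using h2)
  · rintro rfl
    exact ⟨by omega, by simpa using h⟩

theorem shape_next {σ : Fin q} {e e' : ℕ} (h : σ ∈ xs e') (he : e < e')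
    (hno : NoneBetween xs σ e e') :
    shape (sets xs) σ 0 e' = child (shape (sets xs) σ 0 e) (e' - e) :=
  shape_eq_child (by simpa using h) (Nat.zero_le _) he fun i _ h1 h2 => by
    simpa using hno i h1 h2

theorem exists_previous {σ : Fin q} {e : ℕ} (h : ¬ ∀ i < e, σ ∉ xs i) :
    ∃ i < e, σ ∈ xs i ∧ NoneBetween xs σ i e := by
  push Not at h
  obtain ⟨i, hi, hσ⟩ := h
  have hne : ((range e).filter (σ ∈ xs ·)).Nonempty := ⟨i, by simp [hi, hσ]⟩
  have hmax := max'_mem _ hne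
  rw [mem_filter, mem_range] at hmax
  refine ⟨_, hmax.1, hmax.2, fun j h1 h2 h3 => ?_⟩
  have := le_max' ((range e).filter (σ ∈ xs ·)) j (by simp [h2, h3])
  omega

variable (C : Layout M q m n xs pt) {lastEv lastPos succ gap queue₀ : ℕ → ℕ} {tl₀ : ℕ}
  (hS : Scanned m xs pt M.len lastEv lastPos succ gap queue₀ tl₀)
  {nn hd tl : ℕ} {S : ℕ → Finset ℕ} {queue par label : ℕ → ℕ}

include C

theorem Queued.tl_le (Q : Queued m xs pt succ gap nn S hd tl queue par label) : tl ≤ M.len := by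
  have : (range tl).card ≤ (range M.len).card := by
    refine card_le_card_of_injOn queue (fun i hi => ?_) (fun i hi j hj => ?_)
    · obtain ⟨e, σ, h1⟩ := Q.ev i (by simpa using hi)
      simpa using (C.ev_bound h1).2
    · exact Q.inj i (by simpa using hi) j (by simpa using hj)
  simpa using this

include hS

/-- All occurrences of smaller rank than the head of the queue have a node. -/
theorem Queued.processed (Q : Queued m xs pt succ gap nn S hd tl queue par label) :
    ∀ e B σ, Ev m xs pt B e σ → (∀ e' σ', hd < tl → Ev m xs pt (queue hd) e' σ' →
      rank xs σ e < rank xs σ' e') → ∃ i < hd, queue i = B := by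
  intro e
  induction e using Nat.strong_induction_on with
  | _ e ih =>
    intro B σ hB hlt
    have key : ∀ j < tl, queue j = B → ∃ i < hd, queue i = B := by
      intro j hj hjB
      refine ⟨j, ?_, hjB⟩
      by_contra hcon
      obtain ⟨e', σ', hev⟩ := Q.ev hd (by omega)
      have h1 := hlt e' σ' (by omega) hev
      have h2 := Q.sorted hd j (by omega) hj e' σ' e σ hev (hjB ▸ hB)
      omega
    by_cases hf : ∀ i < e, σ ∉ xs i
    · obtain ⟨j, hj, hjB⟩ := Q.first B e σ hB hf
      exact key j hj hjB
    · obtain ⟨e₀, he₀, hσ₀, hnb⟩ := exists_previous hf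
      obtain ⟨B₀, hB₀⟩ := Layout.exists_ev (pt := pt) (he₀.trans hB.1) hσ₀
      have hsh := shape_next (Layout.ev_mem hB) he₀ hnb
      -- The previous occurrence has rank one less, so it has been processed by induction; at that
      -- time the present one was put into the queue.
      obtain ⟨i, hi, hiB⟩ := ih e₀ he₀ B₀ σ hB₀ fun e' σ' h1 h2 => by
        have := hlt e' σ' h1 h2
        unfold rank at this ⊢
        rw [hsh, card_child (by omega)] at this
        omega
      have hnx := (hS.nxt B₀ e₀ B e σ hB₀ hB (C.ev_bound hB).2 he₀ hnb).1
      obtain ⟨j, hj, hjB⟩ := Q.pushed i hi (by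
        rw [hiB, hnx]; exact (C.ev_bound hB).1.ne')
      exact key j hj (by rw [hjB, hiB, hnx])

/-- All smaller shapes have a node when the head of the queue is processed. -/
theorem Queued.complete (Q : Queued m xs pt succ gap nn S hd tl queue par label)
    {st : ℕ} {ch depth fail : ℕ → ℕ} (T : Trie (InTrie (sets xs) m) st nn S ch depth fail)
    {e : ℕ} {σ : Fin q} (hev : Ev m xs pt (queue hd) e σ) {D : Finset ℕ}
    (hD : InTrie (sets xs) m D) (hcard : D.card < rank xs σ e) : ∃ v ≤ nn, S v = D := by
  rcases hD with rfl | rfl | ⟨e', he', τ, hτ, rfl⟩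
  · exact ⟨0, Nat.zero_le _, T.zero⟩
  · exact ⟨1, T.pos, T.one⟩
  · obtain ⟨B, hB⟩ := Layout.exists_ev (pt := pt) he' (by simpa using hτ)
    obtain ⟨i, hi, hiB⟩ := Q.processed C hS e' B τ hB fun e₁ σ₁ _ h2 => by
      obtain ⟨rfl, rfl⟩ := C.ev_unique hev h2
      exact hcard
    obtain ⟨h1, h2⟩ := Q.label i hi e' τ (hiB ▸ hB)
    exact ⟨_, h1, h2⟩

/-- The successor of the head has a rank larger by one, and by `near` no queued entry has a larger
rank: appending it keeps the queue sorted. It is not in the queue yet, since by `pred` its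
predecessor, the head, would have been processed before. -/
theorem Queued.step (Q : Queued m xs pt succ gap nn S hd tl queue par label)
    (hlt : hd < tl) {nn' : ℕ} {S' : ℕ → Finset ℕ} (hnn : nn ≤ nn') (hSS : ∀ v ≤ nn, S' v = S v)
    {v : ℕ} (hv : v ≤ nn')
    (hvS : S' v = child (S (par (queue hd))) (gap (queue hd))) :
    (succ (queue hd) = 0 → Queued m xs pt succ gap nn' S' (hd + 1) tl queue par
      (Function.update label (queue hd) v)) ∧
    (succ (queue hd) ≠ 0 → Queued m xs pt succ gap nn' S' (hd + 1) (tl + 1)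
      (Function.update queue tl (succ (queue hd))) (Function.update par (succ (queue hd)) v)
      (Function.update label (queue hd) v)) := by
  obtain ⟨e, σ, hev⟩ := Q.ev hd hlt
  have hlabel : ∀ i < hd + 1, ∀ e σ, Ev m xs pt (queue i) e σ →
      Function.update label (queue hd) v (queue i) ≤ nn' ∧
      S' (Function.update label (queue hd) v (queue i)) = shape (sets xs) σ 0 e := by
    intro i hi e₁ σ₁ h1
    rcases Nat.lt_succ_iff_lt_or_eq.1 hi with h2 | rfl
    · rw [Function.update_of_ne fun h => h2.ne (Q.inj i (by omega) hd hlt h)]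
      obtain ⟨h3, h4⟩ := Q.label i h2 e₁ σ₁ h1
      exact ⟨by omega, by rw [hSS _ h3, h4]⟩
    · rw [Function.update_self]
      exact ⟨hv, by rw [hvS, (Q.par i hlt e₁ σ₁ h1).2.2]⟩
  have hnear : ∀ i < tl, hd + 1 < tl → ∀ e σ e' σ', Ev m xs pt (queue (hd + 1)) e σ →
      Ev m xs pt (queue i) e' σ' → rank xs σ' e' ≤ rank xs σ e + 1 := by
    intro i hi h1 e₁ σ₁ e₂ σ₂ h2 h3
    have h4 := Q.near i hi hlt e σ e₂ σ₂ hev h3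
    have h5 := Q.sorted hd (hd + 1) (by omega) h1 e σ e₁ σ₁ hev h2
    omega
  constructor
  · intro h0
    refine ⟨hlt, Q.ev, Q.inj, Q.sorted, hnear, Q.first, ?_, ?_, Q.par_first, ?_, hlabel⟩
    · intro i hi hne
      rcases Nat.lt_succ_iff_lt_or_eq.1 hi with h2 | rfl
      · exact Q.pushed i h2 hne
      · exact absurd h0 hne
    · intro j hj e' σ B e h1 h2 h3 h4
      obtain ⟨i, hi, h5⟩ := Q.pred j hj e' σ B e h1 h2 h3 h4
      exact ⟨i, by omega, h5⟩
    · intro j hj e₁ σ₁ h1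
      obtain ⟨h2, h3, h4⟩ := Q.par j hj e₁ σ₁ h1
      exact ⟨by omega, h3, by rw [hSS _ h2, h4]⟩
  · intro h0
    obtain ⟨e', hev', -, hee, hnb⟩ := hS.succ_ne _ e σ hev h0
    set B' := succ (queue hd) with hB'
    have hsh := shape_next (Layout.ev_mem hev') hee hnb
    have hrk : rank xs σ e' = rank xs σ e + 1 := by
      unfold rank; rw [hsh, card_child (by omega)]
    have hnot : ∀ j < tl, queue j ≠ B' := by
      intro j hj h
      obtain ⟨i, hi, h5⟩ := Q.pred j hj e' σ _ e (h ▸ hev') hev hee hnb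
      exact hi.ne (Q.inj i (by omega) hd hlt h5)
    have hq : ∀ j < tl, Function.update queue tl B' j = queue j := fun j hj =>
      Function.update_of_ne hj.ne _ _
    have hgap := (hS.nxt _ e B' e' σ hev hev' (C.ev_bound hev').2 hee hnb).2
    refine ⟨by omega, ?_, ?_, ?_, ?_, ?_, ?_, ?_, ?_, ?_, ?_⟩
    · intro i hi
      rcases Nat.lt_succ_iff_lt_or_eq.1 hi with h2 | rfl
      · rw [hq i h2]; exact Q.ev i h2
      · rw [Function.update_self]; exact ⟨e', σ, hev'⟩
    · intro i hi j hj h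
      rcases Nat.lt_succ_iff_lt_or_eq.1 hi with h2 | rfl <;>
      rcases Nat.lt_succ_iff_lt_or_eq.1 hj with h3 | rfl
      · rw [hq i h2, hq j h3] at h; exact Q.inj i h2 j h3 h
      · rw [hq i h2, Function.update_self] at h; exact absurd h (hnot i h2)
      · rw [hq j h3, Function.update_self] at h; exact absurd h.symm (hnot j h3)
      · rfl
    · intro i j hij hj e₁ σ₁ e₂ σ₂ g1 g2
      rcases Nat.lt_succ_iff_lt_or_eq.1 hj with h3 | rfl
      · rw [hq i (by omega)] at g1
        rw [hq j h3] at g2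
        exact Q.sorted i j hij h3 e₁ σ₁ e₂ σ₂ g1 g2
      · rw [Function.update_self] at g2
        obtain ⟨rfl, rfl⟩ := C.ev_unique g2 hev'
        rcases hij.lt_or_eq with h4 | rfl
        · rw [hq i h4] at g1
          have := Q.near i h4 hlt e σ₂ e₁ σ₁ hev g1
          omega
        · rw [Function.update_self] at g1
          obtain ⟨rfl, rfl⟩ := C.ev_unique g1 hev'
          exact le_rfl
    · intro i hi h1 e₁ σ₁ e₂ σ₂ g1 g2
      rcases Nat.lt_succ_iff_lt_or_eq.1 hi with h2 | rfl
      · rw [hq i h2] at g2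
        rcases Nat.lt_succ_iff_lt_or_eq.1 h1 with h4 | h4
        · rw [hq _ h4] at g1
          exact hnear i h2 h4 _ _ _ _ g1 g2
        · rw [h4, Function.update_self] at g1
          obtain ⟨rfl, rfl⟩ := C.ev_unique g1 hev'
          have := Q.near i h2 hlt e σ₁ e₂ σ₂ hev g2
          omega
      · rw [Function.update_self] at g2
        obtain ⟨rfl, rfl⟩ := C.ev_unique g2 hev'
        rcases Nat.lt_succ_iff_lt_or_eq.1 h1 with h4 | h4
        · rw [hq _ h4] at g1
          have := Q.sorted hd (hd + 1) (by omega) h4 e σ₂ e₁ σ₁ hev g1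
          omega
        · rw [h4, Function.update_self] at g1
          obtain ⟨rfl, rfl⟩ := C.ev_unique g1 hev'
          omega
    · intro B e₁ σ₁ h1 h2
      obtain ⟨i, hi, h3⟩ := Q.first B e₁ σ₁ h1 h2
      exact ⟨i, by omega, by rw [hq i hi, h3]⟩
    · intro i hi hne
      rw [hq i (by omega)] at hne ⊢
      rcases Nat.lt_succ_iff_lt_or_eq.1 hi with h2 | rfl
      · obtain ⟨j, hj, h3⟩ := Q.pushed i h2 hne
        exact ⟨j, by omega, by rw [hq j hj, h3]⟩
      · exact ⟨tl, by omega, by rw [Function.update_self]⟩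
    · intro j hj e₁ σ₁ B e₂ g1 g2 g3 g4
      rcases Nat.lt_succ_iff_lt_or_eq.1 hj with h3 | rfl
      · rw [hq j h3] at g1
        obtain ⟨i, hi, h5⟩ := Q.pred j h3 e₁ σ₁ B e₂ g1 g2 g3 g4
        exact ⟨i, by omega, by rw [hq i (by omega), h5]⟩
      · rw [Function.update_self] at g1
        obtain ⟨rfl, rfl⟩ := C.ev_unique g1 hev'
        have : e₂ = e := by
          rcases lt_trichotomy e₂ e with h6 | h6 | h6
          · exact absurd (Layout.ev_mem hev) (g4 _ h6 hee)
          · exact h6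
          · exact absurd (Layout.ev_mem g2) (hnb _ h6 g3)
        subst this
        exact ⟨hd, by omega, by rw [hq hd hlt, C.ev_eq g2 hev]⟩
    · intro B e₁ σ₁ g1 g2
      rw [Function.update_of_ne, Q.par_first B e₁ σ₁ g1 g2]
      rintro rfl
      obtain ⟨rfl, rfl⟩ := C.ev_unique g1 hev'
      exact g2 _ hee (Layout.ev_mem hev)
    · intro j hj e₁ σ₁ g1
      rcases Nat.lt_succ_iff_lt_or_eq.1 hj with h3 | rfl
      · rw [hq j h3] at g1 ⊢
        rw [Function.update_of_ne (hnot j h3)]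
        obtain ⟨h2, h3, h4⟩ := Q.par j h3 e₁ σ₁ g1
        exact ⟨by omega, h3, by rw [hSS _ h2, h4]⟩
      · rw [Function.update_self] at g1
        obtain ⟨rfl, rfl⟩ := C.ev_unique g1 hev'
        rw [Function.update_self, Function.update_self, hgap]
        refine ⟨hv, .inr (by omega), ?_⟩
        rw [hvS, (Q.par hd hlt e σ₁ hev).2.2, hsh]
    · intro i hi e₁ σ₁ g1
      rw [hq i (by omega)] at g1 ⊢
      exact hlabel i hi e₁ σ₁ g1

omit C hS in
-- First occurrences all have rank 1 and shape `{0}`, the child of the root at any distance. Their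
-- `gap`, which was never set, is therefore irrelevant.
theorem Queued.init (hS : Scanned m xs pt M.len lastEv lastPos succ gap queue tl)
    (C : Layout M q m n xs pt) (hnn : S 0 = ∅) :
    Queued m xs pt succ gap nn S 0 tl queue (fun _ => 0) label where
  hd_le := Nat.zero_le _
  ev i hi := by
    obtain ⟨e, σ, h, -⟩ := hS.queue_mem i hi
    exact ⟨e, σ, h⟩
  inj := hS.queue_inj
  sorted i j hij hj e σ e' σ' h1 h2 := by
    obtain ⟨e₁, σ₁, g1, -, g3⟩ := hS.queue_mem i (by omega)
    obtain ⟨rfl, rfl⟩ := C.ev_unique h1 g1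
    obtain ⟨e₁, σ₁, g1, -, g4⟩ := hS.queue_mem j hj
    obtain ⟨rfl, rfl⟩ := C.ev_unique h2 g1
    unfold rank
    rw [shape_first (Layout.ev_mem h1) g3, shape_first (Layout.ev_mem h2) g4]
  near i hi hlt e σ e' σ' h1 h2 := by
    obtain ⟨e₁, σ₁, g1, -, g4⟩ := hS.queue_mem i hi
    obtain ⟨rfl, rfl⟩ := C.ev_unique h2 g1
    unfold rank
    rw [shape_first (Layout.ev_mem h2) g4, card_singleton]
    omega
  first B e σ h := hS.queue_all B e σ h (C.ev_bound h).2
  pushed _ h := absurd h (Nat.not_lt_zero _)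
  pred j hj e' σ B e h1 h2 h3 h4 := by
    obtain ⟨e₁, σ₁, g1, -, g4⟩ := hS.queue_mem j hj
    obtain ⟨rfl, rfl⟩ := C.ev_unique h1 g1
    exact absurd (Layout.ev_mem h2) (g4 _ h3)
  par_first _ _ _ _ _ := rfl
  par j hj e σ h1 := by
    obtain ⟨e₁, σ₁, g1, -, g4⟩ := hS.queue_mem j hj
    obtain ⟨rfl, rfl⟩ := C.ev_unique h1 g1
    refine ⟨Nat.zero_le _, .inl rfl, ?_⟩
    rw [hnn, child_empty, shape_first (Layout.ev_mem h1) g4]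
  label _ h := absurd h (Nat.not_lt_zero _)

end

end SetMatch

/-! ### Building the trie and the cost of the failure links -/

namespace SetMatch
open Finset WordRAM

/-- The child of the node `u` at distance `g`. -/
def transExpr (u g : Expr) : Expr := .get .child (u *ₑ Var.stride +ₑ g) +ₑ (u =ₑ .lit 0)

/-- Create a child of `node` at distance `gap`, and compute its failure link. -/
def newNode : Cmd :=
  .set .nodes (.var .nodes +ₑ .lit 1) ;;
  .set .f (.get .fail Var.node) ;;
  .loop (transExpr Var.f Var.gap =ₑ .lit 0) (.set .f (.get .fail Var.f)) ;;
  .put .fail Var.nodes (transExpr Var.f Var.gap) ;;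
  .put .depth Var.nodes (.get .depth Var.node +ₑ .lit 1) ;;
  .put .child (.var .node *ₑ Var.stride +ₑ Var.gap) Var.nodes ;;
  .set .x Var.nodes

/-- Give the head of the queue the node `x`, and queue the next occurrence of its character. -/
def trieLabel : Cmd :=
  .put .label Var.blk Var.x ;;
  .set .y (.get .succ Var.blk) ;;
  .ite Var.y
    (.put .par Var.y Var.x ;; .put .queue Var.tl Var.y ;; .set .tl (.var .tl +ₑ .lit 1)) .skip ;;
  .set .hd (.var .hd +ₑ .lit 1)

/-- Process the head of the queue. -/
def trieStep : Cmd :=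
  .set .blk (.get .queue Var.hd) ;;
  .set .node (.get .par Var.blk) ;;
  .set .gap (.get .gap Var.blk) ;;
  .set .x (transExpr Var.node Var.gap) ;;
  .ite Var.x .skip newNode ;;
  trieLabel

/-- Build the trie of the shapes of the pattern. -/
def buildTrie : Cmd :=
  .set .hd (.lit 0) ;;
  .set .nodes (.lit 1) ;;
  .put .depth (.lit 1) (.lit 1) ;;
  .loop (.var .hd <ₑ Var.tl) trieStep

abbrev TrieFrame : Store → Store → Prop :=
  Frame [.blk, .node, .gap, .x, .f, .nodes, .y, .tl, .hd] [.fail, .depth, .child, .label, .par, .queue]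

/-- The trie of the store. -/
abbrev StoreTrie (P : Finset ℕ → Prop) (st : ℕ) (S : ℕ → Finset ℕ) (h : Store) : Prop :=
  Trie P st (h.v .nodes) S (h.a .child) (h.a .depth) (h.a .fail)

section

variable {M : Machine} {q m n : ℕ} {xs : ℕ → List (Fin q)} {pt : ℕ → ℕ}

/-- The quadratic capacity of the arrays is needed for the transition table only: one row for every
node, one column for every distance. -/
theorem Layout.index_lt (C : Layout M q m n xs pt) {f g : ℕ} (hf : f ≤ M.len + 1)
    (hg : g ≤ m + n) : f * (m + n + 1) ≤ f * (m + n + 1) + g ∧ f * (m + n + 1) + g < M.cap := by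
  refine ⟨Nat.le_add_right _ _, lt_of_lt_of_le ?_ C.cap_ge⟩
  have h1 := C.len_ge
  calc f * (m + n + 1) + g < f * (m + n + 1) + (m + n + 1) := by omega
    _ = (f + 1) * (m + n + 1) := by ring
    _ ≤ _ := Nat.mul_le_mul (by omega) (by omega)

theorem transExpr_spec (C : Layout M q m n xs pt) {h : Store} {u g : Var}
    (hst : h.v .stride = m + n + 1) (hu : h.v u ≤ M.len + 1) (hg : h.v g ≤ m + n)
    (hval : h.a .child (h.v u * (m + n + 1) + h.v g) ≤ M.len + 1) :
    (transExpr u g).ok M h ∧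
    (transExpr u g).eval M.inp h = trans (h.a .child) (m + n + 1) (h.v u) (h.v g) := by
  have hw : M.w ≠ 0 := by have := M.one_lt; intro h0; simp [h0] at this
  have h1 := C.index_lt hu hg
  have h2 := M.fits
  have h3 := C.pow_bound
  refine ⟨?_, ?_⟩
  · simp only [transExpr, Expr.ok, Expr.eval, Op.val, Op.safe, hst]
    refine ⟨⟨⟨⟨trivial, trivial, by omega⟩, trivial, by omega⟩, by omega⟩,
      ⟨trivial, by omega, trivial⟩, ?_⟩
    rcases Nat.eq_zero_or_pos (h.v u) with h0 | h0
    · simp only [h0] at h1 hval ⊢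
      simp only [if_true]
      omega
    · simp only [h0.ne', if_false]
      omega
  · simp only [transExpr, Expr.eval, Op.val, hst, trans]
    rcases Nat.eq_zero_or_pos (h.v u) with h0 | h0
    · simp [h0]
    · simp [h0.ne']

theorem Trie.ch_le {P : Finset ℕ → Prop} {st nn : ℕ} {S : ℕ → Finset ℕ}
    {ch depth fail : ℕ → ℕ} (T : Trie P st nn S ch depth fail) {u g : ℕ} (hu : u ≤ nn)
    (hg : g < st) (hug : u = 0 ∨ 0 < g) : ch (u * st + g) ≤ nn := by
  rcases Nat.eq_zero_or_pos u with rfl | hpos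
  · rw [zero_mul, zero_add, T.ch_zero g hg]; exact Nat.zero_le _
  · by_cases h0 : ch (u * st + g) = 0
    · omega
    · exact (T.ch_mem u hu hpos g hg (by omega) h0).1

/-- The invariant of the search for a failure link. -/
structure FailInv (P : Finset ℕ → Prop) (S : ℕ → Finset ℕ) (u g : ℕ) (h : Store) (b : ℕ)
    (h' : Store) (b' : ℕ) : Prop where
  cand : Trie.Candidate P (h.v .nodes - 1) S u g (h'.v .f)
  frame : Frame [.f] [] h h'
  out : h'.out = h.out
  spent : b + 40 * (S (h'.v .f)).card ≤ b' + 40 * (S (h.v .f)).card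

/-- Every round of the search makes the candidate shape smaller, at a price of at most 40 credits.
The last inequality expresses this through the failure depths of the new node and of its parent. The
row of the new node consists of untouched zeros. -/
theorem newNode_spec (C : Layout M q m n xs pt) {P : Finset ℕ → Prop} (hP : ShapeFamily P)
    {S : ℕ → Finset ℕ} {h : Store} {b nn u g : ℕ} (T : StoreTrie P (m + n + 1) S h)
    (hst : h.v .stride = m + n + 1) (hnn : h.v .nodes = nn) (hnn' : nn ≤ M.len)
    (hu : h.v .node = u) (hg : h.v .gap = g) (hun : u ≤ nn) (hu0 : 0 < u) (hg0 : 0 < g)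
    (hgm : g ≤ m + n) (htr : trans (h.a .child) (m + n + 1) u g = 0) (hPc : P (child (S u) g))
    (hcomp : ∀ D, P D → D.card ≤ (S u).card → ∃ v ≤ nn, S v = D)
    (hcard : (S u).card ≤ M.len) (hb : 120 + 40 * (S (h.a .fail u)).card ≤ b) :
    vc M newNode (fun h' b' => ∃ S' : ℕ → Finset ℕ, (∀ v ≤ nn, S' v = S v) ∧
      StoreTrie P (m + n + 1) S' h' ∧ h'.v .nodes = nn + 1 ∧ h'.v .x = nn + 1 ∧
      S' (nn + 1) = child (S u) g ∧ (∀ v ≤ nn, h'.a .fail v = h.a .fail v) ∧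
      Frame [.f, .nodes, .x] [.fail, .depth, .child] h h' ∧ h'.out = h.out ∧
      b + 40 * (S' (h'.a .fail (nn + 1))).card ≤ b' + 160 + 40 * (S (h.a .fail u)).card) h b := by
  have hw : M.w ≠ 0 := by have := M.one_lt; intro h0; simp [h0] at this
  have hcap := C.cap_bound
  have hpow := C.pow_bound
  have hge := C.len_ge
  have hfit := M.fits
  unfold StoreTrie at T
  rw [hnn] at T
  have hgst : g < m + n + 1 := by omega
  have hidx := C.index_lt (f := u) (g := g) (by omega) hgm
  have hdep := T.depth u hun
  unfold newNode
  simp only [vc, Expr.ok, Expr.cost, Expr.eval, Op.val, Op.safe, hnn, hu, Store.set_v_same,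
    Store.set_a, Store.set_v_of_ne, ne_eq, reduceCtorEq, not_false_eq_true]
  refine ⟨⟨trivial, by omega, by omega⟩, by omega, ⟨trivial, by omega⟩, by omega, ?_⟩
  refine wp_loop (FailInv P S u g ((h.set .nodes (nn + 1)).set .f (h.a .fail u)) (b - 6 - 11))
    ⟨by simpa using T.candidate_fail hP hun hu0 hg0, Frame.refl _ _ _, rfl, by simp⟩ ?_
  intro h' b' hI
  have hcand := hI.cand
  have hsp := hI.spent
  simp only [Store.set_v_same, Store.set_v_of_ne, ne_eq, reduceCtorEq, not_false_eq_true,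
    Nat.add_sub_cancel] at hcand hsp
  have hv : ∀ y, y ≠ .f → y ≠ .nodes → h'.v y = h.v y := by
    intro y h1 h2
    rw [hI.frame.v y (by simpa using h1)]
    simp [h1, h2]
  have ha : h'.a = h.a := by
    funext k; rw [hI.frame.a k (by simp)]; rfl
  have hnn₂ : h'.v .nodes = nn + 1 := by rw [hI.frame.v .nodes (by simp)]; simp
  have hg₂ : h'.v .gap = g := by rw [hv _ (by simp) (by simp), hg]
  have hu₂ : h'.v .node = u := by rw [hv _ (by simp) (by simp), hu]
  have hst₂ : h'.v .stride = m + n + 1 := by rw [hv _ (by simp) (by simp), hst]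
  have hfle := hcand.le
  have hchle := T.ch_le hfle hgst (.inr hg0)
  have htle : trans (h.a .child) (m + n + 1) (h'.v .f) g ≤ nn := by
    by_cases h0 : trans (h.a .child) (m + n + 1) (h'.v .f) g = 0
    · omega
    · exact (T.trans_mem hfle hgst (.inr hg0) h0).1
  obtain ⟨hok, hev⟩ := transExpr_spec C (h := h') (u := .f) (g := .gap) hst₂ (by omega)
    (by omega) (by rw [ha, hg₂]; omega)
  rw [ha, hg₂] at hev
  have hcost : (transExpr Var.f Var.gap).cost = 20 := rfl
  refine ⟨⟨hok, by simp, trivial⟩, by simp only [Expr.cost, hcost]; omega, ?_, ?_⟩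
  · intro hne
    have h0 : trans (h.a .child) (m + n + 1) (h'.v .f) g = 0 := by
      simpa [hev] using hne
    obtain ⟨hc2, hlt⟩ := T.candidate_step hP hun hu0 hg0 hgst hcomp hcand h0
    simp only [vc, Expr.ok, Expr.cost, Expr.eval, hcost]
    refine ⟨⟨trivial, by omega⟩, by omega, ⟨?_, hI.frame.set (by simp) _, hI.out, ?_⟩⟩
    · simpa [ha] using hc2
    · simp [ha]; omega
  · intro hne
    have h0 : trans (h.a .child) (m + n + 1) (h'.v .f) g ≠ 0 := by
      simpa [hev] using hne
    have hT := T.insert hP hun hu0 hg0 hgst hPc htr hcand h0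
    simp only [Expr.cost, hcost, hev, hok, hnn₂, ha, hu₂,
      hst₂, hg₂, Store.put_v, Store.put_a_same, Store.put_a_of_ne, ne_eq, reduceCtorEq,
      not_false_eq_true]
    refine ⟨trivial, by omega, trivial, by omega, trivial, by omega, ⟨⟨trivial, by omega⟩,
      by omega, by omega⟩, by omega, ⟨⟨trivial, trivial, by omega⟩, trivial, by omega⟩, by omega,
      trivial, by omega, trivial, by omega, ?_⟩
    refine ⟨Function.update S (nn + 1) (child (S u) g), fun v hv => Function.update_of_ne (by omega) _ _,
      ?_, by simp, by simp, by simp, fun v hv => ?_, ?_, hI.out, ?_⟩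
    · simpa [StoreTrie, ha, hnn₂] using hT
    · simp [Function.update_of_ne (show v ≠ nn + 1 by omega)]
    · refine ((((Frame.trans ?_ (hI.frame.mono (by simp) (by simp))).put (by simp) _ _).put
        (by simp) _ _).put (by simp) _ _).set (by simp) _
      exact ((Frame.refl _ _ _).set (by simp) _).set (by simp) _
    · simp only [Function.update_self]
      obtain ⟨h5, h6⟩ := T.trans_mem hfle hgst (.inr hg0) h0
      rw [Function.update_of_ne (by omega), h6, card_child hg0]
      omega

/-- The potential of the queue. -/
def potential (S : ℕ → Finset ℕ) (fail par queue : ℕ → ℕ) (a b : ℕ) : ℕ :=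
  ∑ i ∈ Ico a b, (S (fail (par (queue i)))).card

/-- The invariant of `buildTrie`. -/
structure TrieInv {q : ℕ} (m n : ℕ) (xs : ℕ → List (Fin q)) (pt : ℕ → ℕ) (h : Store) (b : ℕ)
    (h' : Store) (b' : ℕ) : Prop where
  trie : ∃ S, StoreTrie (InTrie (sets xs) m) (m + n + 1) S h' ∧
    Queued m xs pt (h.a .succ) (h.a .gap) (h'.v .nodes) S (h'.v .hd) (h'.v .tl) (h'.a .queue)
      (h'.a .par) (h'.a .label) ∧
    b + 40 * potential S (h'.a .fail) (h'.a .par) (h'.a .queue) (h'.v .hd) (h'.v .tl) ≤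
      b' + 300 * h'.v .hd + 20
  nodes_le : h'.v .nodes ≤ h'.v .hd + 1
  frame : TrieFrame h h'
  out : h'.out = h.out

/-- The successor enters the queue with parent `x` and contributes the depth of the failure link of
`x` to the potential. In `hsp` these credits are set aside whether or not a successor exists. -/
theorem trieLabel_spec (C : Layout M q m n xs pt) {lastEv lastPos queue₀ : ℕ → ℕ} {tl₀ : ℕ}
    {h : Store} (hSc : Scanned m xs pt M.len lastEv lastPos (h.a .succ) (h.a .gap) queue₀ tl₀)
    {nn : ℕ} {S S' : ℕ → Finset ℕ} {h₁ : Store} {b b₁ : ℕ}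
    (T : StoreTrie (InTrie (sets xs) m) (m + n + 1) S' h₁)
    (Q : Queued m xs pt (h.a .succ) (h.a .gap) nn S (h₁.v .hd) (h₁.v .tl) (h₁.a .queue)
      (h₁.a .par) (h₁.a .label))
    (hlt : h₁.v .hd < h₁.v .tl) (hnn : nn ≤ h₁.v .nodes) (hSS : ∀ v ≤ nn, S' v = S v)
    (hblk : h₁.v .blk = h₁.a .queue (h₁.v .hd)) (hx : h₁.v .x ≤ h₁.v .nodes)
    (hxS : S' (h₁.v .x) = child (S (h₁.a .par (h₁.v .blk))) (h.a .gap (h₁.v .blk)))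
    (hnodes : h₁.v .nodes ≤ h₁.v .hd + 2) (hF : TrieFrame h h₁) (hout : h₁.out = h.out)
    (hb : 70 ≤ b₁)
    (hsp : b + 40 * (potential S' (h₁.a .fail) (h₁.a .par) (h₁.a .queue) (h₁.v .hd + 1) (h₁.v .tl)
      + (S' (h₁.a .fail (h₁.v .x))).card) + 70 ≤ b₁ + 300 * (h₁.v .hd + 1) + 20) :
    vc M trieLabel (TrieInv m n xs pt h b) h₁ b₁ := by
  have hw : M.w ≠ 0 := by have := M.one_lt; intro h0; simp [h0] at this
  have hcap := C.cap_bound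
  have hpow := C.pow_bound
  have hge := C.len_ge
  have hfit := M.fits
  obtain ⟨e, σ, hev⟩ := Q.ev _ hlt
  have hbd := C.ev_bound hev
  rw [← hblk] at hev hbd
  have htl := Q.tl_le C
  have hsucc : h₁.a .succ = h.a .succ := hF.a _ (by simp)
  obtain ⟨q1, q2⟩ := Q.step C hSc hlt hnn hSS hx (by rw [hxS, hblk])
  rw [← hblk] at q1 q2
  have hsb : h.a .succ (h₁.v .blk) < M.len := by
    by_cases h0 : h.a .succ (h₁.v .blk) = 0
    · omega
    · obtain ⟨e', -, h2, -⟩ := hSc.succ_ne _ _ _ hev h0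
      exact h2
  unfold trieLabel
  simp [hw, hsucc]
  constructorm* _ ∧ _
  all_goals try omega
  · intro h0
    constructorm* _ ∧ _
    all_goals try omega
    refine ⟨⟨S', ?_, ?_, ?_⟩, by simpa using hnodes, ?_, by simpa using hout⟩
    · simpa [StoreTrie] using T
    · simpa using q2 h0
    · have hQ := q2 h0
      have : potential S' (h₁.a .fail)
          (Function.update (h₁.a .par) (h.a .succ (h₁.v .blk)) (h₁.v .x))
          (Function.update (h₁.a .queue) (h₁.v .tl) (h.a .succ (h₁.v .blk))) (h₁.v .hd + 1)
          (h₁.v .tl + 1) =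
          potential S' (h₁.a .fail) (h₁.a .par) (h₁.a .queue) (h₁.v .hd + 1) (h₁.v .tl)
            + (S' (h₁.a .fail (h₁.v .x))).card := by
        unfold potential
        rw [sum_Ico_succ_top hlt]
        congr 1
        · refine sum_congr rfl fun i hi => ?_
          rw [mem_Ico] at hi
          have h3 := hQ.inj i (by omega) (h₁.v .tl) (by omega)
          rw [Function.update_of_ne hi.2.ne, Function.update_self] at h3
          rw [Function.update_of_ne hi.2.ne, Function.update_of_ne fun h => hi.2.ne (h3 h)]
        · simp
      simp [this]
      omega
    · exact ((((((hF.put (by simp) _ _).set (by simp) _).put (by simp) _ _).put (by simp) _ _).set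
        (by simp) _).set (by simp) _)
  · intro h0
    constructorm* _ ∧ _
    all_goals try omega
    refine ⟨⟨S', ?_, ?_, ?_⟩, by simpa using hnodes, ?_, by simpa using hout⟩
    · simpa [StoreTrie] using T
    · simpa using q1 h0
    · simp
      omega
    · exact (((hF.put (by simp) _ _).set (by simp) _).set (by simp) _)

theorem rank_le {σ : Fin q} {e : ℕ} (C : Layout M q m n xs pt) (he : e < m) :
    rank xs σ e ≤ M.len := by
  have h1 : rank xs σ e ≤ (range (e + 1 - 0)).card := card_le_card (filter_subset _ _)
  have h2 := C.len_ge
  rw [card_range] at h1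
  omega

/-- The head releases the failure depth of its parent `u`. The failure depth of its own node is
larger by at most one, up to the steps spent in the search if the node is new. So the net cost of a
round is bounded, and the number of rounds is the number of occurrences. -/
theorem trieStep_spec (C : Layout M q m n xs pt) {lastEv lastPos queue₀ : ℕ → ℕ} {tl₀ : ℕ}
    {h : Store} (hSc : Scanned m xs pt M.len lastEv lastPos (h.a .succ) (h.a .gap) queue₀ tl₀)
    (hst : h.v .stride = m + n + 1) {b : ℕ} (hb : 300 * M.len + 20 ≤ b) {h' : Store} {b' : ℕ}
    (hI : TrieInv m n xs pt h b h' b') (hlt : h'.v .hd < h'.v .tl) :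
    6 ≤ b' ∧ vc M trieStep (TrieInv m n xs pt h b) h' (b' - 6) := by
  have hw : M.w ≠ 0 := by have := M.one_lt; intro h0; simp [h0] at this
  have hcap := C.cap_bound
  have hpow := C.pow_bound
  have hge := C.len_ge
  have hfit := M.fits
  have hP := shapeFamily_inTrie (sets xs) m
  obtain ⟨S, T, Q, hsp⟩ := hI.trie
  have hF := hI.frame
  have hnl := hI.nodes_le
  have hst' : h'.v .stride = m + n + 1 := by rw [← hst]; exact hF.v _ (by simp)
  have hgap : h'.a .gap = h.a .gap := hF.a _ (by simp)
  obtain ⟨e, σ, hev⟩ := Q.ev _ hlt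
  have hbd := C.ev_bound hev
  have htl := Q.tl_le C
  obtain ⟨hu, hug, hsh⟩ := Q.par _ hlt e σ hev
  have hgm := hSc.gap_le (h'.a .queue (h'.v .hd))
  have hpot : potential S (h'.a .fail) (h'.a .par) (h'.a .queue) (h'.v .hd) (h'.v .tl) =
      (S (h'.a .fail (h'.a .par (h'.a .queue (h'.v .hd))))).card +
      potential S (h'.a .fail) (h'.a .par) (h'.a .queue) (h'.v .hd + 1) (h'.v .tl) := by
    unfold potential
    rw [sum_eq_sum_Ico_succ_bot hlt]
  rw [hpot] at hsp
  refine ⟨by omega, ?_⟩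
  generalize hA : h'.a .queue (h'.v .hd) = A at *
  generalize hu' : h'.a .par A = u at *
  generalize hg' : h.a .gap A = g at *
  set h₁ := (((h'.set .blk A).set .node u).set .gap g) with hh₁
  have hval := T.ch_le hu (show g < m + n + 1 by omega) hug
  obtain ⟨hok, hev₁⟩ := transExpr_spec C (h := h₁) (u := .node) (g := .gap) (by simpa [hh₁] using hst')
    (by simp [hh₁]; omega) (by simp [hh₁]; omega) (by simp [hh₁]; omega)
  have hcost : (transExpr Var.node Var.gap).cost = 20 := rfl
  replace hev₁ : (transExpr Var.node Var.gap).eval M.inp h₁ =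
    trans (h'.a .child) (m + n + 1) u g := by simpa [hh₁] using hev₁
  unfold trieStep
  simp only [vc, Expr.ok, Expr.cost, Expr.eval, Store.set_v_same, Store.set_v_of_ne, ne_eq,
    reduceCtorEq, not_false_eq_true, Store.set_a, hA, hu', hgap, hg']
  rw [← hh₁, hev₁, hcost]
  refine ⟨⟨trivial, by omega⟩, by omega, ⟨trivial, by omega⟩, by omega, ⟨trivial, by omega⟩,
    by omega, hok, by omega, trivial, by omega, ?_, ?_⟩
  · intro h0
    refine ⟨by omega, ?_⟩
    obtain ⟨h2, h3⟩ := T.trans_mem hu (by omega) hug h0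
    have h4 := T.card_fail_trans_le hP hu (show g < m + n + 1 by omega) hug h0
    refine trieLabel_spec C hSc (S := S) (S' := S) (nn := h'.v .nodes) ?_ ?_ ?_ ?_ ?_ ?_ ?_ ?_ ?_ ?_
      ?_ ?_ ?_
    · simpa [hh₁, StoreTrie] using T
    · simpa [hh₁] using Q
    · simpa [hh₁] using hlt
    · simp [hh₁]
    · intros; rfl
    · simp [hh₁, hA]
    · simpa [hh₁] using h2
    · simp [hh₁, h3, hu', hg']
    · simp [hh₁]; omega
    · exact (((hF.set (by simp) _).set (by simp) _).set (by simp) _).set (by simp) _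
    · exact hI.out
    · omega
    · simp [hh₁]
      omega
  · intro h0
    have hu0 : 0 < u := by
      by_contra hcon
      obtain rfl : u = 0 := by omega
      rw [T.trans_zero (by omega)] at h0
      omega
    have hg0 : 0 < g := by omega
    have hcard : rank xs σ e = (S u).card + 1 := by
      unfold rank; rw [← hsh, card_child hg0]
    have hrl := rank_le C hev.1 (σ := σ)
    refine vc_mono (newNode_spec C hP (S := S) (nn := h'.v .nodes) (u := u) (g := g) ?_ ?_ ?_ ?_ ?_
      ?_ hu hu0 hg0 ?_ ?_ ?_ ?_ ?_ ?_) ?_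
    · simpa [hh₁, StoreTrie] using T
    · simpa [hh₁] using hst'
    · simp [hh₁]
    · omega
    · simp [hh₁]
    · simp [hh₁]
    · omega
    · simpa [hh₁] using h0
    · rw [hsh]
      exact .inr (.inr ⟨e, hev.1, σ, by simpa using Layout.ev_mem hev, rfl⟩)
    -- A shape no larger than `S u` is smaller than the shape of the head; the order of the queue
    -- guarantees that it has a node.
    · intro D hD hDc
      refine Q.complete C hSc T (hA ▸ hev) hD (by omega)
    · omega
    · simp [hh₁]; omega
    · rintro h₂ b₂ ⟨S', k1, k2, k3, k4, k5, k6, k7, k8, k9⟩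
      have hv : ∀ y, y ≠ .f → y ≠ .nodes → y ≠ .x → h₂.v y = h₁.v y := by
        intro y g1 g2 g3
        rw [k7.v y (by simp [g1, g2, g3]), Store.set_v_of_ne _ _ _ _ g3]
      have e1 : h₂.v .hd = h'.v .hd := by rw [hv _ (by simp) (by simp) (by simp)]; simp [hh₁]
      have e2 : h₂.v .tl = h'.v .tl := by rw [hv _ (by simp) (by simp) (by simp)]; simp [hh₁]
      have e3 : h₂.v .blk = A := by rw [hv _ (by simp) (by simp) (by simp)]; simp [hh₁]
      have e4 : h₂.a .queue = h'.a .queue := k7.a _ (by simp)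
      have e5 : h₂.a .par = h'.a .par := k7.a _ (by simp)
      have e6 : h₂.a .label = h'.a .label := k7.a _ (by simp)
      have hp2 : potential S' (h₂.a .fail) (h'.a .par) (h'.a .queue) (h'.v .hd + 1) (h'.v .tl) =
          potential S (h'.a .fail) (h'.a .par) (h'.a .queue) (h'.v .hd + 1) (h'.v .tl) := by
        unfold potential
        refine sum_congr rfl fun i hi => ?_
        rw [mem_Ico] at hi
        obtain ⟨e', σ', hev'⟩ := Q.ev i hi.2
        have h5 := (Q.par i hi.2 e' σ' hev').1
        rw [k6 _ h5, k1]
        · rfl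
        · exact T.fail_le h5
      have k9' : b' - 6 - (1 + 1 + ((1 + (1 + (1 + (1 + (1 + 1))))) + 1) + 2) -
          (1 + 1 + ((1 + (1 + (1 + (1 + (1 + 1))))) + 1) + 2) -
          (1 + 1 + ((1 + (1 + (1 + (1 + (1 + 1))))) + 1) + 2) - (20 + 2) - (1 + 1 + 1) +
          40 * (S' (h₂.a .fail (h'.v .nodes + 1))).card ≤ b₂ + 160 + 40 * (S (h'.a .fail u)).card :=
        k9
      refine trieLabel_spec C hSc (S := S) (S' := S') (nn := h'.v .nodes) k2 ?_ ?_ ?_ k1 ?_ ?_ ?_ ?_ ?_ ?_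
        ?_ ?_
      · rw [e1, e2, e4, e5, e6]; exact Q
      · rw [e1, e2]; exact hlt
      · omega
      · rw [e3, e4, e1, hA]
      · rw [k3, k4]
      · rw [k4, k5, e3, e5, hu', hg']
      · omega
      · refine Frame.trans ?_ (k7.mono (by simp) (by simp))
        exact (((hF.set (by simp) _).set (by simp) _).set (by simp) _).set (by simp) _
      · rw [k8]; exact hI.out
      · omega
      · rw [e1, e2, e4, e5, hp2, k4]
        omega

theorem buildTrie_spec (C : Layout M q m n xs pt) {lastEv lastPos : ℕ → ℕ}
    {h : Store} (hSc : Scanned m xs pt M.len lastEv lastPos (h.a .succ) (h.a .gap) (h.a .queue)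
      (h.v .tl))
    (hst : h.v .stride = m + n + 1) (hpar : h.a .par = fun _ => 0) (hdep : h.a .depth = fun _ => 0)
    (hfail : h.a .fail = fun _ => 0) (hch : h.a .child = fun _ => 0) {b : ℕ}
    (hb : 300 * M.len + 40 ≤ b) :
    wp M buildTrie (fun h' b' => b ≤ b' + 300 * M.len + 40 ∧ TrieFrame h h' ∧ h'.out = h.out ∧
      h'.v .nodes ≤ M.len + 1 ∧
      ∃ S, StoreTrie (InTrie (sets xs) m) (m + n + 1) S h' ∧
      ∀ B e σ, Ev m xs pt B e σ → h'.a .label B ≤ h'.v .nodes ∧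
        S (h'.a .label B) = shape (sets xs) σ 0 e) h b := by
  have hw : M.w ≠ 0 := by have := M.one_lt; intro h0; simp [h0] at this
  have hcap := C.cap_bound
  have hpow := C.pow_bound
  apply wp_of_vc
  unfold buildTrie
  simp only [vc, Expr.ok, Expr.cost, Expr.eval]
  refine ⟨by omega, by omega, by omega, by omega, by omega, by omega, by omega, by omega,
    wp_loop (TrieInv m n xs pt h b) ?_ ?_⟩
  · refine ⟨⟨fun v => if v = 1 then {0} else ∅, ?_, ?_, ?_⟩, by simp, ?_, rfl⟩
    · have := Trie.init (P := InTrie (sets xs) m) (.inl rfl) (.inr (.inl rfl)) (m + n + 1)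
      simpa [StoreTrie, hdep, hch, hfail] using this
    · have := Queued.init (nn := 1) (S := fun v => if v = 1 then {0} else ∅) (label := h.a .label)
        hSc C (by simp)
      simpa [hpar] using this
    · simp [potential, hfail]
      omega
    · exact (((Frame.refl _ _ _).set (by simp) _).set (by simp) _).put (by simp) _ _
  · intro h' b' hI
    obtain ⟨S, T, Q, hsp⟩ := hI.trie
    have htl := Q.tl_le C
    have hhd := Q.hd_le
    have hnl := hI.nodes_le
    refine ⟨by simp, by simp; omega, ?_, ?_⟩
    · intro hlt
      exact (trieStep_spec C hSc hst (by omega) hI (eval_lt_ne_zero.1 hlt)).2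
    · intro hge
      have heq : h'.v .hd = h'.v .tl := by
        have : h'.v .tl ≤ h'.v .hd := eval_lt_eq_zero.1 hge
        omega
      refine ⟨by simp; omega, hI.frame, hI.out, by omega, S, T, fun B e σ hB => ?_⟩
      -- With an empty queue the condition about its head is void, so every occurrence has been
      -- processed.
      obtain ⟨i, hi, rfl⟩ := Q.processed C hSc e B σ hB fun _ _ h1 _ => by omega
      exact Q.label i hi e σ hB

end

end SetMatch

namespace SetMatch
open Finset WordRAM

/-! ### The state of a character in the window of the text -/

section CharOk

variable {α : Type} [DecidableEq α]

/-- For the window `[s, c)`: `last` is the last occurrence of `σ`, `num` counts the occurrences, and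
`node` stands for the longest part of the shape of `σ` that is in the trie. -/
structure CharOk (P : Finset ℕ → Prop) (X : ℕ → Finset α) (nn : ℕ) (S : ℕ → Finset ℕ) (s c : ℕ)
    (σ : α) (num node last : ℕ) : Prop where
  last_lt : last < c
  last_mem : s ≤ last → σ ∈ X last
  last_max : ∀ i, s ≤ i → i < c → σ ∈ X i → i ≤ last
  num_eq : num = (shape X σ s last).card
  node_le : node ≤ nn
  low : Low (S node) (shape X σ s last)
  max : ∀ F, P F → Low F (shape X σ s last) → F ⊆ S node

variable {P : Finset ℕ → Prop} {X : ℕ → Finset α} {nn : ℕ} {S : ℕ → Finset ℕ} {s c : ℕ} {σ : α}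
  {num node last : ℕ} {st : ℕ} {ch depth fail : ℕ → ℕ}

theorem CharOk.drop_of_notMem (h : CharOk P X nn S s c σ num node last) (hσ : σ ∉ X s) :
    CharOk P X nn S (s + 1) c σ num node last := by
  have hsh := shape_succ_of_notMem (c := last) hσ
  exact ⟨h.last_lt, fun h' => h.last_mem (by omega), fun i h1 => h.last_max i (by omega),
    by rw [hsh, h.num_eq], h.node_le, by rw [hsh]; exact h.low, by rw [hsh]; exact h.max⟩

/-- The shape loses its largest element. If `node` stood for a proper part, this part is still
contained in the smaller shape. Otherwise its depth exceeds the new count, and the failure link is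
by definition the longest proper initial part in the trie. -/
theorem CharOk.drop (h : CharOk P X nn S s c σ num node last)
    (T : Trie P st nn S ch depth fail) (hσ : σ ∈ X s) (hs : s < c) :
    0 < num ∧ CharOk P X nn S (s + 1) c σ (num - 1)
      (if num - 1 < depth node then fail node else node) last := by
  have hsl := h.last_max s le_rfl hs hσ
  have hcard := card_shape_succ_of_mem hσ hsl
  have hnum := h.num_eq
  have hlow : Low (shape X σ (s + 1) last) (shape X σ s last) := low_shape_succ
  refine ⟨by omega, h.last_lt, fun h' => h.last_mem (by omega), fun i h1 => h.last_max i (by omega),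
    by omega, ?_, ?_, ?_⟩
  · split_ifs
    · exact T.fail_le h.node_le
    · exact h.node_le
  all_goals
    rw [T.depth _ h.node_le]
    split_ifs with hlt
  · have heq : S node = shape X σ s last := eq_of_subset_of_card_le h.low.1 (by omega)
    have hpos : 0 < node := by
      by_contra hcon
      obtain rfl : node = 0 := by omega
      rw [T.zero] at hlt; simp at hlt
    obtain ⟨-, f2, f3, -⟩ := T.fail _ h.node_le hpos
    have hfc := f2.card_lt f3
    have hf := heq ▸ f2
    refine hf.of_subset hlow (hf.subset_of_card_le hlow ?_)
    rw [heq] at hfc; omega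
  · exact h.low.of_subset hlow (h.low.subset_of_card_le hlow (by omega))
  · intro F hF hFl
    have heq : S node = shape X σ s last := eq_of_subset_of_card_le h.low.1 (by omega)
    have hpos : 0 < node := by
      by_contra hcon
      obtain rfl : node = 0 := by omega
      rw [T.zero] at hlt; simp at hlt
    obtain ⟨-, -, -, f4⟩ := T.fail _ h.node_le hpos
    refine f4 F hF (heq ▸ hFl.trans hlow) fun hFS => ?_
    have := card_le_card hFl.1
    rw [hFS, heq] at this
    omega
  · exact fun F hF hFl => h.max F hF (hFl.trans hlow)

/-- In a window that matches a prefix of the pattern the whole shape is in the trie, so its longest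
part in the trie is the shape itself. -/
theorem CharOk.exact {m : ℕ} (h : CharOk (InTrie X m) X nn S s c σ num node last)
    (hpm : PMatchAt X 0 s (c - s)) (hsc : s ≤ c) (hm : c - s ≤ m) :
    S node = shape X σ s last :=
  Subset.antisymm h.low.1 (h.max _ (hpm.inTrie hm h.last_mem (by have := h.last_lt; omega))
    (Low.refl _))

/-- This also covers characters absent from the window: then `last < s`, the old shape is empty, and
the distance to the outdated `last` has no influence on the child. -/
theorem CharOk.shape_eq {m : ℕ} (h : CharOk (InTrie X m) X nn S s c σ num node last)
    (hpm : PMatchAt X 0 s (c - s)) (hsc : s ≤ c) (hm : c - s ≤ m) (hσ : σ ∈ X c) :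
    shape X σ s c = child (S node) (c - last) := by
  rw [h.exact hpm hsc hm]
  exact shape_eq_child hσ hsc h.last_lt fun i h1 h2 h3 h4 => by
    have := h.last_max i h1 h3 h4; omega

theorem CharOk.extend_of_notMem (h : CharOk P X nn S s c σ num node last) (hσ : σ ∉ X c) :
    CharOk P X nn S s (c + 1) σ num node last :=
  ⟨by have := h.last_lt; omega, h.last_mem, fun i h1 h2 h3 => by
    rcases Nat.lt_succ_iff_lt_or_eq.1 h2 with h4 | rfl
    · exact h.last_max i h1 h4 h3
    · exact absurd h3 hσ, h.num_eq, h.node_le, h.low, h.max⟩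

theorem CharOk.extend {m : ℕ} (h : CharOk (InTrie X m) X nn S s c σ num node last)
    (hpm : PMatchAt X 0 s (c - s)) (hsc : s ≤ c) (hm : c - s ≤ m) (hσ : σ ∈ X c) {v : ℕ}
    (hv : v ≤ nn) (hvS : S v = shape X σ s c) :
    CharOk (InTrie X m) X nn S s (c + 1) σ (num + 1) v c := by
  refine ⟨by omega, fun _ => hσ, fun i _ h2 _ => by omega, ?_, hv, hvS ▸ Low.refl _,
    fun F _ hF => hvS ▸ hF.1⟩
  have := h.last_lt
  rw [h.shape_eq hpm hsc hm hσ, card_child (by omega), h.exact hpm hsc hm, h.num_eq]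

theorem CharOk.skip (h : CharOk P X nn S c c σ num node last) :
    CharOk P X nn S (c + 1) (c + 1) σ num node last := by
  have := h.last_lt
  have h1 : shape X σ (c + 1) last = shape X σ c last := by
    rw [shape_eq_empty (by omega), shape_eq_empty (by omega)]
  exact ⟨by omega, fun h' => by omega, fun i _ _ _ => by omega, by rw [h1, h.num_eq], h.node_le,
    by rw [h1]; exact h.low, by rw [h1]; exact h.max⟩

end CharOk

theorem coe_map_sets {q : ℕ} {xs : ℕ → List (Fin q)} (hn : ∀ i, (xs i).Nodup) (i : ℕ)
    {β : Type} (f : Fin q → β) : (sets xs i).val.map f = ((xs i).map f : Multiset β) := by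
  rw [List.toFinset_val, (hn i).dedup, Multiset.map_coe]

/-- If the nodes of the next characters agree with the labels, then they stand for the shapes. -/
theorem trans_of_perm {q m st nn : ℕ} {xs : ℕ → List (Fin q)}
    {S : ℕ → Finset ℕ} {ch depth fail : ℕ → ℕ}
    (T : Trie (InTrie (sets xs) m) st nn S ch depth fail) {s l : ℕ}
    (hpm : PMatchAt (sets xs) 0 s l) (hl : l < m) {num node last : Fin q → ℕ}
    (hok : ∀ σ, CharOk (InTrie (sets xs) m) (sets xs) nn S s (s + l) σ (num σ) (node σ) (last σ))
    (hst : s + l < st) {LP : List ℕ} (hLP : ∀ x ∈ LP, x ≤ nn)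
    (hLPS : LP.map S = (xs l).map fun σ => shape (sets xs) σ 0 l)
    (h : ((xs (s + l)).map fun σ => trans ch st (node σ) (s + l - last σ)).Perm LP)
    {σ : Fin q} (hσ : σ ∈ xs (s + l)) :
    trans ch st (node σ) (s + l - last σ) ≤ nn ∧
      S (trans ch st (node σ) (s + l - last σ)) = shape (sets xs) σ s (s + l) := by
  have h2 : trans ch st (node σ) (s + l - last σ) ∈ LP :=
    h.subset (List.mem_map.2 ⟨σ, hσ, rfl⟩)
  refine ⟨hLP _ h2, ?_⟩
  -- The number 0 of a missing transition is never a label: it stands for the empty shape, whereas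
  -- the shapes in the pattern contain 0.
  have h3 : trans ch st (node σ) (s + l - last σ) ≠ 0 := fun h0 => by
    have h4 : S (trans ch st (node σ) (s + l - last σ)) ∈ LP.map S := List.mem_map_of_mem h2
    rw [hLPS, List.mem_map, h0, T.zero] at h4
    obtain ⟨τ, hτ, h5⟩ := h4
    exact ne_empty_of_mem (zero_mem_shape (by simpa using hτ) (Nat.zero_le _)) h5
  have hlast := (hok σ).last_lt
  rw [(hok σ).shape_eq (by simpa using hpm) (by omega) (by omega) (by simpa using hσ)]
  exact (T.trans_mem (hok σ).node_le (by omega) (.inr (by omega)) h3).2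

/-- The windows can be extended if and only if the nodes of the next characters agree. -/
theorem perm_iff_pMatchAt_succ {q m st nn : ℕ} {xs : ℕ → List (Fin q)} (hn : ∀ i, (xs i).Nodup)
    {S : ℕ → Finset ℕ} {ch depth fail : ℕ → ℕ}
    (T : Trie (InTrie (sets xs) m) st nn S ch depth fail) {s l : ℕ}
    (hpm : PMatchAt (sets xs) 0 s l) (hl : l < m) {num node last : Fin q → ℕ}
    (hok : ∀ σ, CharOk (InTrie (sets xs) m) (sets xs) nn S s (s + l) σ (num σ) (node σ) (last σ))
    (hst : s + l < st) {LP : List ℕ} (hLP : ∀ x ∈ LP, x ≤ nn)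
    (hLPS : LP.map S = (xs l).map fun σ => shape (sets xs) σ 0 l) :
    ((xs (s + l)).map fun σ => trans ch st (node σ) (s + l - last σ)).Perm LP ↔
      PMatchAt (sets xs) 0 s (l + 1) := by
  have hsh : ∀ σ ∈ xs (s + l), shape (sets xs) σ s (s + l) = child (S (node σ)) (s + l - last σ) :=
    fun σ hσ => (hok σ).shape_eq (by simpa using hpm) (by omega) (by omega) (by simpa using hσ)
  have hgap : ∀ σ, 0 < s + l - last σ ∧ s + l - last σ < st := fun σ => by
    have := (hok σ).last_lt; omega
  rw [hpm.succ_iff, coe_map_sets hn, coe_map_sets hn, Multiset.coe_eq_coe]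
  simp only [zero_add]
  rw [← hLPS]
  constructor
  · intro h
    have h1 : ((xs (s + l)).map fun σ => trans ch st (node σ) (s + l - last σ)).map S =
        (xs (s + l)).map fun σ => shape (sets xs) σ s (s + l) := by
      rw [List.map_map]
      exact List.map_congr_left fun σ hσ =>
        (trans_of_perm T hpm hl hok hst hLP hLPS h hσ).2
    rw [← h1]
    exact (h.map S).symm
  -- Conversely, every shape of the next set is now the shape of some label. So its node exists, the
  -- transition leads there, and injectivity of `S` on the nodes turns the permutation of shapes
  -- into one of node numbers.
  · intro h
    have h1 : ∀ σ ∈ xs (s + l), trans ch st (node σ) (s + l - last σ) ≤ nn ∧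
        S (trans ch st (node σ) (s + l - last σ)) = shape (sets xs) σ s (s + l) := by
      intro σ hσ
      have h2 : shape (sets xs) σ s (s + l) ∈ LP.map S :=
        h.symm.subset (List.mem_map.2 ⟨σ, hσ, rfl⟩)
      obtain ⟨x, hx, hxS⟩ := List.mem_map.1 h2
      rw [T.trans_eq (hok σ).node_le (hgap σ).2 (.inr (hgap σ).1) (hLP x hx)
        (hxS.trans (hsh σ hσ))]
      exact ⟨hLP x hx, hxS⟩
    have h2 : (xs (s + l)).map (fun σ => shape (sets xs) σ s (s + l)) =
        ((xs (s + l)).map fun σ => trans ch st (node σ) (s + l - last σ)).map S := by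
      rw [List.map_map]
      exact List.map_congr_left fun σ hσ => (h1 σ hσ).2.symm
    rw [h2] at h
    have hinv : ∀ x ≤ nn, Function.invFunOn S {v | v ≤ nn} (S x) = x := fun x hx => by
      have h3 : ∃ a ∈ {v | v ≤ nn}, S a = S x := ⟨x, hx, rfl⟩
      exact T.inj _ (Function.invFunOn_mem h3) _ hx (Function.invFunOn_eq h3)
    have h4 : ∀ L : List ℕ, (∀ x ∈ L, x ≤ nn) →
        (L.map S).map (Function.invFunOn S {v | v ≤ nn}) = L := by
      intro L hL
      rw [List.map_map]
      conv_rhs => rw [← List.map_id L]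
      exact List.map_congr_left fun x hx => hinv x (hL x hx)
    have h5 := h.map (Function.invFunOn S {v | v ≤ nn})
    rw [h4 _ hLP, h4 _ (by
      intro x hx
      obtain ⟨σ, hσ, rfl⟩ := List.mem_map.1 hx
      exact (h1 σ hσ).1)] at h5
    exact h5.symm

end SetMatch

namespace SetMatch
open Finset WordRAM

/-! ### Comparing the next sets -/

/-- Count the labels of the set at `blk'`. -/
def countLabels : Cmd :=
  .set .j (.lit 0) ;;
  .loop (.var .j <ₑ Var.k)
    (.set .x (.get .label (.var .blk' +ₑ .lit 1 +ₑ Var.j)) ;;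
     .put .cnt Var.x (.get .cnt Var.x +ₑ .lit 1) ;;
     .set .j (.var .j +ₑ .lit 1))

/-- Compute the next node of the next character, and look for it among the labels. -/
def matchChar : Cmd :=
  .set .y (.inp (.var .blk +ₑ .lit 1 +ₑ Var.j)) ;;
  .set .node (.get .cur Var.y) ;;
  .set .gap (.var .c -ₑ .get .last Var.y) ;;
  .set .x (transExpr Var.node Var.gap) ;;
  .put .next Var.j Var.x ;;
  .ite (.get .cnt Var.x) (.put .cnt Var.x (.get .cnt Var.x -ₑ .lit 1)) (.set .bad (.lit 1)) ;;
  .set .j (.var .j +ₑ .lit 1)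

def matchLabels : Cmd :=
  .set .j (.lit 0) ;;
  .loop (.var .j <ₑ Var.k) matchChar

/-- Reset the counters. -/
def clearLabels : Cmd :=
  .set .j (.lit 0) ;;
  .loop (.var .j <ₑ Var.k)
    (.put .cnt (.get .label (.var .blk' +ₑ .lit 1 +ₑ Var.j)) (.lit 0) ;;
     .set .j (.var .j +ₑ .lit 1))

/-- Decide whether the match can be extended by the sets at the positions `c` and `l`. -/
def compare : Cmd :=
  .set .blk (.get .ptr Var.c) ;;
  .set .blk' (.get .ptr Var.l) ;;
  .set .k (.inp Var.blk) ;;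
  .ite (.var .k =ₑ .inp Var.blk')
    (.set .bad (.lit 0) ;; countLabels ;; matchLabels ;; clearLabels)
    (.set .bad (.lit 1))

theorem map_range_length {α β : Type} {L : List α} {g : ℕ → β} {F : α → β}
    (h : ∀ j (hj : j < L.length), g j = F L[j]) : (List.range L.length).map g = L.map F := by
  apply List.ext_getElem
  · simp
  · intro j h1 h2
    simpa using h j (by simpa using h2)

theorem count_map_range_succ (f : ℕ → ℕ) (k x : ℕ) :
    ((List.range (k + 1)).map f).count x =
      ((List.range k).map f).count x + if f k = x then 1 else 0 := by
  rw [List.range_succ, List.map_append, List.count_append]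
  simp [List.count_singleton]

theorem count_map_range_le {f : ℕ → ℕ} {j k : ℕ} (h : j ≤ k) (x : ℕ) :
    ((List.range j).map f).count x ≤ ((List.range k).map f).count x := by
  induction k, h using Nat.le_induction with
  | base => exact le_rfl
  | succ k _ ih => rw [count_map_range_succ]; omega

section

variable {M : Machine} {q m n : ℕ} {xs : ℕ → List (Fin q)} {pt : ℕ → ℕ}

/-- The invariant of `countLabels`. -/
structure CountInv (f : ℕ → ℕ) (k : ℕ) (h : Store) (b : ℕ) (h' : Store) (b' : ℕ) : Prop where
  j : h'.v .j ≤ k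
  cnt : ∀ x, h'.a .cnt x = ((List.range (h'.v .j)).map f).count x
  frame : Frame [.j, .x] [.cnt] h h'
  out : h'.out = h.out
  spent : b ≤ b' + 60 * h'.v .j + 3

theorem countLabels_spec (C : Layout M q m n xs pt) {h : Store} {b B k nn : ℕ} {f : ℕ → ℕ}
    (hk : h.v .k = k) (hB : h.v .blk' = B) (hBk : B + 1 + k ≤ M.len)
    (hf : ∀ j < k, h.a .label (B + 1 + j) = f j) (hfn : ∀ j < k, f j ≤ nn) (hnn : nn ≤ M.len + 1)
    (hcnt : ∀ x, h.a .cnt x = 0) (hb : 60 * k + 20 ≤ b) :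
    vc M countLabels (fun h' b' => b ≤ b' + 60 * k + 20 ∧ Frame [.j, .x] [.cnt] h h' ∧
      h'.out = h.out ∧ ∀ x, h'.a .cnt x = ((List.range k).map f).count x) h b := by
  have hw : M.w ≠ 0 := by have := M.one_lt; intro h0; simp [h0] at this
  have hcap := C.cap_bound
  have hpow := C.pow_bound
  unfold countLabels
  simp only [vc, Expr.ok, Expr.cost, Expr.eval]
  refine ⟨by omega, by omega, wp_loop (CountInv f k h b) ?_ ?_⟩
  · exact ⟨by simp, by simpa using hcnt, (Frame.refl _ _ _).set (by simp) _, rfl, by simp; omega⟩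
  · intro h' b' hI
    have hk' : h'.v .k = k := by rw [← hk]; exact hI.frame.v _ (by simp)
    have hB' : h'.v .blk' = B := by rw [← hB]; exact hI.frame.v _ (by simp)
    have hl' : h'.a .label = h.a .label := hI.frame.a _ (by simp)
    have hsp := hI.spent
    have hj := hI.j
    refine ⟨by simp, by simp; omega, ?_, ?_⟩
    · intro hlt
      have hlt : h'.v .j < k := by simpa [hk'] using hlt
      have h1 := hf _ hlt
      have h2 := hfn _ hlt
      have h3 := hI.cnt (f (h'.v .j))
      have h4 := List.count_le_length (a := f (h'.v .j)) (l := (List.range (h'.v .j)).map f)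
      simp only [List.length_map, List.length_range] at h4
      simp only [vc, Expr.ok, Expr.cost, Expr.eval, Op.val, Op.safe, Store.set_v_same,
        Store.set_v_of_ne, ne_eq, reduceCtorEq, not_false_eq_true, Store.set_a, Store.put_v, hl',
        hB', h1]
      constructorm* _ ∧ _
      all_goals try omega
      all_goals try trivial
      refine ⟨by simp; omega, ?_, ((hI.frame.set (by simp) _).put (by simp) _ _).set (by simp) _,
        hI.out, by simp; omega⟩
      intro x
      simp only [Store.set_v_same, Store.set_a, Store.put_a_same, Function.update_apply,
        count_map_range_succ]
      rcases eq_or_ne (f (h'.v .j)) x with rfl | hne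
      · simp [h3]
      · simp [hne, hne.symm, hI.cnt]
    · intro hge
      have hjk : h'.v .j = k := by
        have : ¬ h'.v .j < k := by simpa [hk'] using hge
        omega
      have hc := hI.cnt
      rw [hjk] at hsp hc
      exact ⟨by simp; omega, hI.frame, hI.out, hc⟩

/-- The invariant of `clearLabels`. -/
structure ClearInv (f : ℕ → ℕ) (k : ℕ) (h : Store) (b : ℕ) (h' : Store) (b' : ℕ) : Prop where
  j : h'.v .j ≤ k
  cnt : ∀ x, h'.a .cnt x ≠ 0 → ∃ j, h'.v .j ≤ j ∧ j < k ∧ f j = x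
  frame : Frame [.j] [.cnt] h h'
  out : h'.out = h.out
  spent : b ≤ b' + 40 * h'.v .j + 3

/-- Only counters of labels of this set can be nonzero, so the reset costs the size of the set and
not the number of nodes. -/
theorem clearLabels_spec (C : Layout M q m n xs pt) {h : Store} {b B k nn : ℕ} {f : ℕ → ℕ}
    (hk : h.v .k = k) (hB : h.v .blk' = B) (hBk : B + 1 + k ≤ M.len)
    (hf : ∀ j < k, h.a .label (B + 1 + j) = f j) (hfn : ∀ j < k, f j ≤ nn) (hnn : nn ≤ M.len + 1)
    (hcnt : ∀ x, h.a .cnt x ≠ 0 → ∃ j < k, f j = x) (hb : 40 * k + 20 ≤ b) :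
    vc M clearLabels (fun h' b' => b ≤ b' + 40 * k + 20 ∧ Frame [.j] [.cnt] h h' ∧
      h'.out = h.out ∧ ∀ x, h'.a .cnt x = 0) h b := by
  have hw : M.w ≠ 0 := by have := M.one_lt; intro h0; simp [h0] at this
  have hcap := C.cap_bound
  have hpow := C.pow_bound
  unfold clearLabels
  simp only [vc, Expr.ok, Expr.cost, Expr.eval]
  refine ⟨by omega, by omega, wp_loop (ClearInv f k h b) ?_ ?_⟩
  · exact ⟨by simp, by simpa using hcnt, (Frame.refl _ _ _).set (by simp) _, rfl, by simp; omega⟩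
  · intro h' b' hI
    have hk' : h'.v .k = k := by rw [← hk]; exact hI.frame.v _ (by simp)
    have hB' : h'.v .blk' = B := by rw [← hB]; exact hI.frame.v _ (by simp)
    have hl' : h'.a .label = h.a .label := hI.frame.a _ (by simp)
    have hsp := hI.spent
    have hj := hI.j
    refine ⟨by simp, by simp; omega, ?_, ?_⟩
    · intro hlt
      have hlt : h'.v .j < k := by simpa [hk'] using hlt
      have h1 := hf _ hlt
      have h2 := hfn _ hlt
      simp only [vc, Expr.ok, Expr.cost, Expr.eval, Op.val, Op.safe, Store.put_v, hl', hB', h1]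
      constructorm* _ ∧ _
      all_goals try omega
      all_goals try trivial
      refine ⟨by simp; omega, ?_, (hI.frame.put (by simp) _ _).set (by simp) _,
        hI.out, by simp; omega⟩
      intro x
      simp only [Store.set_v_same, Store.set_a, Store.put_a_same, Function.update_apply]
      split_ifs with hx
      · simp
      · intro hx0
        obtain ⟨j, g1, g2, g3⟩ := hI.cnt x hx0
        refine ⟨j, ?_, g2, g3⟩
        rcases g1.lt_or_eq with g4 | g4
        · exact g4
        · rw [g4] at hx; exact absurd g3.symm hx
    · intro hge
      have hjk : h'.v .j = k := by
        have : ¬ h'.v .j < k := by simpa [hk'] using hge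
        omega
      rw [hjk] at hsp
      refine ⟨by simp; omega, hI.frame, hI.out, fun x => ?_⟩
      by_contra hx
      obtain ⟨j, g1, g2, -⟩ := hI.cnt x hx
      omega

abbrev MatchFrame : Store → Store → Prop := Frame [.j, .y, .node, .gap, .x, .bad] [.next, .cnt]

/-- The invariant of `matchLabels`. -/
structure MatchInv (f g : ℕ → ℕ) (k : ℕ) (h : Store) (b : ℕ) (h' : Store) (b' : ℕ) : Prop where
  j : h'.v .j ≤ k
  le : ∀ x, h'.a .cnt x ≤ ((List.range k).map f).count x
  good : h'.v .bad = 0 → ∀ x, h'.a .cnt x + ((List.range (h'.v .j)).map g).count x =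
    ((List.range k).map f).count x
  bad : h'.v .bad ≠ 0 → ¬ ((List.range k).map g).Perm ((List.range k).map f)
  next : ∀ i < h'.v .j, h'.a .next i = g i
  frame : MatchFrame h h'
  out : h'.out = h.out
  spent : b ≤ b' + 130 * h'.v .j + 3

/-- Both lists have length `k`, so it suffices to test inclusion of multisets: no counter may be
exhausted. -/
theorem matchLabels_spec (C : Layout M q m n xs pt) {h : Store} {b c k nn : ℕ} {f g : ℕ → ℕ}
    {P : Finset ℕ → Prop} {S : ℕ → Finset ℕ} (T : StoreTrie P (m + n + 1) S h)
    (hst : h.v .stride = m + n + 1) (hnn : h.v .nodes = nn) (hnl : nn ≤ M.len + 1)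
    (hc : h.v .c = c) (hcL : c < m + n) (hk : h.v .k = k) (hkc : k = (xs c).length)
    (hblk : h.v .blk = pt c) (hbad : h.v .bad = 0)
    (hcur : ∀ σ : Fin q, h.a .cur (σ + 1) ≤ nn) (hlast : ∀ σ : Fin q, h.a .last (σ + 1) < c)
    (hg : ∀ j (hj : j < (xs c).length), g j =
      trans (h.a .child) (m + n + 1) (h.a .cur ((xs c)[j] + 1)) (c - h.a .last ((xs c)[j] + 1)))
    (hcnt : ∀ x, h.a .cnt x = ((List.range k).map f).count x) (hb : 130 * k + 20 ≤ b) :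
    vc M matchLabels (fun h' b' => b ≤ b' + 130 * k + 20 ∧ MatchFrame h h' ∧ h'.out = h.out ∧
      (∀ x, h'.a .cnt x ≤ ((List.range k).map f).count x) ∧ (∀ i < k, h'.a .next i = g i) ∧
      (h'.v .bad = 0 ↔ ((List.range k).map g).Perm ((List.range k).map f))) h b := by
  have hw : M.w ≠ 0 := by have := M.one_lt; intro h0; simp [h0] at this
  have hcap := C.cap_bound
  have hpow := C.pow_bound
  have hpt := C.pt_le c hcL
  unfold matchLabels
  simp only [vc, Expr.ok, Expr.cost, Expr.eval]
  refine ⟨by omega, by omega, wp_loop (MatchInv f g k h b) ?_ ?_⟩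
  · exact ⟨by simp, by simp [hcnt], by simp [hcnt], by simp [hbad], by simp,
      (Frame.refl _ _ _).set (by simp) _, rfl, by simp; omega⟩
  · intro h' b' hI
    have hk' : h'.v .k = k := by rw [← hk]; exact hI.frame.v _ (by simp)
    have hsp := hI.spent
    have hj := hI.j
    refine ⟨by simp, by simp; omega, ?_, ?_⟩
    · intro hlt
      have hlt : h'.v .j < k := by simpa [hk'] using hlt
      have hblk' : h'.v .blk = pt c := by rw [← hblk]; exact hI.frame.v _ (by simp)
      have hc' : h'.v .c = c := by rw [← hc]; exact hI.frame.v _ (by simp)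
      have hst' : h'.v .stride = m + n + 1 := by rw [← hst]; exact hI.frame.v _ (by simp)
      have hcur' : h'.a .cur = h.a .cur := hI.frame.a _ (by simp)
      have hlast' : h'.a .last = h.a .last := hI.frame.a _ (by simp)
      have hch' : h'.a .child = h.a .child := hI.frame.a _ (by simp)
      have hlt' : h'.v .j < (xs c).length := by omega
      have hchr := C.inp_chr c hcL _ hlt'
      have hgj := hg _ hlt'
      generalize hσ : (xs c)[h'.v .j] = σ at *
      have hσq := σ.2
      have h1 := hcur σ
      have h2 := hlast σ
      have T' : Trie P (m + n + 1) nn S (h.a .child) (h.a .depth) (h.a .fail) := hnn ▸ T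
      generalize hu : h.a .cur (σ + 1) = u at *
      generalize hla : h.a .last (σ + 1) = la at *
      have hch := T'.ch_le h1 (g := c - la) (by omega) (.inr (by omega))
      have hgn : g (h'.v .j) ≤ nn := by
        rw [hgj, trans]
        split_ifs with h0
        · have := T'.ch_zero (c - la) (by omega)
          have := T'.pos
          subst h0
          simp [*]; omega
        · simpa using hch
      generalize hh₁ : ((h'.set .y (σ + 1)).set .node u).set .gap (c - la) = h₁
      obtain ⟨hok, hev⟩ := transExpr_spec C (h := h₁) (u := .node) (g := .gap)
        (by simp [← hh₁, hst']) (by simp [← hh₁]; omega) (by simp [← hh₁]; omega)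
        (by simp [← hh₁, hch']; omega)
      have hcost : (transExpr Var.node Var.gap).cost = 20 := rfl
      have hev' : (transExpr Var.node Var.gap).eval M.inp h₁ = g (h'.v .j) := by
        rw [hev, hgj]; simp [← hh₁, hch']
      unfold matchChar
      simp only [vc, Expr.ok, Expr.cost, Expr.eval, Op.val, Op.safe, Store.set_v_same,
        Store.set_v_of_ne, ne_eq, reduceCtorEq, not_false_eq_true, Store.set_a, Store.put_v,
        hblk', hchr, hcur', hlast', hc', hu, hla, hh₁, hcost, hok, hev', Store.put_a_of_ne]
      have hv1 : ∀ x, x ≠ .y → x ≠ .node → x ≠ .gap → h₁.v x = h'.v x := by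
        intro x h1 h2 h3; simp [← hh₁, h1, h2, h3]
      have ha1 : h₁.a = h'.a := by simp [← hh₁]
      have ho1 : h₁.out = h'.out := by simp [← hh₁]
      have hF1 : MatchFrame h h₁ := hh₁ ▸ ((hI.frame.set (by simp) _).set (by simp) _).set
        (by simp) _
      have hj1 : h₁.v .j = h'.v .j := hv1 _ (by simp) (by simp) (by simp)
      have hle := hI.le (g (h'.v .j))
      have hgood := hI.good
      have hbad' := hI.bad
      have hb1 : h₁.v .bad = h'.v .bad := hv1 _ (by simp) (by simp) (by simp)
      simp only [hj1, ha1]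
      have hnext : ∀ i < h'.v .j + 1,
          Function.update (h'.a .next) (h'.v .j) (g (h'.v .j)) i = g i := by
        intro i hi
        rw [Function.update_apply]
        split_ifs with h0
        · rw [h0]
        · exact hI.next i (by omega)
      have hbig : ((List.range k).map f).count (g (h'.v .j)) ≤ k := by
        simpa using List.count_le_length (a := g (h'.v .j)) (l := (List.range k).map f)
      constructorm* _ ∧ _
      all_goals try omega
      all_goals try trivial
      · intro h0
        constructorm* _ ∧ _
        all_goals try omega
        all_goals try trivial
        refine ⟨by simp; omega, ?_, ?_, by simpa [hb1] using hbad', ?_, ?_, ?_, ?_⟩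
        · intro x
          simp only [Store.set_a, Store.put_a_same, Function.update_apply]
          split_ifs with hx
          · subst hx; omega
          · simpa [ha1] using hI.le x
        · intro hb0 x
          have hg0 := hgood (by simpa [hb1] using hb0) x
          simp only [Store.set_a, Store.set_v_same, Store.put_a_same, Function.update_apply,
            count_map_range_succ]
          split_ifs with hx hx' hx'
          · subst hx; omega
          · exact absurd hx.symm hx'
          · exact absurd hx'.symm hx
          · simpa [ha1] using hg0
        · simpa [ha1] using hnext
        · exact (((hF1.set (by simp) _).put (by simp) _ _).put (by simp) _ _).set (by simp) _
        · simpa [ho1] using hI.out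
        · simp; omega
      · intro h0
        constructorm* _ ∧ _
        all_goals try omega
        all_goals try trivial
        refine ⟨by simp; omega, ?_, by simp, ?_, ?_, ?_, ?_, ?_⟩
        · simpa [ha1] using hI.le
        -- The counter is exhausted, so the value occurs in the first `j + 1` terms of `g` more
        -- often than among all labels.
        · intro _ hp
          by_cases hb0 : h'.v .bad = 0
          · have e1 := hgood hb0 (g (h'.v .j))
            have e2 := hp.count_eq (g (h'.v .j))
            have e3 := count_map_range_le (f := g) (show h'.v .j + 1 ≤ k from hlt) (g (h'.v .j))
            rw [count_map_range_succ, if_pos rfl] at e3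
            omega
          · exact hbad' hb0 hp
        · simpa [ha1] using hnext
        · exact (((hF1.set (by simp) _).put (by simp) _ _).set (by simp) _).set (by simp) _
        · simpa [ho1] using hI.out
        · simp; omega
    · intro hge
      have hjk : h'.v .j = k := by
        have : ¬ h'.v .j < k := by simpa [hk'] using hge
        omega
      have hgood := hI.good
      have hnx := hI.next
      rw [hjk] at hsp hgood hnx
      refine ⟨by simp; omega, hI.frame, hI.out, hI.le, hnx, fun h0 => ?_, fun hp => ?_⟩
      · refine List.Subperm.perm_of_length_le (List.subperm_ext_iff.2 fun x _ => ?_) (by simp)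
        have := hgood h0 x
        omega
      · by_contra h0
        exact hI.bad h0 hp

end

end SetMatch

/-! ### Correctness of one comparison -/

namespace SetMatch
open Finset WordRAM

/-- What the search does not change. -/
abbrev SearchFrame : Store → Store → Prop :=
  Frame [.blk, .blk', .i, .j, .k, .x, .y, .node, .gap, .f, .s, .c, .l, .bad]
    [.cnt, .cur, .last, .num, .border, .next]

/-- The results of the preprocessing that the search relies on. -/
structure Prepared (M : Machine) {q : ℕ} (m n : ℕ) (xs : ℕ → List (Fin q)) (pt : ℕ → ℕ)
    (S : ℕ → Finset ℕ) (h : Store) : Prop where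
  m_eq : h.v .m = m
  len_eq : h.v .len = m + n
  stride : h.v .stride = m + n + 1
  ptr : ∀ i < m + n, h.a .ptr i = pt i
  nodes_le : h.v .nodes ≤ M.len + 1
  trie : StoreTrie (InTrie (sets xs) m) (m + n + 1) S h
  label : ∀ B e σ, Ev m xs pt B e σ → h.a .label B ≤ h.v .nodes ∧
    S (h.a .label B) = shape (sets xs) σ 0 e

theorem Prepared.frame {M : Machine} {q m n : ℕ} {xs : ℕ → List (Fin q)} {pt : ℕ → ℕ}
    {S : ℕ → Finset ℕ} {h h' : Store} (hP : Prepared M m n xs pt S h) (hF : SearchFrame h h') :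
    Prepared M m n xs pt S h' := by
  have e1 : h'.v .nodes = h.v .nodes := hF.v _ (by simp)
  have e2 : h'.a .child = h.a .child := hF.a _ (by simp)
  have e3 : h'.a .depth = h.a .depth := hF.a _ (by simp)
  have e4 : h'.a .fail = h.a .fail := hF.a _ (by simp)
  have e5 : h'.a .label = h.a .label := hF.a _ (by simp)
  have e6 : h'.a .ptr = h.a .ptr := hF.a _ (by simp)
  refine ⟨(hF.v _ (by simp)).trans hP.m_eq, (hF.v _ (by simp)).trans hP.len_eq,
    (hF.v _ (by simp)).trans hP.stride, e6 ▸ hP.ptr, e1 ▸ hP.nodes_le, ?_, ?_⟩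
  · have := hP.trie
    simpa only [StoreTrie, e1, e2, e3, e4] using this
  · rw [e1, e5]; exact hP.label

/-- The arrays describe the characters of the window `[s, c)`. -/
def WindowOk {q : ℕ} (m : ℕ) (xs : ℕ → List (Fin q)) (S : ℕ → Finset ℕ) (s c : ℕ) (h : Store) :
    Prop :=
  ∀ σ : Fin q, CharOk (InTrie (sets xs) m) (sets xs) (h.v .nodes) S s c σ (h.a .num (σ + 1))
    (h.a .cur (σ + 1)) (h.a .last (σ + 1))

theorem WindowOk.congr {q m : ℕ} {xs : ℕ → List (Fin q)} {S : ℕ → Finset ℕ} {s c : ℕ}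
    {h h' : Store} (hW : WindowOk m xs S s c h) (hv : h'.v .nodes = h.v .nodes)
    (h1 : h'.a .num = h.a .num) (h2 : h'.a .cur = h.a .cur) (h3 : h'.a .last = h.a .last) :
    WindowOk m xs S s c h' := by
  unfold WindowOk
  rw [hv, h1, h2, h3]
  exact hW

/-- The common size of two sets, and `0` if their sizes differ. -/
def common {q : ℕ} (xs : ℕ → List (Fin q)) (l c : ℕ) : ℕ :=
  if (xs c).length = (xs l).length then (xs c).length else 0

abbrev CompareFrame : Store → Store → Prop :=
  Frame [.blk, .blk', .k, .j, .y, .node, .gap, .x, .bad] [.next, .cnt]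

/-- The state after the comparison of the sets at the positions `c` and `l`. -/
structure Compared {q : ℕ} (xs : ℕ → List (Fin q)) (pt : ℕ → ℕ) (S : ℕ → Finset ℕ)
    (s c l : ℕ) (h : Store) (b : ℕ) (h' : Store) (b' : ℕ) : Prop where
  frame : CompareFrame h h'
  out : h'.out = h.out
  spent : b ≤ b' + 230 * common xs l c + 150
  cnt : ∀ x, h'.a .cnt x = 0
  blk : h'.v .blk = pt c
  k : h'.v .k = (xs c).length
  bad_iff : h'.v .bad = 0 ↔ PMatchAt (sets xs) 0 s (l + 1)
  next : h'.v .bad = 0 → ∀ j (hj : j < (xs c).length), h'.a .next j ≤ h.v .nodes ∧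
    S (h'.a .next j) = shape (sets xs) (xs c)[j] s c

section

variable {M : Machine} {q m n : ℕ} {xs : ℕ → List (Fin q)} {pt : ℕ → ℕ}

theorem card_sets (C : Layout M q m n xs pt) (i : ℕ) : (sets xs i).card = (xs i).length :=
  List.toFinset_card_of_nodup (C.nodup i)

/-- Sets of different sizes are rejected before any character is read. Hence the cost is governed by
`common`, which is bounded by the size of either set; the amortization uses both bounds. -/
theorem compare_spec (C : Layout M q m n xs pt) {S : ℕ → Finset ℕ} {h : Store} {b s c l : ℕ}
    (hP : Prepared M m n xs pt S h) (hW : WindowOk m xs S s c h) (hcnt : ∀ x, h.a .cnt x = 0)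
    (hpm : PMatchAt (sets xs) 0 s l) (hsc : c = s + l) (hl : l < m) (hc : c < m + n)
    (hvc : h.v .c = c) (hvl : h.v .l = l) (hb : 230 * common xs l c + 150 ≤ b) :
    vc M compare (Compared xs pt S s c l h b) h b := by
  have hw : M.w ≠ 0 := by have := M.one_lt; intro h0; simp [h0] at this
  have hcap := C.cap_bound
  have hpow := C.pow_bound
  have hge := C.len_ge
  have hptc := C.pt_le c hc
  have hptl := C.pt_le l (by omega)
  have hic := C.inp_pt c hc
  have hil := C.inp_pt l (by omega)
  have hrc := hP.ptr c hc
  have hrl := hP.ptr l (by omega)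
  unfold compare
  simp only [vc, Expr.ok, Expr.cost, Expr.eval, Op.val, Op.safe, Store.set_v_same,
    Store.set_v_of_ne, ne_eq, reduceCtorEq, not_false_eq_true, Store.set_a, hvc, hvl, hrc, hrl,
    hic, hil]
  generalize hh₁ : ((h.set .blk (pt c)).set .blk' (pt l)).set .k (xs c).length = h₁
  have hF₁ : CompareFrame h h₁ := hh₁ ▸ (((Frame.refl _ _ _).set (by simp) _).set (by simp) _).set
    (by simp) _
  constructorm* _ ∧ _
  all_goals try omega
  all_goals try trivial
  · intro h0
    have heq : (xs c).length = (xs l).length := by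
      by_contra hne; simp [hne] at h0
    simp only [common, heq, if_true] at hb ⊢
    generalize hk : (xs l).length = k at *
    refine ⟨by omega, by omega, ?_⟩
    generalize hh₂ : h₁.set .bad 0 = h₂
    have hF₂ : CompareFrame h h₂ := hh₂ ▸ hF₁.set (by simp) _
    have hA₂ : h₂.a = h.a := by simp [← hh₂, ← hh₁]
    have hk₂ : h₂.v .k = k := by simp [← hh₂, ← hh₁, heq]
    have hblk₂ : h₂.v .blk = pt c := by simp [← hh₂, ← hh₁]
    have hblk₂' : h₂.v .blk' = pt l := by simp [← hh₂, ← hh₁]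
    have hbad₂ : h₂.v .bad = 0 := by simp [← hh₂]
    have hc₂ : h₂.v .c = c := by rw [← hvc]; exact hF₂.v _ (by simp)
    set f : ℕ → ℕ := fun j => h.a .label (pt l + 1 + j) with hf
    set g : ℕ → ℕ := fun j => if hj : j < (xs c).length then trans (h.a .child) (m + n + 1)
      (h.a .cur ((xs c)[j] + 1)) (c - h.a .last ((xs c)[j] + 1)) else 0 with hg
    have hEv : ∀ j (hj : j < (xs l).length), Ev m xs pt (pt l + 1 + j) l (xs l)[j] :=
      fun j hj => ⟨hl, j, List.getElem?_eq_getElem hj, rfl⟩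
    have hfn : ∀ j < k, f j ≤ h.v .nodes := fun j hj => (hP.label _ _ _ (hEv j (by omega))).1
    have hout₂ : h₂.out = h.out := by simp [← hh₂, ← hh₁]
    have hnl := hP.nodes_le
    refine vc_mono (countLabels_spec C (f := f) (nn := h.v .nodes) hk₂ hblk₂' (by omega)
      (fun j _ => by rw [hA₂]) hfn (by omega) (by rw [hA₂]; exact hcnt) (by omega)) ?_
    rintro h₃ b₃ ⟨hb₃, hF₃, ho₃, hc₃⟩
    have hFF₃ : CompareFrame h h₃ := hF₂.trans (hF₃.mono (by simp) (by simp))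
    have hv₃ : ∀ x, x ≠ .j → x ≠ .x → h₃.v x = h₂.v x := fun x e1 e2 => hF₃.v x (by simp [e1, e2])
    refine vc_mono (matchLabels_spec C (f := f) (g := g) (nn := h.v .nodes)
      (P := InTrie (sets xs) m) (S := S) (c := c) (k := k) ?_ ?_ ?_ hnl ?_ hc ?_ heq.symm ?_ ?_ ?_ ?_
      ?_ hc₃ (by omega)) ?_
    · exact (hP.frame (hFF₃.mono (by simp) (by simp))).trie
    · exact (hP.frame (hFF₃.mono (by simp) (by simp))).stride
    · exact hFF₃.v _ (by simp)
    · rw [hv₃ _ (by simp) (by simp), hc₂]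
    · rw [hv₃ _ (by simp) (by simp), hk₂]
    · rw [hv₃ _ (by simp) (by simp), hblk₂]
    · rw [hv₃ _ (by simp) (by simp), hbad₂]
    · intro σ
      rw [hFF₃.a .cur (by simp)]
      exact (hW σ).node_le
    · intro σ
      rw [hFF₃.a .last (by simp)]
      exact (hW σ).last_lt
    · intro j hj
      simp only [hg, dif_pos hj]
      rw [hFF₃.a .cur (by simp), hFF₃.a .last (by simp), hFF₃.a .child (by simp)]
    rintro h₄ b₄ ⟨hb₄, hF₄, ho₄, hc₄, hn₄, hbad₄⟩
    have hFF₄ : CompareFrame h h₄ := hFF₃.trans (hF₄.mono (by simp) (by simp))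
    have hv₄ : ∀ x, x ≠ .j → x ≠ .y → x ≠ .node → x ≠ .gap → x ≠ .x → x ≠ .bad →
        h₄.v x = h₂.v x := fun x e1 e2 e3 e4 e5 e6 => by
      rw [hF₄.v x (by simp [e1, e2, e3, e4, e5, e6]), hv₃ x e1 e5]
    refine vc_mono (clearLabels_spec C (f := f) (nn := h.v .nodes) (k := k) (B := pt l)
      ?_ ?_ (by omega) (fun j _ => by rw [hFF₄.a .label (by simp)]) hfn (by omega) ?_ (by omega)) ?_
    · rw [hv₄ _ (by simp) (by simp) (by simp) (by simp) (by simp) (by simp), hk₂]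
    · rw [hv₄ _ (by simp) (by simp) (by simp) (by simp) (by simp) (by simp), hblk₂']
    · intro x hx
      have h1 := hc₄ x
      have h2 : x ∈ (List.range k).map f := List.count_pos_iff.1 (by omega)
      simpa using h2
    rintro h₅ b₅ ⟨hb₅, hF₅, ho₅, hc₅⟩
    have hv₅ : ∀ x, x ≠ .j → h₅.v x = h₄.v x := fun x e1 => hF₅.v x (by simp [e1])
    have hcomm : common xs l c = k := by rw [common, if_pos (by omega), heq]
    have hLV : (List.range k).map g = (xs c).map fun σ : Fin q => trans (h.a .child) (m + n + 1)
        (h.a .cur (σ + 1)) (s + l - h.a .last (σ + 1)) := by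
      rw [← heq]
      refine map_range_length fun j hj => ?_
      simp only [hg, dif_pos hj, ← hsc]
    have hLP : ((List.range k).map f).map S = (xs l).map fun σ => shape (sets xs) σ 0 l := by
      rw [List.map_map, ← hk]
      exact map_range_length fun j hj => (hP.label _ _ _ (hEv j hj)).2
    have hLPn : ∀ x ∈ (List.range k).map f, x ≤ h.v .nodes := by
      intro x hx
      obtain ⟨j, hj, rfl⟩ := List.mem_map.1 hx
      exact hfn j (List.mem_range.1 hj)
    have hbad₅ : h₅.v .bad = 0 ↔ ((xs (s + l)).map fun σ : Fin q => trans (h.a .child) (m + n + 1)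
        (h.a .cur (σ + 1)) (s + l - h.a .last (σ + 1))).Perm ((List.range k).map f) := by
      rw [hv₅ _ (by simp), hbad₄, hLV, hsc]
    refine ⟨hFF₄.trans (hF₅.mono (by simp) (by simp)), ?_, by rw [hcomm]; omega, hc₅, ?_, ?_, ?_, ?_⟩
    · rw [ho₅, ho₄, ho₃, hout₂]
    · rw [hv₅ _ (by simp), hv₄ _ (by simp) (by simp) (by simp) (by simp) (by simp) (by simp), hblk₂]
    · rw [hv₅ _ (by simp), hv₄ _ (by simp) (by simp) (by simp) (by simp) (by simp) (by simp), hk₂,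
        heq]
    · rw [hbad₅]
      exact perm_iff_pMatchAt_succ C.nodup hP.trie hpm hl (hsc ▸ hW) (by omega) hLPn hLP
    · intro h0 j hj
      have := trans_of_perm hP.trie hpm hl (hsc ▸ hW) (by omega) hLPn hLP (hbad₅.1 h0)
        (σ := (xs c)[j]) (by rw [← hsc]; exact List.getElem_mem hj)
      rw [hF₅.a .next (by simp), hn₄ j (by omega)]
      simp only [hg, dif_pos hj]
      rw [← hsc] at this
      exact this
  · intro h0
    have hne : (xs c).length ≠ (xs l).length := by
      intro heq; simp [heq] at h0
    refine ⟨by omega, by omega, hF₁.set (by simp) _, by simp [← hh₁], by omega, ?_,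
      by simp [← hh₁], by simp [← hh₁], ?_, by simp⟩
    · simpa [← hh₁] using hcnt
    · simp only [Store.set_v_same, one_ne_zero, false_iff]
      intro hpm'
      apply hne
      rw [← card_sets C, ← card_sets C]
      have := hpm'.card_eq (i := l) (by omega)
      rw [zero_add] at this
      rw [hsc, this]

end

end SetMatch

namespace SetMatch
open Finset WordRAM

/-! ### Moving the window -/

/-- Record the match of the next character. -/
def commitChar : Cmd :=
  .set .y (.inp (.var .blk +ₑ .lit 1 +ₑ Var.j)) ;;
  .put .cur Var.y (.get .next Var.j) ;;
  .put .last Var.y Var.c ;;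
  .put .num Var.y (.get .num Var.y +ₑ .lit 1) ;;
  .set .j (.var .j +ₑ .lit 1)

/-- Add the next set to the window. -/
def commit : Cmd :=
  .set .j (.lit 0) ;;
  .loop (.var .j <ₑ Var.k) commitChar

/-- Remove an occurrence of a character from the window. -/
def dropChar : Cmd :=
  .set .y (.inp (.var .blk +ₑ .lit 1 +ₑ Var.j)) ;;
  .put .num Var.y (.get .num Var.y -ₑ .lit 1) ;;
  .set .node (.get .cur Var.y) ;;
  .ite (.get .num Var.y <ₑ .get .depth Var.node) (.put .cur Var.y (.get .fail Var.node)) .skip ;;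
  .set .j (.var .j +ₑ .lit 1)

/-- Remove the first set from the window. -/
def dropSet : Cmd :=
  .set .blk (.get .ptr Var.s) ;;
  .set .k (.inp Var.blk) ;;
  .set .j (.lit 0) ;;
  .loop (.var .j <ₑ Var.k) dropChar ;;
  .set .s (.var .s +ₑ .lit 1)

/-- Move the window to the next candidate. -/
def shift : Cmd :=
  .set .f (.get .border Var.l) ;;
  .set .i (.var .s +ₑ (.var .l -ₑ Var.f)) ;;
  .loop (.var .s <ₑ Var.i) dropSet ;;
  .set .l Var.f

section

variable {M : Machine} {q m n : ℕ} {xs : ℕ → List (Fin q)} {pt : ℕ → ℕ}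

theorem mem_take_succ {α : Type} {L : List α} {j : ℕ} (hj : j < L.length) {a : α} :
    a ∈ L.take (j + 1) ↔ a ∈ L.take j ∨ a = L[j] := by
  rw [List.take_succ_eq_append_getElem hj, List.mem_append, List.mem_singleton]

theorem notMem_take {α : Type} {L : List α} (hL : L.Nodup) {j : ℕ} (hj : j < L.length) :
    L[j] ∉ L.take j := by
  intro h
  obtain ⟨i, hi, h1⟩ := List.mem_take_iff_getElem.1 h
  have := hL.getElem_inj_iff.1 h1
  omega

abbrev CommitFrame : Store → Store → Prop := Frame [.j, .y] [.cur, .last, .num]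

/-- The invariant of `commit`. -/
structure CommitInv {q : ℕ} (m : ℕ) (xs : ℕ → List (Fin q)) (S : ℕ → Finset ℕ) (s c : ℕ)
    (h : Store) (b : ℕ) (h' : Store) (b' : ℕ) : Prop where
  j : h'.v .j ≤ (xs c).length
  done : ∀ σ ∈ (xs c).take (h'.v .j), CharOk (InTrie (sets xs) m) (sets xs) (h.v .nodes) S s (c + 1)
    σ (h'.a .num (σ + 1)) (h'.a .cur (σ + 1)) (h'.a .last (σ + 1))
  todo : ∀ σ ∉ (xs c).take (h'.v .j), CharOk (InTrie (sets xs) m) (sets xs) (h.v .nodes) S s c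
    σ (h'.a .num (σ + 1)) (h'.a .cur (σ + 1)) (h'.a .last (σ + 1))
  frame : CommitFrame h h'
  out : h'.out = h.out
  spent : b ≤ b' + 80 * h'.v .j + 3

theorem card_shape_le {α : Type} [DecidableEq α] {X : ℕ → Finset α} {σ : α} {s c : ℕ} :
    (shape X σ s c).card ≤ c + 1 := by
  refine (card_le_card (t := range (c + 1)) fun x hx => ?_).trans (by simp)
  have := mem_shape.1 hx
  simp; omega

/-- The invariant separates the characters already updated from the rest. For a character outside
the set at `c`, only the end of the window moves. -/
theorem commit_spec (C : Layout M q m n xs pt) {S : ℕ → Finset ℕ} {h : Store} {b s c : ℕ}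
    (hW : WindowOk m xs S s c h) (hsc : s ≤ c) (hcm : c - s ≤ m) (hc : c < m + n)
    (hpm : PMatchAt (sets xs) 0 s (c - s))
    (hvc : h.v .c = c) (hblk : h.v .blk = pt c) (hk : h.v .k = (xs c).length)
    (hnext : ∀ j (hj : j < (xs c).length), h.a .next j ≤ h.v .nodes ∧
      S (h.a .next j) = shape (sets xs) (xs c)[j] s c) (hb : 80 * (xs c).length + 20 ≤ b) :
    vc M commit (fun h' b' => b ≤ b' + 80 * (xs c).length + 20 ∧ CommitFrame h h' ∧
      h'.out = h.out ∧ WindowOk m xs S s (c + 1) h') h b := by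
  have hw : M.w ≠ 0 := by have := M.one_lt; intro h0; simp [h0] at this
  have hcap := C.cap_bound
  have hpow := C.pow_bound
  have hge := C.len_ge
  have hpt := C.pt_le c hc
  unfold commit
  simp only [vc, Expr.ok, Expr.cost, Expr.eval]
  refine ⟨by omega, by omega, wp_loop (CommitInv m xs S s c h b) ?_ ?_⟩
  · exact ⟨by simp, by simp, fun σ _ => by simpa using hW σ, (Frame.refl _ _ _).set (by simp) _, rfl,
      by simp; omega⟩
  · intro h' b' hI
    have hk' : h'.v .k = (xs c).length := by rw [← hk]; exact hI.frame.v _ (by simp)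
    have hsp := hI.spent
    have hj := hI.j
    have hn' : h'.v .nodes = h.v .nodes := hI.frame.v _ (by simp)
    refine ⟨by simp, by simp; omega, ?_, ?_⟩
    · intro hlt
      have hlt : h'.v .j < (xs c).length := by simpa [hk'] using hlt
      have hblk' : h'.v .blk = pt c := by rw [← hblk]; exact hI.frame.v _ (by simp)
      have hc' : h'.v .c = c := by rw [← hvc]; exact hI.frame.v _ (by simp)
      have hnx' : h'.a .next = h.a .next := hI.frame.a _ (by simp)
      have hchr := C.inp_chr c hc _ hlt
      obtain ⟨hx1, hx2⟩ := hnext _ hlt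
      have hmem : (xs c)[h'.v .j] ∈ xs c := List.getElem_mem hlt
      have hnot := notMem_take (C.nodup c) hlt
      have htk := fun τ : Fin q => mem_take_succ hlt (a := τ)
      have hdone := hI.done
      have htodo := hI.todo
      generalize (xs c)[h'.v .j] = σ at *
      have hσq := σ.2
      have hok := htodo σ hnot
      have hnum := hok.num_eq
      have hlast := hok.last_lt
      have hcs := card_shape_le (X := sets xs) (σ := σ) (s := s) (c := h'.a .last (σ + 1))
      unfold commitChar
      simp only [vc, Expr.ok, Expr.cost, Expr.eval, Op.val, Op.safe, Store.set_v_same,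
        Store.set_v_of_ne, ne_eq, reduceCtorEq, not_false_eq_true, Store.set_a, Store.put_v,
        hblk', hchr, hc', hnx', Store.put_a_of_ne]
      constructorm* _ ∧ _
      all_goals try omega
      all_goals try trivial
      have hnew := hok.extend hpm hsc hcm (by simpa using hmem) hx1 hx2
      refine ⟨by simp; omega, ?_, ?_, ?_, hI.out, by simp; omega⟩
      · intro τ hτ
        simp only [Store.set_v_same, htk] at hτ
        by_cases hτσ : τ = σ
        · subst hτσ
          simpa using hnew
        · have hne : (τ : ℕ) ≠ σ := fun e => hτσ (Fin.ext e)
          simpa [Function.update_apply, hne] using hdone τ (hτ.resolve_right hτσ)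
      · intro τ hτ
        simp only [Store.set_v_same, htk, not_or] at hτ
        have hne : (τ : ℕ) ≠ σ := fun e => hτ.2 (Fin.ext e)
        simpa [Function.update_apply, hne] using htodo τ hτ.1
      · exact ((((hI.frame.set (by simp) _).put (by simp) _ _).put (by simp) _ _).put
          (by simp) _ _).set (by simp) _
    · intro hge'
      have hjk : h'.v .j = (xs c).length := by
        have : ¬ h'.v .j < (xs c).length := by simpa [hk'] using hge'
        omega
      refine ⟨by simp; omega, hI.frame, hI.out, fun σ => ?_⟩
      rw [hn']
      by_cases hσ : σ ∈ xs c
      · exact hI.done σ (by rwa [hjk, List.take_length])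
      · exact (hI.todo σ (by rwa [hjk, List.take_length])).extend_of_notMem (by simpa using hσ)

abbrev DropFrame : Store → Store → Prop := Frame [.j, .y, .node] [.cur, .num]

/-- The invariant of the loop of `dropSet`. -/
structure DropInv {q : ℕ} (m : ℕ) (xs : ℕ → List (Fin q)) (S : ℕ → Finset ℕ) (s c : ℕ)
    (h : Store) (b : ℕ) (h' : Store) (b' : ℕ) : Prop where
  j : h'.v .j ≤ (xs s).length
  done : ∀ σ ∈ (xs s).take (h'.v .j), CharOk (InTrie (sets xs) m) (sets xs) (h.v .nodes) S (s + 1) c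
    σ (h'.a .num (σ + 1)) (h'.a .cur (σ + 1)) (h'.a .last (σ + 1))
  todo : ∀ σ ∉ (xs s).take (h'.v .j), CharOk (InTrie (sets xs) m) (sets xs) (h.v .nodes) S s c
    σ (h'.a .num (σ + 1)) (h'.a .cur (σ + 1)) (h'.a .last (σ + 1))
  frame : DropFrame h h'
  out : h'.out = h.out
  spent : b ≤ b' + 100 * h'.v .j

theorem dropSet_spec (C : Layout M q m n xs pt) {S : ℕ → Finset ℕ} {h : Store} {b s c : ℕ}
    (hP : Prepared M m n xs pt S h) (hW : WindowOk m xs S s c h) (hsc : s < c) (hc : c ≤ m + n)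
    (hvs : h.v .s = s) (hb : 100 * (xs s).length + 50 ≤ b) :
    vc M dropSet (fun h' b' => b ≤ b' + 100 * (xs s).length + 50 ∧
      Frame [.blk, .k, .j, .y, .node, .s] [.cur, .num] h h' ∧
      h'.out = h.out ∧ h'.v .s = s + 1 ∧ WindowOk m xs S (s + 1) c h') h b := by
  have hw : M.w ≠ 0 := by have := M.one_lt; intro h0; simp [h0] at this
  have hcap := C.cap_bound
  have hpow := C.pow_bound
  have hge := C.len_ge
  have hpt := C.pt_le s (by omega)
  have hi := C.inp_pt s (by omega)
  have hr := hP.ptr s (by omega)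
  have hnl := hP.nodes_le
  unfold dropSet
  simp only [vc, Expr.ok, Expr.cost, Expr.eval, Op.val, Op.safe, Store.set_v_same, hvs, hr, hi]
  generalize hh₁ : ((h.set .blk (pt s)).set .k (xs s).length).set .j 0 = h₁
  have hF₁ : Frame [.blk, .k, .j, .y, .node, .s] [.cur, .num] h h₁ :=
    hh₁ ▸ (((Frame.refl _ _ _).set (by simp) _).set (by simp) _).set (by simp) _
  have ho₁ : h₁.out = h.out := by simp [← hh₁]
  have hk₁ : h₁.v .k = (xs s).length := by simp [← hh₁]
  have hblk₁ : h₁.v .blk = pt s := by simp [← hh₁]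
  have hj₁ : h₁.v .j = 0 := by simp [← hh₁]
  have hn₁ : h₁.v .nodes = h.v .nodes := hF₁.v _ (by simp)
  have hW₁ : WindowOk m xs S s c h₁ := hW.congr hn₁ (by simp [← hh₁]) (by simp [← hh₁])
    (by simp [← hh₁])
  have hP₁ := hP.frame (hF₁.mono (by simp) (by simp))
  have T := hP.trie
  constructorm* _ ∧ _
  all_goals try omega
  all_goals try trivial
  refine wp_loop (DropInv m xs S s c h₁ (b - 30)) ?_ ?_
  · exact ⟨by simp [hj₁], by simp [hj₁], fun σ _ => hW₁ σ, Frame.refl _ _ _, rfl, by omega⟩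
  · intro h' b' hI
    have hk' : h'.v .k = (xs s).length := by rw [← hk₁]; exact hI.frame.v _ (by simp)
    have hsp := hI.spent
    have hj := hI.j
    have hn' : h'.v .nodes = h.v .nodes := (hI.frame.v _ (by simp)).trans hn₁
    have hblk' : h'.v .blk = pt s := by rw [← hblk₁]; exact hI.frame.v _ (by simp)
    refine ⟨by simp, by simp; omega, ?_, ?_⟩
    · intro hlt
      have hlt : h'.v .j < (xs s).length := by simpa [hk'] using hlt
      have hde' : h'.a .depth = h.a .depth :=
        (hI.frame.a _ (by simp)).trans (hF₁.a _ (by simp))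
      have hfa' : h'.a .fail = h.a .fail :=
        (hI.frame.a _ (by simp)).trans (hF₁.a _ (by simp))
      have hchr := C.inp_chr s (by omega) _ hlt
      have hmem : (xs s)[h'.v .j] ∈ xs s := List.getElem_mem hlt
      have hnot := notMem_take (C.nodup s) hlt
      have htk := fun τ : Fin q => mem_take_succ hlt (a := τ)
      have hdone := hI.done
      have htodo := hI.todo
      generalize (xs s)[h'.v .j] = σ at *
      have hσq := σ.2
      have hok := htodo σ hnot
      rw [hn₁] at hok
      obtain ⟨hpos, hnew⟩ := hok.drop T (by simpa using hmem) hsc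
      have hnode := hok.node_le
      generalize hu : h'.a .cur (σ + 1) = u at *
      unfold dropChar
      simp only [vc, Expr.ok, Expr.cost, Expr.eval, Op.val, Op.safe, Store.set_v_same,
        Store.set_v_of_ne, ne_eq, reduceCtorEq, not_false_eq_true, Store.set_a, Store.put_v,
        hblk', hchr, hde', hfa', Store.put_a_of_ne, Store.put_a_same, hu, Function.update_self]
      -- Both branches of the test end in such a store: apart from temporary values, only the
      -- entries of `σ` in `num` and `cur` have changed.
      have hkey : ∀ (g : Store) (b₀ : ℕ), g.v .j = h'.v .j + 1 → DropFrame h₁ g →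
          g.out = h'.out → (∀ x, x ≠ (σ : ℕ) + 1 → g.a .num x = h'.a .num x ∧
            g.a .cur x = h'.a .cur x) → g.a .last = h'.a .last →
          g.a .num (σ + 1) = h'.a .num (σ + 1) - 1 →
          g.a .cur (σ + 1) = (if h'.a .num (σ + 1) - 1 < h.a .depth u then h.a .fail u else u) →
          b' ≤ b₀ + 100 → DropInv m xs S s c h₁ (b - 30) g b₀ := by
        intro g b₀ e1 e2 e3 e4 e5 e6 e7 e8
        refine ⟨by omega, ?_, ?_, e2, e3.trans hI.out, by omega⟩
        · intro τ hτ
          rw [e1, htk] at hτ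
          by_cases hτσ : τ = σ
          · subst hτσ
            rw [e5, e6, e7, hn₁]
            exact hnew
          · have hne : (τ : ℕ) + 1 ≠ σ + 1 := fun e => hτσ (Fin.ext (by omega))
            rw [(e4 _ hne).1, (e4 _ hne).2, e5]
            exact hdone τ (hτ.resolve_right hτσ)
        · intro τ hτ
          rw [e1, htk, not_or] at hτ
          have hne : (τ : ℕ) + 1 ≠ σ + 1 := fun e => hτ.2 (Fin.ext (by omega))
          rw [(e4 _ hne).1, (e4 _ hne).2, e5]
          exact htodo τ hτ.1
      constructorm* _ ∧ _
      all_goals try omega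
      all_goals try trivial
      · intro h0
        have h0 : h'.a .num (σ + 1) - 1 < h.a .depth u := by
          by_contra hcon; simp [hcon] at h0
        constructorm* _ ∧ _
        all_goals try omega
        all_goals try trivial
        refine hkey _ _ (by simp) ?_ (by simp) ?_ (by simp) (by simp) (by simp [h0]) (by omega)
        · exact ((((hI.frame.set (by simp) _).put (by simp) _ _).set (by simp) _).put
            (by simp) _ _).set (by simp) _
        · intro x hx
          simp [hx]
      · intro h0
        have h0 : ¬ h'.a .num (σ + 1) - 1 < h.a .depth u := by
          by_contra hcon; simp [hcon] at h0
        constructorm* _ ∧ _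
        all_goals try omega
        all_goals try trivial
        refine hkey _ _ (by simp) ?_ (by simp) ?_ (by simp) (by simp) (by simp [h0, hu]) (by omega)
        · exact (((hI.frame.set (by simp) _).put (by simp) _ _).set (by simp) _).set (by simp) _
        · intro x hx
          simp [hx]
    · intro hge'
      have hjk : h'.v .j = (xs s).length := by
        have : ¬ h'.v .j < (xs s).length := by simpa [hk'] using hge'
        omega
      have hs' : h'.v .s = s := by
        rw [hI.frame.v _ (by simp), ← hvs]; simp [← hh₁]
      simp only [Expr.cost, hs']
      refine ⟨⟨trivial, by omega, by omega⟩, by omega, by omega,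
        (hF₁.trans (hI.frame.mono (by simp) (by simp))).set (by simp) _,
        (hI.out.trans ho₁), by simp, fun σ => ?_⟩
      simp only [Store.set_a, Store.set_v_of_ne, ne_eq, reduceCtorEq, not_false_eq_true, hn']
      by_cases hσ : σ ∈ xs s
      · exact hn₁ ▸ hI.done σ (by rwa [hjk, List.take_length])
      · exact hn₁ ▸ (hI.todo σ (by rwa [hjk, List.take_length])).drop_of_notMem (by simpa using hσ)

/-- The invariant of the loop of `shift`. -/
structure ShiftInv {q : ℕ} (m : ℕ) (xs : ℕ → List (Fin q)) (S : ℕ → Finset ℕ) (s i c : ℕ)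
    (h : Store) (b : ℕ) (h' : Store) (b' : ℕ) : Prop where
  le : s ≤ h'.v .s
  le' : h'.v .s ≤ i
  win : WindowOk m xs S (h'.v .s) c h'
  frame : Frame [.blk, .k, .j, .y, .node, .s] [.cur, .num] h h'
  out : h'.out = h.out
  spent : b ≤ b' + 100 * wt xs s (h'.v .s)

/-- The windows passed on the way need not match any prefix, and their shapes may be missing from
the trie. This is why `CharOk` is stated with longest parts instead of exact shapes. -/
theorem shift_spec (C : Layout M q m n xs pt) {S : ℕ → Finset ℕ} {h : Store} {b s c l f : ℕ}
    (hP : Prepared M m n xs pt S h) (hW : WindowOk m xs S s c h) (hsc : c = s + l)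
    (hc : c ≤ m + n) (hlm : l ≤ m) (hvs : h.v .s = s) (hvl : h.v .l = l) (hf : h.a .border l = f)
    (hfl : f < l) (hb : 100 * wt xs s (s + (l - f)) + 50 ≤ b) :
    vc M shift (fun h' b' => b ≤ b' + 100 * wt xs s (s + (l - f)) + 50 ∧
      Frame [.blk, .k, .j, .y, .node, .s, .f, .i, .l] [.cur, .num] h h' ∧
      h'.out = h.out ∧ h'.v .s = s + (l - f) ∧ h'.v .l = f ∧
      WindowOk m xs S (s + (l - f)) c h') h b := by
  have hw : M.w ≠ 0 := by have := M.one_lt; intro h0; simp [h0] at this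
  have hcap := C.cap_bound
  have hpow := C.pow_bound
  have hge := C.len_ge
  generalize hi : s + (l - f) = i at *
  unfold shift
  simp only [vc, Expr.ok, Expr.cost, Expr.eval, Op.val, Op.safe, Store.set_v_same,
    Store.set_v_of_ne, ne_eq, reduceCtorEq, not_false_eq_true, hvs, hvl, hf, hi]
  generalize hh₁ : (h.set .f f).set .i i = h₁
  have hF₁ : Frame [.blk, .k, .j, .y, .node, .s, .f, .i, .l] [.cur, .num] h h₁ :=
    hh₁ ▸ ((Frame.refl _ _ _).set (by simp) _).set (by simp) _
  have ho₁ : h₁.out = h.out := by simp [← hh₁]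
  have hs₁ : h₁.v .s = s := by simp [← hh₁, hvs]
  have hi₁ : h₁.v .i = i := by simp [← hh₁]
  have hf₁ : h₁.v .f = f := by simp [← hh₁]
  have hn₁ : h₁.v .nodes = h.v .nodes := hF₁.v _ (by simp)
  have hW₁ : WindowOk m xs S s c h₁ := hW.congr hn₁ (by simp [← hh₁]) (by simp [← hh₁])
    (by simp [← hh₁])
  have hP₁ := hP.frame (hF₁.mono (by simp) (by simp))
  constructorm* _ ∧ _
  all_goals try omega
  all_goals try trivial
  refine wp_loop (ShiftInv m xs S s i c h₁ (b - 30)) ?_ ?_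
  · exact ⟨by omega, by omega, hs₁ ▸ hW₁, Frame.refl _ _ _, rfl, by simp [hs₁]; omega⟩
  · intro h' b' hI
    have hi' : h'.v .i = i := by rw [← hi₁]; exact hI.frame.v _ (by simp)
    have hf' : h'.v .f = f := by rw [← hf₁]; exact hI.frame.v _ (by simp)
    have hsp := hI.spent
    have hle := hI.le
    have hle' := hI.le'
    have hwin := hI.win
    have hwt := wt_add (xs := xs) hle hle'
    generalize hs' : h'.v .s = s' at *
    refine ⟨by simp, by simp; omega, ?_, ?_⟩
    · intro hlt
      have hlt : s' < i := by simpa [hi', hs'] using hlt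
      have hwt' := wt_eq_add (xs := xs) hlt
      have hP' := hP₁.frame (hI.frame.mono (by simp) (by simp))
      refine vc_mono (dropSet_spec C hP' hwin (by omega) hc hs' (by simp; omega)) ?_
      rintro h₂ b₂ ⟨e1, e2, e3, e4, e5⟩
      refine ⟨by omega, by omega, e4 ▸ e5, hI.frame.trans e2, e3.trans hI.out, ?_⟩
      rw [e4, wt_succ hle]
      simp at e1
      omega
    · intro hge'
      have hsi : s' = i := by
        have : ¬ s' < i := by simpa [hi', hs'] using hge'
        omega
      subst hsi
      simp only [Expr.cost, hf']
      refine ⟨trivial, by omega, by omega,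
        (hF₁.trans (hI.frame.mono (by simp) (by simp))).set (by simp) _, hI.out.trans ho₁,
        by simp, by simp, ?_⟩
      exact hwin.congr (by simp) rfl rfl rfl

end

end SetMatch

namespace SetMatch
open Finset WordRAM

/-! ### The search -/

section SearchOk

variable {α : Type} [DecidableEq α]

/-- The state of the search: the window `[s, c)` matches the first `l` sets, all candidates before
`s` are settled, and `out` reports the occurrences of the pattern that start before `s`. -/
structure SearchOk (X : ℕ → Finset α) (m L s c l : ℕ) (border : ℕ → ℕ) (out : List ℕ) : Prop where
  s_pos : 0 < s
  c_eq : c = s + l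
  c_le : c ≤ L
  l_le : l ≤ m
  pm : PMatchAt X 0 s l
  border : ∀ e, 0 < e → e ≤ c → e ≤ m → IsBorder X e (border e)
  low : c + 1 ≤ m → ∀ s', 0 < s' → s' < s → ¬ PMatchAt X 0 s' (c + 1 - s')
  sound : ∀ x ∈ out, ∃ s', m ≤ s' ∧ s' + m ≤ L ∧ x = s' - m + 1 ∧ PMatchAt X 0 s' m
  complete : ∀ s', m ≤ s' → s' < s → PMatchAt X 0 s' m → s' - m + 1 ∈ out

/-- Record the border `l` of the prefix of length `c`. -/
def recordBorder (m c l : ℕ) (border : ℕ → ℕ) : ℕ → ℕ :=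
  if c < m + 1 then Function.update border c l else border

namespace SearchOk

variable {X : ℕ → Finset α} {m L s c l : ℕ} {border : ℕ → ℕ} {out : List ℕ}

/-- Position 0 is left out because the pattern trivially matches itself there. The border of the
prefix of length 1 is 0, which an untouched cell already contains. -/
theorem init (hm : 0 < m) (hL : 1 ≤ L) (h0 : border 1 = 0) : SearchOk X m L 1 1 0 border [] where
  s_pos := by omega
  c_eq := rfl
  c_le := hL
  l_le := Nat.zero_le _
  pm := pMatchAt_zero _ _
  border e h1 h2 _ := by
    obtain rfl : e = 1 := by omega
    rw [h0]
    exact ⟨by omega, pMatchAt_zero _ _, fun s h3 h4 => by omega⟩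
  low _ s' h1 h2 := by omega
  sound x hx := by simp at hx
  complete s' h1 h2 _ := by omega

theorem border_record (h : SearchOk X m L s c l border out) {f : ℕ}
    (hf : c + 1 ≤ m → IsBorder X (c + 1) f) (e : ℕ) (h1 : 0 < e) (h2 : e ≤ c + 1) (h3 : e ≤ m) :
    IsBorder X e (recordBorder m (c + 1) f border e) := by
  unfold recordBorder
  rcases h2.lt_or_eq with h4 | rfl
  · have := h.border e h1 (by omega) h3
    split_ifs
    · rwa [Function.update_of_ne (by omega)]
    · exact this
  · rw [if_pos (by omega), Function.update_self]
    exact hf h3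

theorem extend (h : SearchOk X m L s c l border out) (hl : l < m) (hc : c < L)
    (hpm : PMatchAt X 0 s (l + 1)) :
    SearchOk X m L s (c + 1) (l + 1) (recordBorder m (c + 1) (l + 1) border) out where
  s_pos := h.s_pos
  c_eq := by have := h.c_eq; omega
  c_le := hc
  l_le := hl
  pm := hpm
  border := h.border_record fun hcm => by
    have h1 := h.c_eq
    have h2 := h.s_pos
    -- The border just found starts at `s`, and by `low` no smaller positive start reaches the end
    -- of this prefix: it is the longest one.
    rw [show l + 1 = c + 1 - s by omega] at hpm ⊢
    refine ⟨by omega, by rwa [show c + 1 - (c + 1 - s) = s by omega], fun s' h3 h4 => ?_⟩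
    exact h.low hcm s' h3 (by omega)
  low hcm s' h1 h2 hp := h.low (by omega) s' h1 h2 (hp.mono (by omega))
  sound := h.sound
  complete := h.complete

theorem skip (h : SearchOk X m L s c 0 border out) (hm : 0 < m) (hc : c < L)
    (hpm : ¬ PMatchAt X 0 s 1) :
    SearchOk X m L (s + 1) (c + 1) 0 (recordBorder m (c + 1) 0 border) out := by
  have hcs := h.c_eq
  have hlow : c + 1 ≤ m → ∀ s', 0 < s' → s' < s + 1 → ¬ PMatchAt X 0 s' (c + 1 - s') := by
    intro hcm s' h1 h2
    rcases Nat.lt_succ_iff_lt_or_eq.1 h2 with h3 | rfl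
    · exact h.low hcm s' h1 h3
    · rwa [show c + 1 - s' = 1 by omega]
  refine ⟨by omega, by omega, hc, by omega, pMatchAt_zero _ _, h.border_record fun hcm => ?_,
    fun hcm s' h1 h2 hp => hlow (by omega) s' h1 h2 (hp.mono (by omega)), h.sound, ?_⟩
  · exact ⟨by omega, pMatchAt_zero _ _, fun s' h1 h2 => by
      simpa using hlow hcm s' h1 (by omega)⟩
  · intro s' h1 h2 hp
    rcases Nat.lt_succ_iff_lt_or_eq.1 h2 with h3 | rfl
    · exact h.complete s' h1 h3 hp
    · exact absurd (hp.mono (by omega)) hpm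

/-- A start strictly between `s` and the next candidate cannot even reach `c`, because the border is
the longest one; the start `s` itself is settled by `hlow` and `hout`. -/
theorem shift (h : SearchOk X m L s c l border out) (hl : 0 < l)
    (hlow : c + 1 ≤ m → ¬ PMatchAt X 0 s (l + 1))
    (hout : m ≤ s → PMatchAt X 0 s m → s - m + 1 ∈ out) :
    SearchOk X m L (s + (l - border l)) c (border l) border out := by
  have hcs := h.c_eq
  have hlm := h.l_le
  have hs := h.s_pos
  have hb := h.border l hl (by omega) hlm
  have hbl := hb.1
  have hno : ∀ s', s < s' → s' < s + (l - border l) → ¬ PMatchAt X 0 s' (c - s') := by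
    intro s' h1 h2
    rw [hcs]
    exact hb.not_pMatchAt h.pm h1 h2
  refine ⟨by omega, by omega, h.c_le, by omega, hb.pMatchAt h.pm, h.border, ?_, h.sound, ?_⟩
  · intro hcm s' h1 h2
    rcases lt_trichotomy s' s with h3 | rfl | h3
    · exact h.low hcm s' h1 h3
    · rw [show c + 1 - s' = l + 1 by omega]
      exact hlow hcm
    · exact fun hp => hno s' h3 h2 (hp.mono (by omega))
  · intro s' h1 h2 hp
    rcases lt_trichotomy s' s with h3 | rfl | h3
    · exact h.complete s' h1 h3 hp
    · exact hout h1 hp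
    · exact absurd (hp.mono (by omega)) (hno s' h3 h2)

theorem report (h : SearchOk X m L s c m border out) (hm : m ≤ s) :
    SearchOk X m L s c m border (out ++ [s - m + 1]) := by
  refine ⟨h.s_pos, h.c_eq, h.c_le, h.l_le, h.pm, h.border, h.low, ?_, ?_⟩
  · intro x hx
    rcases List.mem_append.1 hx with h1 | h1
    · exact h.sound x h1
    · rw [List.mem_singleton] at h1
      exact ⟨s, hm, by have := h.c_eq; have := h.c_le; omega, h1, h.pm⟩
  · exact fun s' h1 h2 hp => List.mem_append_left _ (h.complete s' h1 h2 hp)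

/-- At the end of the sequence `l < m` means that `s` is too late for a whole occurrence, so all
occurrences start before `s`. -/
theorem mem_out_iff (h : SearchOk X m L s L l border out) (hl : l < m) (x : ℕ) :
    x ∈ out ↔ ∃ s', m ≤ s' ∧ s' + m ≤ L ∧ x = s' - m + 1 ∧ PMatchAt X 0 s' m := by
  refine ⟨h.sound x, ?_⟩
  rintro ⟨s', h1, h2, rfl, h3⟩
  exact h.complete s' h1 (by have := h.c_eq; omega) h3

end SearchOk

end SearchOk

/-! ### The search loop and its amortized cost -/

/-- Advance the end of the window, and record the border. -/
def advance : Cmd :=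
  .set .c (.var .c +ₑ .lit 1) ;;
  .ite (.var .c <ₑ (.var .m +ₑ .lit 1)) (.put .border Var.c Var.l) .skip

def searchStep : Cmd :=
  .ite (.var .l =ₑ Var.m)
    (.ite (.var .s <ₑ Var.m) .skip (.emit (.var .s -ₑ Var.m +ₑ .lit 1)) ;; shift)
    (compare ;;
     .ite Var.bad
       (.ite Var.l shift (.set .s (.var .s +ₑ .lit 1) ;; advance))
       (commit ;; .set .l (.var .l +ₑ .lit 1) ;; advance))

/-- Report the occurrences of the pattern in the text. -/
def search : Cmd :=
  .set .s (.lit 1) ;;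
  .set .c (.lit 1) ;;
  .set .l (.lit 0) ;;
  .loop ((.var .c <ₑ Var.len) +ₑ (.var .l =ₑ Var.m)) searchStep

/-- The common size of the sets at the positions `l` and `c`, if they will be compared. -/
def pending {q : ℕ} (xs : ℕ → List (Fin q)) (m L l c : ℕ) : ℕ :=
  if l < m ∧ c < L then common xs l c else 0

/-- The potential of the search: a bound on its remaining time. -/
def searchPotential {q : ℕ} (xs : ℕ → List (Fin q)) (m L s c l : ℕ) : ℕ :=
  300 * wt xs (c + 1) L + 1000 * wt xs c L + 600 * wt xs s c + 230 * pending xs m L l c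

section

variable {M : Machine} {q m n : ℕ} {xs : ℕ → List (Fin q)} {pt : ℕ → ℕ}

theorem common_le_left (xs : ℕ → List (Fin q)) (l c : ℕ) : common xs l c ≤ (xs l).length := by
  unfold common; split_ifs with h <;> omega

theorem common_le_right (xs : ℕ → List (Fin q)) (l c : ℕ) : common xs l c ≤ (xs c).length := by
  unfold common; split_ifs <;> omega

theorem pending_le (xs : ℕ → List (Fin q)) (m L l c : ℕ) : pending xs m L l c ≤ wt xs c L := by
  unfold pending
  split_ifs with h
  · exact (common_le_right xs l c).trans (length_lt_wt le_rfl h.2).le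
  · exact Nat.zero_le _

/-- When a position enters the window, its weight drops from 1000 to 600, which frees 400. The first
comparison at the next position, at rate 230, is paid by the terms of weight 300, and the old
pending term pays for the comparison just made. -/
theorem searchPotential_extend {L s c l l' : ℕ} (hsc : s ≤ c) (hl : l < m) (hc : c < L) :
    searchPotential xs m L s (c + 1) l' + 400 * ((xs c).length + 1) + 230 * common xs l c ≤
      searchPotential xs m L s c l := by
  have h1 := wt_eq_add (xs := xs) hc
  have h2 := wt_succ (xs := xs) hsc
  have h3 := pending_le xs m L l' (c + 1)
  have h4 : pending xs m L l' (c + 1) + wt xs (c + 1 + 1) L ≤ wt xs (c + 1) L := by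
    rcases (show c + 1 ≤ L from hc).lt_or_eq with h5 | h5
    · have h6 := wt_eq_add (xs := xs) h5
      have h7 : pending xs m L l' (c + 1) ≤ (xs (c + 1)).length := by
        unfold pending
        split_ifs
        · exact common_le_right _ _ _
        · exact Nat.zero_le _
      omega
    · have : wt xs (c + 1 + 1) L = 0 := by simp [wt, ← h5]
      omega
  have h5 : pending xs m L l c = common xs l c := if_pos ⟨hl, hc⟩
  unfold searchPotential
  omega

/-- Of the 600 credits on each unit that leaves the window, 230 pay for the next comparison and 370
remain. The set at `f` has the size of some set at `r < l - f`, and the latter has the size of the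
set at `s + r`, which is being removed. -/
theorem searchPotential_shift (C : Layout M q m n xs pt) {L s c l f : ℕ} (hsc : c = s + l)
    (hf : IsBorder (sets xs) l f) (hpm : PMatchAt (sets xs) 0 s l) :
    searchPotential xs m L (s + (l - f)) c f + 370 * wt xs s (s + (l - f)) +
      230 * pending xs m L l c ≤ searchPotential xs m L s c l := by
  have hfl := hf.1
  have h1 : pending xs m L f c ≤ wt xs s (s + (l - f)) := by
    unfold pending
    split_ifs
    · obtain ⟨r, hr, h2⟩ := exists_card_eq_of_border (by omega) hf.2.1
      have h3 := hpm.card_eq (i := r) (by omega)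
      rw [zero_add] at h3
      rw [h3, card_sets C, card_sets C] at h2
      refine (common_le_left xs f c).trans ?_
      rw [← h2]
      exact (length_lt_wt (by omega) (by omega)).le
    · exact Nat.zero_le _
  have h2 := wt_add (xs := xs) (show s ≤ s + (l - f) by omega) (show s + (l - f) ≤ c by omega)
  unfold searchPotential
  omega

/-- The invariant of `search`. -/
structure SearchInv {q : ℕ} (m n : ℕ) (xs : ℕ → List (Fin q)) (S : ℕ → Finset ℕ) (h : Store)
    (b : ℕ) (h' : Store) (b' : ℕ) : Prop where
  frame : SearchFrame h h'
  ok : SearchOk (sets xs) m (m + n) (h'.v .s) (h'.v .c) (h'.v .l) (h'.a .border) h'.out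
  win : WindowOk m xs S (h'.v .s) (h'.v .c) h'
  cnt : ∀ x, h'.a .cnt x = 0
  spent : b + searchPotential xs m (m + n) (h'.v .s) (h'.v .c) (h'.v .l) ≤
    b' + searchPotential xs m (m + n) 1 1 0

theorem advance_spec (C : Layout M q m n xs pt) {h : Store} {b : ℕ} {Q : Store → ℕ → Prop}
    (hm : h.v .m = m) (hc : h.v .c < m + n) (hb : 40 ≤ b)
    (hQ : ∀ h' b', b ≤ b' + 40 → Frame [.c] [.border] h h' → h'.out = h.out →
      h'.v .c = h.v .c + 1 →
      h'.a .border = recordBorder m (h.v .c + 1) (h.v .l) (h.a .border) → Q h' b') :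
    vc M advance Q h b := by
  have hw : M.w ≠ 0 := by have := M.one_lt; intro h0; simp [h0] at this
  have hcap := C.cap_bound
  have hpow := C.pow_bound
  have hge := C.len_ge
  unfold advance
  simp only [vc, Expr.ok, Expr.cost, Expr.eval, Op.val, Op.safe, Store.set_v_same,
    Store.set_v_of_ne, ne_eq, reduceCtorEq, not_false_eq_true, hm]
  constructorm* _ ∧ _
  all_goals try omega
  all_goals try trivial
  · intro h0
    have h0 : h.v .c + 1 < m + 1 := by by_contra hcon; simp [hcon] at h0
    constructorm* _ ∧ _
    all_goals try omega
    all_goals try trivial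
    refine hQ _ _ (by omega) (((Frame.refl _ _ _).set (by simp) _).put (by simp) _ _) rfl (by simp) ?_
    rw [recordBorder, if_pos h0]
    simp
  · intro h0
    have h0 : ¬ h.v .c + 1 < m + 1 := by intro hcon; simp [hcon] at h0
    refine ⟨by omega, hQ _ _ (by omega) ((Frame.refl _ _ _).set (by simp) _) rfl (by simp) ?_⟩
    rw [recordBorder, if_neg h0]
    simp

/-- In `hb` the budget may be overdrawn by the comparison just made and a constant. The shift frees
370 credits per unit and uses 100 per unit plus 50; since at least one unit is removed, the
remaining 220 cover this constant. -/
theorem shift_search (C : Layout M q m n xs pt) {S : ℕ → Finset ℕ} {h₀ h : Store} {b₀ b : ℕ}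
    (hP : Prepared M m n xs pt S h₀) (hF : SearchFrame h₀ h)
    (hok : SearchOk (sets xs) m (m + n) (h.v .s) (h.v .c) (h.v .l) (h.a .border) h.out)
    (hW : WindowOk m xs S (h.v .s) (h.v .c) h) (hcnt : ∀ x, h.a .cnt x = 0) (hl : 0 < h.v .l)
    (hlow : h.v .c + 1 ≤ m → ¬ PMatchAt (sets xs) 0 (h.v .s) (h.v .l + 1))
    (hout : m ≤ h.v .s → PMatchAt (sets xs) 0 (h.v .s) m → h.v .s - m + 1 ∈ h.out)
    (hb : b₀ + searchPotential xs m (m + n) (h.v .s) (h.v .c) (h.v .l) ≤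
      b + 220 + 230 * pending xs m (m + n) (h.v .l) (h.v .c) +
        searchPotential xs m (m + n) 1 1 0) (hb₀ : searchPotential xs m (m + n) 1 1 0 ≤ b₀) :
    vc M shift (SearchInv m n xs S h₀ b₀) h b := by
  have hf := hok.border _ hl (by have := hok.c_eq; omega) hok.l_le
  have h1 := searchPotential_shift C (L := m + n) hok.c_eq hf hok.pm
  have hfl := hf.1
  have h2 := length_lt_wt (xs := xs) (a := h.v .s)
    (b := h.v .s + (h.v .l - h.a .border (h.v .l))) le_rfl (by omega)
  refine vc_mono (shift_spec C (hP.frame hF) hW hok.c_eq hok.c_le hok.l_le rfl rfl rfl hfl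
    (by omega)) ?_
  rintro h' b' ⟨e1, e2, e3, e4, e5, e6⟩
  have ec : h'.v .c = h.v .c := e2.v _ (by simp)
  refine ⟨hF.trans (e2.mono (by simp) (by simp)), ?_, ?_, ?_, ?_⟩
  · rw [e3, e4, e5, ec, e2.a .border (by simp)]
    exact hok.shift hl hlow hout
  · rwa [e4, ec]
  · rw [e2.a .cnt (by simp)]; exact hcnt
  · rw [e4, e5, ec]
    omega

theorem searchStep_spec (C : Layout M q m n xs pt) {S : ℕ → Finset ℕ} {h₀ h : Store} {b₀ b : ℕ}
    (hP : Prepared M m n xs pt S h₀) (hm : 0 < m) (hI : SearchInv m n xs S h₀ b₀ h b)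
    (hc : h.v .l ≠ m → h.v .c < m + n)
    (hb₀ : searchPotential xs m (m + n) 1 1 0 + 50 ≤ b₀) :
    vc M searchStep (SearchInv m n xs S h₀ b₀) h (b - 12) := by
  have hw : M.w ≠ 0 := by have := M.one_lt; intro h0; simp [h0] at this
  have hcap := C.cap_bound
  have hpow := C.pow_bound
  have hge := C.len_ge
  have hF := hI.frame
  have hP' := hP.frame hF
  have hok := hI.ok
  have hW := hI.win
  have hcnt := hI.cnt
  have hsp := hI.spent
  have hvm := hP'.m_eq
  have hcs := hok.c_eq
  have hcl := hok.c_le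
  have hlm := hok.l_le
  unfold searchStep
  simp only [vc, Expr.ok, Expr.cost, Expr.eval, Op.val, Op.safe, hvm]
  refine ⟨⟨trivial, trivial, trivial⟩, by omega, fun h0 => ?_, fun h0 => ?_⟩
  · have hl : h.v .l = m := by by_contra hcon; simp [hcon] at h0
    refine ⟨⟨trivial, trivial, trivial⟩, by omega, fun h1 => ?_, fun h1 => ?_⟩
    · have h1 : h.v .s < m := by by_contra hcon; simp [hcon] at h1
      -- A full match that starts inside the pattern is not an occurrence in the text; nothing is
      -- reported.
      refine ⟨by omega, shift_search C hP hF hok hW hcnt (by omega) (fun _ => by omega)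
        (fun _ => by omega) (by omega) (by omega)⟩
    · have h1 : ¬ h.v .s < m := by intro hcon; simp [hcon] at h1
      refine ⟨⟨⟨trivial, trivial, by omega⟩, by omega, by omega⟩, by omega, ?_⟩
      refine shift_search C hP (hF.trans ⟨fun _ _ => rfl, fun _ _ => rfl⟩) ?_ hW hcnt
        (show 0 < h.v .l by omega) (fun hcm => ?_) (fun _ _ => by simp) ?_ (by omega)
      · have := (hl ▸ hok).report (by omega)
        simpa [hl] using this
      · simp only [Store.emit_v] at hcm
        omega
      · simp only [Store.emit_v]
        omega
  · have hl : h.v .l < m := by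
      have : h.v .l ≠ m := by intro hcon; simp [hcon] at h0
      omega
    have hcL := hc (by omega)
    have hpot := fun l' => searchPotential_extend (xs := xs) (l' := l')
      (show h.v .s ≤ h.v .c by omega) hl hcL
    have hpend : pending xs m (m + n) (h.v .l) (h.v .c) = common xs (h.v .l) (h.v .c) :=
      if_pos ⟨hl, hcL⟩
    have hpot' := hpot 0
    have hcr := common_le_right xs (h.v .l) (h.v .c)
    refine vc_mono (compare_spec C hP' hW hcnt hok.pm hcs hl hcL rfl rfl (by omega)) ?_
    intro h₁ b₁ hC
    have hF₁ := hC.frame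
    have hspent := hC.spent
    have es : h₁.v .s = h.v .s := hF₁.v _ (by simp)
    have ec : h₁.v .c = h.v .c := hF₁.v _ (by simp)
    have el : h₁.v .l = h.v .l := hF₁.v _ (by simp)
    have en : h₁.v .nodes = h.v .nodes := hF₁.v _ (by simp)
    have eb : h₁.a .border = h.a .border := hF₁.a _ (by simp)
    have hW₁ : WindowOk m xs S (h.v .s) (h.v .c) h₁ :=
      hW.congr en (hF₁.a _ (by simp)) (hF₁.a _ (by simp)) (hF₁.a _ (by simp))
    have hFF₁ : SearchFrame h₀ h₁ := hF.trans (hF₁.mono (by simp) (by simp))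
    have hm₁ := (hP.frame hFF₁).m_eq
    refine ⟨trivial, by omega, fun hbad => ?_, fun hbad => ?_⟩
    · have hno : ¬ PMatchAt (sets xs) 0 (h.v .s) (h.v .l + 1) := fun hp => hbad (hC.bad_iff.2 hp)
      refine ⟨trivial, by omega, fun hl0 => ?_, fun hl0 => ?_⟩
      · refine shift_search C hP hFF₁ ?_ ?_ hC.cnt (Nat.pos_of_ne_zero hl0) ?_ ?_ ?_ (by omega)
        · rw [es, ec, el, eb, hC.out]; exact hok
        · rwa [es, ec]
        · intro _; rwa [es, el]
        · intro _ hp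
          rw [es] at hp
          exact absurd (hp.mono hl) hno
        · rw [es, ec, el]
          omega
      · have hl0 : h.v .l = 0 := el ▸ hl0
        simp only [es]
        refine ⟨⟨trivial, by omega, by omega⟩, by omega, ?_⟩
        refine advance_spec C (by simpa using hm₁) (by simp [ec]; omega)
          (by omega) ?_
        intro h₂ b₂ e1 e2 e3 e4 e5
        simp only [Store.set_v_of_ne, ne_eq, reduceCtorEq, not_false_eq_true, Store.set_a, ec, el,
          eb, hl0] at e4 e5
        have es₂ : h₂.v .s = h.v .s + 1 := by rw [e2.v _ (by simp)]; simp
        have el₂ : h₂.v .l = 0 := by rw [e2.v _ (by simp)]; simp [el, hl0]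
        have en₂ : h₂.v .nodes = h₁.v .nodes := by rw [e2.v _ (by simp)]; simp
        have hF₂ : Frame [.c, .s] [.border] h₁ h₂ :=
          ((Frame.refl _ _ _).set (by simp) _).trans (e2.mono (by simp) (by simp))
        refine ⟨hFF₁.trans (hF₂.mono (by simp) (by simp)), ?_, ?_, ?_, ?_⟩
        · rw [es₂, e4, el₂, e5, e3, Store.set_out, hC.out]
          exact (hl0 ▸ hok).skip hm hcL (by simpa [hl0] using hno)
        · rw [es₂, e4]
          have hcs' : h.v .c = h.v .s := by omega
          intro σ
          have := hW₁ σ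
          rw [hcs'] at this ⊢
          -- Without a match the window is empty before and after, so no character has to be
          -- updated.
          rw [en₂, hF₂.a .num (by simp), hF₂.a .cur (by simp), hF₂.a .last (by simp)]
          exact this.skip
        · rw [hF₂.a .cnt (by simp)]; exact hC.cnt
        · rw [es₂, e4, el₂]
          have : searchPotential xs m (m + n) (h.v .s + 1) (h.v .c + 1) 0 ≤
              searchPotential xs m (m + n) (h.v .s) (h.v .c + 1) 0 := by
            have := wt_eq_add (xs := xs) (show h.v .s < h.v .c + 1 by omega)
            unfold searchPotential
            omega
          omega
    · have hpm := hC.bad_iff.1 hbad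
      have hcard := hpm.card_eq (i := h.v .l) (by omega)
      rw [zero_add, ← hcs, card_sets C, card_sets C] at hcard
      have hcomm : common xs (h.v .l) (h.v .c) = (xs (h.v .c)).length := if_pos hcard.symm
      have hcl' : h.v .c - h.v .s = h.v .l := by omega
      have hpot₁ := hpot (h.v .l + 1)
      refine vc_mono (commit_spec C hW₁ (by omega) (by omega) hcL (hcl' ▸ hok.pm) ec hC.blk hC.k
        (en ▸ hC.next hbad) (by omega)) ?_
      rintro h₂ b₂ ⟨f1, f2, f3, f4⟩
      have el₂ : h₂.v .l = h.v .l := (f2.v _ (by simp)).trans el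
      have ec₂ : h₂.v .c = h.v .c := (f2.v _ (by simp)).trans ec
      have em₂ : h₂.v .m = m := (f2.v _ (by simp)).trans hm₁
      have eb₂ : h₂.a .border = h.a .border := (f2.a _ (by simp)).trans eb
      simp only [el₂]
      refine ⟨⟨trivial, by omega, by omega⟩, by omega, ?_⟩
      refine advance_spec C (by simpa using em₂) (by simp [ec₂]; omega) (by omega) ?_
      intro h₃ b₃ e1 e2 e3 e4 e5
      simp only [Store.set_v_of_ne, Store.set_v_same, ne_eq, reduceCtorEq, not_false_eq_true,
        Store.set_a, ec₂, eb₂] at e4 e5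
      have hF₃ : Frame [.c, .l] [.border] h₂ h₃ :=
        ((Frame.refl _ _ _).set (by simp) _).trans (e2.mono (by simp) (by simp))
      have es₃ : h₃.v .s = h.v .s := by rw [hF₃.v _ (by simp), f2.v _ (by simp), es]
      have el₃ : h₃.v .l = h.v .l + 1 := by rw [e2.v _ (by simp)]; simp
      have hFF₃ : SearchFrame h₀ h₃ := (hFF₁.trans (f2.mono (by simp) (by simp))).trans
        (hF₃.mono (by simp) (by simp))
      refine ⟨hFF₃, ?_, ?_, ?_, ?_⟩
      · rw [es₃, e4, el₃, e5, e3, Store.set_out, f3, hC.out]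
        exact hok.extend hl hcL hpm
      · rw [es₃, e4]
        exact f4.congr (hF₃.v _ (by simp)) (hF₃.a _ (by simp)) (hF₃.a _ (by simp))
          (hF₃.a _ (by simp))
      · rw [hF₃.a .cnt (by simp), f2.a .cnt (by simp)]; exact hC.cnt
      · rw [es₃, e4, el₃]
        omega

theorem search_spec (C : Layout M q m n xs pt) {S : ℕ → Finset ℕ} {h : Store} {b : ℕ}
    (hP : Prepared M m n xs pt S h) (hm : 0 < m) (hn : 0 < n) (hcnt : h.a .cnt = fun _ => 0)
    (hcur : h.a .cur = fun _ => 0) (hlast : h.a .last = fun _ => 0)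
    (hnum : h.a .num = fun _ => 0) (hborder : h.a .border = fun _ => 0) (hout : h.out = [])
    (hb : 2200 * wt xs 0 (m + n) + 50 ≤ b) :
    wp M search (fun h' b' => b ≤ b' + 2200 * wt xs 0 (m + n) + 50 ∧ ∀ x, x ∈ h'.out ↔
      ∃ s, m ≤ s ∧ s + m ≤ m + n ∧ x = s - m + 1 ∧ PMatchAt (sets xs) 0 s m) h b := by
  have hw : M.w ≠ 0 := by have := M.one_lt; intro h0; simp [h0] at this
  have hpow := C.pow_bound
  have hwt0 := wt_eq_add (xs := xs) (show 0 < m + n by omega)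
  -- The window is empty at the start; the constant is `300 + 1000 + 230`.
  have hpot : searchPotential xs m (m + n) 1 1 0 ≤ 1530 * wt xs 0 (m + n) := by
    have h1 := wt_eq_add (xs := xs) (show 0 + 1 < m + n by omega)
    have h2 := pending_le xs m (m + n) 0 1
    unfold searchPotential
    rw [wt_self]
    simp only [zero_add] at *
    omega
  apply wp_of_vc
  unfold search
  simp only [vc, Expr.ok, Expr.cost, Expr.eval]
  refine ⟨by omega, by omega, by omega, by omega, by omega, by omega,
    wp_loop (SearchInv m n xs S h (b - 9)) ?_ ?_⟩
  · refine ⟨((((Frame.refl _ _ _).set (by simp) _).set (by simp) _).set (by simp) _), ?_, ?_, ?_, ?_⟩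
    · have := SearchOk.init (X := sets xs) (m := m) (L := m + n) (border := h.a .border) hm
        (by omega) (by simp [hborder])
      simpa [hout] using this
    · intro σ
      have hsh : shape (sets xs) σ 1 0 = ∅ := shape_eq_empty one_pos
      have T := hP.trie
      simp only [Store.set_v_of_ne, Store.set_v_same, ne_eq, reduceCtorEq, not_false_eq_true,
        Store.set_a, hcur, hlast, hnum]
      -- The zeros in `last` point to position 0, which lies before the first window; every shape is
      -- empty and the root is the right node.
      refine ⟨one_pos, fun h1 => by omega, fun i h1 h2 => by omega, by simp [hsh], Nat.zero_le _,
        ?_, fun F _ hF => ?_⟩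
      · rw [T.zero]; exact low_empty _
      · rw [T.zero]; rw [hsh] at hF; exact hF.1
    · simp [hcnt]
    · simp; omega
  · intro h' b' hI
    have hP' := hP.frame hI.frame
    have hlen := hP'.len_eq
    have hm' := hP'.m_eq
    have hsp := hI.spent
    -- The sum of the two tests acts as a disjunction: a full match that ends at the last position
    -- must still be reported and shifted.
    simp only [Expr.ok, Expr.cost, Expr.eval, Op.val, Op.safe, hlen, hm']
    refine ⟨⟨⟨trivial, trivial, trivial⟩, ⟨trivial, trivial, trivial⟩, ?_⟩, by omega, ?_, ?_⟩
    · split_ifs <;> omega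
    · intro hne
      refine searchStep_spec C hP hm hI (fun hl => ?_) (by omega)
      by_contra hcon
      simp [hl, hcon] at hne
    · intro heq
      have hok := hI.ok
      have hcl := hok.c_le
      have hlm := hok.l_le
      have h1 : ¬ h'.v .c < m + n := by intro hcon; simp [hcon] at heq
      have h2 : h'.v .l ≠ m := by intro hcon; simp [hcon] at heq
      rw [show h'.v .c = m + n by omega] at hok
      exact ⟨by omega, hok.mem_out_iff (by omega)⟩

end

end SetMatch

namespace SetMatch
open Finset WordRAM

/-! ### The input -/

section

variable {q : ℕ} (ys : List (List (Fin q)))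

/-- The encoding of a set. -/
def block (l : List (Fin q)) : List ℕ := l.length :: l.map fun σ : Fin q => (σ : ℕ) + 1

/-- The address of the set number `i` if `ys` is encoded from address `3` on. -/
def addr (i : ℕ) : ℕ := 3 + ((ys.take i).flatMap block).length

variable {ys}

theorem length_block (l : List (Fin q)) : (block l).length = l.length + 1 := by simp [block]

theorem addr_succ {i : ℕ} (hi : i < ys.length) : addr ys (i + 1) = addr ys i + ys[i].length + 1 := by
  unfold addr
  rw [List.take_succ_eq_append_getElem hi, List.flatMap_append, List.length_append,
    List.flatMap_singleton, length_block]
  omega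

theorem addr_mono {i j : ℕ} (h : i ≤ j) : addr ys i ≤ addr ys j := by
  have h1 : ys.take i <+: ys.take j := List.take_prefix_take_left h
  obtain ⟨r, hr⟩ := h1
  unfold addr
  rw [← hr, List.flatMap_append, List.length_append]
  omega

theorem getD_addr {a b c : ℕ} {i : ℕ} (hi : i < ys.length) {x : ℕ} (hx : x < ys[i].length + 1) :
    ([a, b, c] ++ ys.flatMap block).getD (addr ys i + x) 0 = (block ys[i]).getD x 0 := by
  have h1 : ys = ys.take i ++ ([ys[i]] ++ ys.drop (i + 1)) := by
    rw [← List.append_assoc, ← List.take_succ_eq_append_getElem hi, List.take_append_drop]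
  have h2 : [a, b, c] ++ ys.flatMap block = ([a, b, c] ++ (ys.take i).flatMap block) ++
      (block ys[i] ++ (ys.drop (i + 1)).flatMap block) := by
    conv_lhs => rw [h1, List.flatMap_append, List.flatMap_append, List.flatMap_singleton]
    exact (List.append_assoc _ _ _).symm
  have h3 : addr ys i = ([a, b, c] ++ (ys.take i).flatMap block).length := by
    simp [addr]; omega
  rw [h2, h3, List.getD_append_right _ _ _ _ (by omega), Nat.add_sub_cancel_left,
    List.getD_append _ _ _ _ (by rw [length_block]; exact hx)]

theorem getD_addr_length {a b c : ℕ} {i : ℕ} (hi : i < ys.length) :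
    ([a, b, c] ++ ys.flatMap block).getD (addr ys i) 0 = ys[i].length := by
  have := getD_addr (a := a) (b := b) (c := c) hi (x := 0) (by omega)
  simpa [block] using this

theorem getD_addr_char {a b c : ℕ} {i j : ℕ} (hi : i < ys.length) (hj : j < ys[i].length) :
    ([a, b, c] ++ ys.flatMap block).getD (addr ys i + 1 + j) 0 = ys[i][j] + 1 := by
  have := getD_addr (a := a) (b := b) (c := c) hi (x := 1 + j) (by omega)
  rw [← add_assoc] at this
  rw [this, Nat.add_comm 1 j]
  simp [block, hj]

theorem addr_length {a b c : ℕ} : addr ys ys.length = ([a, b, c] ++ ys.flatMap block).length := by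
  simp [addr]; omega

variable (ys) (m n : ℕ)

/-- The index of the set `i`, where the pattern is put before the text. -/
def place (i : ℕ) : ℕ := if i < m then n + i else i - m

/-- The sets of the pattern, then those of the text. -/
def joint (i : ℕ) : List (Fin q) := ys.getD (place m n i) []

variable {ys m n}

theorem place_lt {i : ℕ} (hi : i < m + n) : place m n i < n + m := by
  unfold place; split_ifs <;> omega

theorem joint_eq {i : ℕ} (h : place m n i < ys.length) : joint ys m n i = ys[place m n i] :=
  List.getD_eq_getElem _ _ h

/-- Every set takes one cell for its size and one for each character, so the total weight is the
length of the input without its three leading numbers. -/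
theorem wt_joint (hys : ys.length = n + m) : wt (joint ys m n) 0 (m + n) + 3 = addr ys (n + m) := by
  have h1 : ∀ j ≤ n, wt (joint ys m n) m (m + j) + addr ys 0 = addr ys j := by
    intro j
    induction j with
    | zero => simp
    | succ j ih =>
      intro hj
      have h2 : place m n (m + j) = j := by simp [place]
      rw [← add_assoc, wt_succ (by omega), addr_succ (by omega), ← ih (by omega), joint_eq (by omega)]
      simp only [h2]
      omega
  have h2 : ∀ j ≤ m, wt (joint ys m n) 0 j + addr ys n = addr ys (n + j) := by
    intro j
    induction j with
    | zero => simp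
    | succ j ih =>
      intro hj
      have h2 : place m n j = n + j := by rw [place, if_pos (by omega)]
      rw [← add_assoc, wt_succ (by omega), addr_succ (by omega), ← ih (by omega), joint_eq (by omega)]
      simp only [h2]
      omega
  have h3 := h1 n le_rfl
  have h4 := h2 m le_rfl
  have h5 : addr ys 0 = 3 := by simp [addr]
  rw [← wt_add (Nat.zero_le m) (Nat.le_add_right m n)]
  omega

theorem layout_joint (hys : ys.length = n + m) (hn : ∀ l ∈ ys, l.Nodup) {M : Machine} {a b c : ℕ}
    (hinp : ∀ i < M.len, M.inp i = ([a, b, c] ++ ys.flatMap block).getD i 0)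
    (hlen : M.len = ([a, b, c] ++ ys.flatMap block).length)
    (hcap : (M.len + q + 4) * (M.len + q + 4) ≤ M.cap) :
    Layout M q m n (joint ys m n) fun i => addr ys (place m n i) := by
  rw [← addr_length, hys] at hlen
  have hpl : ∀ i < m + n, place m n i < ys.length := fun i hi => hys ▸ place_lt hi
  have hle : ∀ i (hi : i < m + n), addr ys (place m n i) + 1 + (joint ys m n i).length ≤ M.len := by
    intro i hi
    have h1 := addr_succ (hpl i hi)
    have h2 := addr_mono (ys := ys) (show place m n i + 1 ≤ n + m from hys ▸ hpl i hi)
    rw [joint_eq (hpl i hi)]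
    omega
  refine ⟨?_, ?_, ?_, hle, ?_, ?_, hcap⟩
  · intro i
    rcases lt_or_ge (place m n i) ys.length with h | h
    · rw [joint_eq h]; exact hn _ (List.getElem_mem h)
    · rw [joint, List.getD_eq_default _ _ h]; exact List.nodup_nil
  · intro i hi
    rw [hinp _ (by have := hle i hi; omega), getD_addr_length (hpl i hi), joint_eq (hpl i hi)]
  · intro i hi j hj
    have h1 := hle i hi
    rw [hinp _ (by omega)]
    simp only [joint_eq (hpl i hi)] at hj ⊢
    exact getD_addr_char (hpl i hi) hj
  · intro i j hij hj
    have h1 := addr_succ (hpl i (by omega))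
    have h2 : place m n i = n + i := if_pos (by omega)
    have h3 : place m n j = n + j := if_pos hj
    have h4 := addr_mono (ys := ys) (show place m n i + 1 ≤ place m n j by omega)
    rw [joint_eq (hpl i (by omega))]
    omega
  · have := wt_joint hys
    have h2 : ∀ b : ℕ, b ≤ wt (joint ys m n) 0 b := fun b => by
      induction b with
      | zero => simp
      | succ b ih => rw [wt_succ (Nat.zero_le b)]; omega
    have := h2 (m + n)
    omega

end

/-! ### The program -/

/-- Report all positions, for the empty pattern. -/
def reportAll : Cmd :=
  .set .i (.lit 0) ;;
  .loop (.var .i <ₑ (.var .n +ₑ .lit 1))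
    (.set .i (.var .i +ₑ .lit 1) ;; .emit Var.i)

def readLengths : Cmd :=
  .set .n (.inp (.lit 0)) ;;
  .set .m (.inp (.lit 1)) ;;
  .set .len (.var .m +ₑ Var.n) ;;
  .set .stride (.var .len +ₑ .lit 1) ;;
  .set .blk (.lit 3)

def main : Cmd :=
  readLengths ;;
  .ite Var.m (ptrLoop Var.m .n ;; ptrLoop (.lit 0) .m ;; scan ;; buildTrie ;; search) reportAll

section

variable {M : Machine} {q m n : ℕ} {xs : ℕ → List (Fin q)} {pt : ℕ → ℕ}

/-- The invariant of `reportAll`. -/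
structure ReportInv (n b : ℕ) (h' : Store) (b' : ℕ) : Prop where
  n_eq : h'.v .n = n
  i : h'.v .i ≤ n + 1
  out : ∀ x, x ∈ h'.out ↔ 0 < x ∧ x ≤ h'.v .i
  spent : b ≤ b' + 20 * h'.v .i

theorem reportAll_spec (C : Layout M q m n xs pt) {h : Store} {b : ℕ} (hn : h.v .n = n)
    (hout : h.out = []) (hb : 20 * n + 50 ≤ b) :
    wp M reportAll (fun h' _ => ∀ x, x ∈ h'.out ↔ 0 < x ∧ x ≤ n + 1) h b := by
  have hpow := C.pow_bound
  have hge := C.len_ge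
  apply wp_of_vc
  unfold reportAll
  simp only [vc, Expr.ok, Expr.cost, Expr.eval]
  refine ⟨by omega, by omega, wp_loop (ReportInv n (b - 3)) ?_ ?_⟩
  · refine ⟨by simpa using hn, by simp, fun x => ?_, by simp⟩
    simp [hout]; omega
  · intro h' b' hI
    have hn' := hI.n_eq
    have hi := hI.i
    have hsp := hI.spent
    have hout' := hI.out
    simp only [vc, Expr.ok, Expr.cost, Expr.eval, Op.val, Op.safe, hn']
    refine ⟨⟨trivial, ⟨trivial, by omega, by omega⟩, trivial⟩, by omega, fun h0 => ?_, fun h0 => ?_⟩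
    · have h0 : h'.v .i < n + 1 := by by_contra hcon; simp [hcon] at h0
      refine ⟨⟨trivial, by omega, by omega⟩, by omega, trivial, by omega, by simpa using hn',
        by simp; omega, fun x => ?_, by simp; omega⟩
      simp [hout']; omega
    · have h0 : ¬ h'.v .i < n + 1 := by intro hcon; simp [hcon] at h0
      rw [show h'.v .i = n + 1 by omega] at hout'
      exact hout'

/-- The initial store. -/
def emptyStore : Store := ⟨fun _ => 0, fun _ _ => 0, []⟩

/-- Per input cell, the passes take at most 60 credits for the addresses, 100 for the scan, 300 for
the trie and 2200 for the search; the rest of 3000 absorbs the additive constants. -/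
theorem main_spec {ys : List (List (Fin q))}
    (C : Layout M q m n (joint ys m n) fun i => addr ys (place m n i)) (hys : ys.length = n + m)
    (hlen : M.len = addr ys (n + m)) (h0 : M.inp 0 = n) (h1 : M.inp 1 = m)
    (hstep : ∀ i < n + m, addr ys (i + 1) = addr ys i + M.inp (addr ys i) + 1) (hn : 0 < n) {b : ℕ}
    (hb : 3000 * M.len ≤ b) :
    wp M main (fun h' _ => ∀ x, x ∈ h'.out ↔ ∃ s, m ≤ s ∧ s + m ≤ m + n ∧ x = s - m + 1 ∧
      PMatchAt (sets (joint ys m n)) 0 s m) emptyStore b := by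
  have hpow := C.pow_bound
  have hcap := C.cap_bound
  have hge := C.len_ge
  have hwt := wt_joint hys
  have hadd : addr ys 0 = 3 := by simp [addr]
  refine wp_seq (wp_of_vc ?_)
  unfold readLengths
  simp only [vc, Expr.ok, Expr.cost, Expr.eval, Op.val, Op.safe, Store.set_v_same,
    Store.set_v_of_ne, ne_eq, reduceCtorEq, not_false_eq_true, h0, h1]
  refine ⟨⟨by omega, by omega⟩, by omega, ⟨by omega, by omega⟩, by omega, ⟨trivial, trivial, by omega⟩,
    by omega, ⟨trivial, by omega, by omega⟩, by omega, by omega, by omega, ?_⟩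
  generalize hh : ((((emptyStore.set .n n).set .m m).set .len (m + n)).set .stride (m + n + 1)).set
    .blk 3 = h
  have hF : Frame [.n, .m, .len, .stride, .blk] [] emptyStore h := hh ▸
    (((((Frame.refl _ _ _).set (by simp) _).set (by simp) _).set (by simp) _).set (by simp) _).set
      (by simp) _
  have hA : ∀ k, h.a k = fun _ => 0 := fun k => by rw [hF.a k (by simp)]; rfl
  have ho : h.out = [] := by simp [← hh, emptyStore]
  have hvn : h.v .n = n := by simp [← hh]
  have hvm : h.v .m = m := by simp [← hh]
  have hvl : h.v .len = m + n := by simp [← hh]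
  have hvs : h.v .stride = m + n + 1 := by simp [← hh]
  have hvb : h.v .blk = 3 := by simp [← hh]
  clear hh
  refine wp_ite trivial (by simp; omega) (fun hm => ?_) fun hm => ?_
  · have hm : 0 < m := by
      have : h.v .m ≠ 0 := hm
      omega
    simp only [Expr.cost]
    refine wp_seq (wp_mono (ptrLoop_spec (b0 := m) (ad := addr ys) (by simp) (.inl ⟨rfl, hvm⟩)
      (by omega) (fun i hi => hstep i (by omega)) (fun i hi => ?_) (by omega) (by omega)) ?_)
    · rw [hlen]; exact addr_mono (by omega)
    rintro h₁ b₁ ⟨e1, e2, e3, e4, e5⟩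
    rw [hvn] at e1 e4 e5
    have hvn₁ : h₁.v .n = n := (e2.v _ (by simp)).trans hvn
    have hvm₁ : h₁.v .m = m := (e2.v _ (by simp)).trans hvm
    refine wp_seq (wp_mono (ptrLoop_spec (b0 := 0) (ad := fun i => addr ys (n + i)) (by simp)
      (.inr ⟨rfl, rfl⟩) e4 (fun i hi => hstep (n + i) (by omega)) (fun i hi => ?_) (by omega)
      (by omega)) ?_)
    · rw [hlen]; exact addr_mono (by omega)
    rintro h₂ b₂ ⟨f1, f2, f3, -, f5⟩
    rw [hvm₁] at f1 f5
    have hF₂ : Frame [.i, .blk] [.ptr] h h₂ := e2.trans f2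
    have hA₂ : ∀ k, k ≠ .ptr → h₂.a k = fun _ => 0 := fun k hk =>
      (hF₂.a k (by simpa using hk)).trans (hA k)
    have hptr : ∀ i < m + n, h₂.a .ptr i = addr ys (place m n i) := by
      intro i hi
      rw [f5]
      unfold place
      split_ifs with g1 g2 g2
      · rfl
      · omega
      · omega
      · rw [e5, if_pos (by omega)]
    refine wp_seq (wp_mono (scan_spec C ((hF₂.v _ (by simp)).trans hvm)
      (fun i hi => hptr i (by omega)) (hA₂ _ (by simp)) (hA₂ _ (by simp)) (hA₂ _ (by simp))
      (hA₂ _ (by simp)) ?_) ?_)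
    · have := wt_add (xs := joint ys m n) (Nat.zero_le m) (Nat.le_add_right m n)
      omega
    rintro h₃ b₃ ⟨g1, g2, g3, g4⟩
    have hA₃ : ∀ k, k ≠ .ptr → k ∉ [Arr.lastEv, .lastPos, .succ, .gap, .queue] →
        h₃.a k = fun _ => 0 := fun k hk hk' => (g2.a k hk').trans (hA₂ k hk)
    have hwm := wt_add (xs := joint ys m n) (Nat.zero_le m) (Nat.le_add_right m n)
    refine wp_seq (wp_mono (buildTrie_spec C g4
      ((g2.v _ (by simp)).trans ((hF₂.v _ (by simp)).trans hvs)) (hA₃ _ (by simp) (by simp))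
      (hA₃ _ (by simp) (by simp)) (hA₃ _ (by simp) (by simp)) (hA₃ _ (by simp) (by simp))
      (by omega)) ?_)
    rintro h₄ b₄ ⟨k1, k2, k3, k4, S, k5, k6⟩
    have hA₄ : ∀ k, k ≠ .ptr → k ∉ [Arr.lastEv, .lastPos, .succ, .gap, .queue] →
        k ∉ [Arr.fail, .depth, .child, .label, .par, .queue] → h₄.a k = fun _ => 0 :=
      fun k hk hk' hk'' => (k2.a k hk'').trans (hA₃ k hk hk')
    have hV₄ : ∀ x, x ∉ [Var.i, .blk] → x ∉ [Var.blk, .k, .j, .pos, .x, .y, .tl] →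
        x ∉ [Var.blk, .node, .gap, .x, .f, .nodes, .y, .tl, .hd] → h₄.v x = h.v x :=
      fun x i1 i2 i3 => ((k2.v x i3).trans (g2.v x i2)).trans (hF₂.v x i1)
    have hP : Prepared M m n (joint ys m n) (fun i => addr ys (place m n i)) S h₄ := by
      refine ⟨(hV₄ _ (by simp) (by simp) (by simp)).trans hvm,
        (hV₄ _ (by simp) (by simp) (by simp)).trans hvl,
        (hV₄ _ (by simp) (by simp) (by simp)).trans hvs, ?_, k4, k5, k6⟩
      rw [k2.a .ptr (by simp), g2.a .ptr (by simp)]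
      exact hptr
    refine wp_mono (search_spec C hP hm hn (hA₄ _ (by simp) (by simp) (by simp))
      (hA₄ _ (by simp) (by simp) (by simp)) (hA₄ _ (by simp) (by simp) (by simp))
      (hA₄ _ (by simp) (by simp) (by simp)) (hA₄ _ (by simp) (by simp) (by simp))
      (by rw [k3, g3, f3, e3, ho]) (by omega)) ?_
    exact fun h' b' hq => hq.2
  · have hm : m = 0 := by
      have : h.v .m = 0 := hm
      omega
    refine wp_mono (reportAll_spec C hvn ho (by simp only [Expr.cost]; omega)) ?_
    intro h' _ hq x
    rw [hq]
    constructor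
    -- The empty pattern matches at each of the `n + 1` starting positions.
    · exact fun hx => ⟨x - 1, by omega, by omega, by omega, by subst hm; exact pMatchAt_zero _ _⟩
    · rintro ⟨s, h2, h3, rfl, -⟩
      omega

end

/-! ### The theorem -/

section

variable {q n m : ℕ} {T : SetString (Fin q) n} {P : SetString (Fin q) m}
  {t : Fin n → List (Fin q)} {p : Fin m → List (Fin q)}

/-- The sets of the text, then those of the pattern. -/
def inputSets (t : Fin n → List (Fin q)) (p : Fin m → List (Fin q)) : List (List (Fin q)) :=
  List.ofFn t ++ List.ofFn p

theorem encodeInput_eq : SetString.encodeInput t p = [n, m, q] ++ (inputSets t p).flatMap block := by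
  have : ∀ l : List (Fin q), (l.length :: l.map fun σ => (σ : ℕ) + 1) = block l := fun l => by
    simp [block, ← List.map_eq_flatMap]
  simp only [SetString.encodeInput, SetString.encode, inputSets, List.flatMap_append, this,
    List.append_assoc]

theorem length_inputSets : (inputSets t p).length = n + m := by simp [inputSets]

theorem size_eq (ht : SetString.Enumerates t T) : T.size = ∑ i, (t i).length := by
  refine sum_congr rfl fun i _ => ?_
  rw [← List.toFinset_card_of_nodup (ht i).1]
  congr 1
  ext a
  simp [(ht i).2]

theorem length_encodeInput (ht : SetString.Enumerates t T) (hp : SetString.Enumerates p P) :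
    (SetString.encodeInput t p).length = 3 + (n + m + T.size + P.size) := by
  rw [encodeInput_eq, List.length_append, List.length_flatMap, inputSets, List.map_append,
    List.sum_append, size_eq ht, size_eq hp]
  simp only [length_block, List.map_ofFn, List.sum_ofFn, Function.comp_def, sum_add_distrib]
  simp
  omega

theorem encodeInput_le (ht : SetString.Enumerates t T) (hp : SetString.Enumerates p P) {x : ℕ}
    (hx : x ∈ SetString.encodeInput t p) : x ≤ n + m + T.size + P.size + q := by
  have hbl : ∀ l : List (Fin q), x ∈ block l → x ≤ l.length + q := by
    intro l hl
    rcases List.mem_cons.1 hl with rfl | hl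
    · omega
    · obtain ⟨σ, -, rfl⟩ := List.mem_map.1 hl
      have := σ.2
      omega
  rw [encodeInput_eq] at hx
  rcases List.mem_append.1 hx with hx | hx
  · simp at hx
    omega
  · obtain ⟨l, hl, hxl⟩ := List.mem_flatMap.1 hx
    have h1 := hbl l hxl
    rcases List.mem_append.1 hl with hl | hl
    · obtain ⟨i, rfl⟩ := (List.mem_ofFn' _ _).1 hl
      have : (t i).length ≤ T.size := by
        rw [size_eq ht]
        exact single_le_sum (f := fun i => (t i).length) (fun _ _ => Nat.zero_le _) (mem_univ i)
      omega
    · obtain ⟨i, rfl⟩ := (List.mem_ofFn' _ _).1 hl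
      have : (p i).length ≤ P.size := by
        rw [size_eq hp]
        exact single_le_sum (f := fun i => (p i).length) (fun _ _ => Nat.zero_le _) (mem_univ i)
      omega

theorem sets_joint_of_lt (hp : SetString.Enumerates p P) {i : ℕ} (hi : i < m) :
    sets (joint (inputSets t p) m n) i = P ⟨i, hi⟩ := by
  have h1 : place m n i = n + i := if_pos hi
  have h2 : joint (inputSets t p) m n i = p ⟨i, hi⟩ := by
    rw [joint, h1, inputSets, List.getD_append_right _ _ _ _ (by simp)]
    simp [hi]
  ext σ
  rw [List.mem_toFinset, h2, (hp _).2]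

theorem sets_joint_add (ht : SetString.Enumerates t T) {i : ℕ} (hi : i < n) :
    sets (joint (inputSets t p) m n) (m + i) = T ⟨i, hi⟩ := by
  have h1 : place m n (m + i) = i := by simp [place]
  have h2 : joint (inputSets t p) m n (m + i) = t ⟨i, hi⟩ := by
    rw [joint, h1, inputSets, List.getD_append _ _ _ _ (by simpa using hi)]
    simp [hi]
  ext σ
  rw [List.mem_toFinset, h2, (ht _).2]

theorem mem_matchPositions_iff (ht : SetString.Enumerates t T) (hp : SetString.Enumerates p P)
    (x : ℕ) : x ∈ SetString.matchPositions T P ↔ ∃ s, m ≤ s ∧ s + m ≤ m + n ∧ x = s - m + 1 ∧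
      PMatchAt (sets (joint (inputSets t p) m n)) 0 s m := by
  have key : ∀ j (h : j + m ≤ n), SetString.PMatch P (T.window m j h) ↔
      PMatchAt (sets (joint (inputSets t p) m n)) 0 (m + j) m := by
    intro j h
    refine exists_congr fun π => ⟨fun hπ i hi => ?_, fun hπ i => ?_⟩
    · rw [zero_add, sets_joint_of_lt hp hi, add_assoc, sets_joint_add ht (by omega)]
      exact hπ ⟨i, hi⟩
    · have := hπ i i.2
      rwa [zero_add, sets_joint_of_lt hp i.2, add_assoc, sets_joint_add ht (by omega)] at this
  constructor
  · rintro ⟨j, h, rfl, hj⟩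
    exact ⟨m + j, by omega, by omega, by omega, (key j h).1 hj⟩
  · rintro ⟨s, h1, h2, rfl, h3⟩
    refine ⟨s - m, by omega, rfl, (key _ _).2 ?_⟩
    rwa [show m + (s - m) = s by omega]

/-- Here `D + 6 ≤ 4 * D`, so the arrays and the input need less than `2 ^ 10 * D ^ 2` cells; as `D ≥
2`, ten further factors `D` replace the constant. This explains the exponent 12. -/
theorem pow_large {D W : ℕ} (hD : 2 ≤ D) (hW : D ^ 12 ≤ W) {l r : ℕ} (hl : l + r + 4 ≤ D + 6) :
    32 * ((l + r + 4) * (l + r + 4)) + l < W := by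
  have h1 : (l + r + 4) * (l + r + 4) ≤ (4 * D) * (4 * D) :=
    Nat.mul_le_mul (by omega) (by omega)
  have h2 : 2 ^ 10 * D ^ 2 ≤ D ^ 12 := by
    rw [show D ^ 12 = D ^ 10 * D ^ 2 by ring]
    exact Nat.mul_le_mul_right _ (Nat.pow_le_pow_left hD 10)
  nlinarith

/-- The program computes the positions of the matches, in linear time. -/
theorem main_correct {w : ℕ} (hn : 0 < n) (ht : SetString.Enumerates t T)
    (hp : SetString.Enumerates p P) (hw : (n + m + T.size + P.size + q + 1) ^ 12 ≤ 2 ^ w)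
    (ω : ℕ → Fin (2 ^ w)) :
    ∃ τ ≤ 12000 * (n + m + T.size + P.size), ∃ s,
      Exec w ω main.code (initState w (SetString.encodeInput t p)) τ s ∧
      ∀ x, x ∈ s.out ↔ x ∈ SetString.matchPositions T P := by
  have hlen := length_encodeInput ht hp
  have hfits := pow_large (l := (SetString.encodeInput t p).length) (r := q) (by omega) hw (by omega)
  have hcapl : 4 * ((SetString.encodeInput t p).length + q + 4) ≤
      ((SetString.encodeInput t p).length + q + 4) * ((SetString.encodeInput t p).length + q + 4) :=
    Nat.mul_le_mul_right _ (by omega)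
  have hlt : ∀ i, (SetString.encodeInput t p).getD i 0 < 2 ^ w := by
    intro i
    rcases lt_or_ge i (SetString.encodeInput t p).length with hi | hi
    · rw [List.getD_eq_getElem _ _ hi]
      have := encodeInput_le ht hp (List.getElem_mem hi)
      omega
    · rw [List.getD_eq_default _ _ hi]
      positivity
  let M : Machine := ⟨w, ω, fun i => (SetString.encodeInput t p).getD i 0,
    (SetString.encodeInput t p).length, _, hfits, fun i _ => hlt i, by omega⟩
  have hys : (inputSets t p).length = n + m := length_inputSets
  have hML : M.len = ([n, m, q] ++ (inputSets t p).flatMap block).length := by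
    rw [← encodeInput_eq]
  have hMI : ∀ i, M.inp i = ([n, m, q] ++ (inputSets t p).flatMap block).getD i 0 := fun i => by
    rw [← encodeInput_eq]
  have C : Layout M q m n (joint (inputSets t p) m n) _ := layout_joint hys
    (fun l hl => by
      rcases List.mem_append.1 hl with hl | hl
      · obtain ⟨i, rfl⟩ := (List.mem_ofFn' _ _).1 hl; exact (ht i).1
      · obtain ⟨i, rfl⟩ := (List.mem_ofFn' _ _).1 hl; exact (hp i).1)
    (fun i _ => hMI i) hML le_rfl
  have hrel : Rel M emptyStore (initState w (SetString.encodeInput t p)) := by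
    refine ⟨fun _ => rfl, fun _ => ?_, fun k i hi => ?_, fun _ _ _ => ?_, fun i _ => ?_, rfl⟩
    · exact Nat.two_pow_pos _
    · have := addr_lt (k := k) hi
      have h2 : M.len ≤ 2 ^ M.w - (32 * i + k.idx + 1) := by omega
      show (SetString.encodeInput t p).getD _ 0 % 2 ^ w = 0
      rw [List.getD_eq_default _ _ h2, Nat.zero_mod]
    · exact Nat.two_pow_pos _
    · exact Nat.mod_eq_of_lt (hlt i)
  obtain ⟨τ, s, h', b', h1, h2, h3, h4⟩ := main_spec C hys (by rw [hML, ← hys, addr_length])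
    (by rw [hMI]; rfl) (by rw [hMI]; rfl)
    (fun i hi => by rw [hMI, getD_addr_length (by omega), addr_succ (by omega)]) hn le_rfl _ hrel
  refine ⟨τ, ?_, s, h1, fun x => ?_⟩
  -- As `n ≥ 1`, the three leading cells at most quadruple the length: `3000 * 4 = 12000`.
  · have : M.len = 3 + (n + m + T.size + P.size) := hlen
    omega
  · rw [h2.out, h4, mem_matchPositions_iff ht hp]

end

end SetMatch

theorem theorem1 :
    ∃ (prog : WordRAM.Prog) (k : ℕ), ∀ a : ℕ, ∃ C : ℕ,
      ∀ (q n m w : ℕ) (T : SetString (Fin q) n) (P : SetString (Fin q) m)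
        (t : Fin n → List (Fin q)) (p : Fin m → List (Fin q)),
        0 < n → SetString.Enumerates t T → SetString.Enumerates p P →
        (n + m + T.size + P.size + q + 1) ^ k ≤ 2 ^ w →
        -- every match is reported, whatever the random words are
        (∀ (ω : ℕ → Fin (2 ^ w)) (out : List ℕ),
          WordRAM.Outputs prog w (SetString.encodeInput t p) ω out →
          ∀ i ∈ SetString.matchPositions T P, i ∈ out) ∧
        -- the program halts almost surely
        (∀ᵐ ω ∂(WordRAM.coinMeasure w),
          ∃ out : List ℕ, WordRAM.Outputs prog w (SetString.encodeInput t p) ω out) ∧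
        -- a false positive is reported with probability at most `1 / n`
        WordRAM.coinMeasure w {ω | ∃ out : List ℕ,
          WordRAM.Outputs prog w (SetString.encodeInput t p) ω out ∧
          ∃ i ∈ out, i ∉ SetString.matchPositions T P} ≤ (n : ENNReal)⁻¹ ∧
        -- linear running time with high probability, where an empty set costs a constant
        WordRAM.coinMeasure w {ω | ¬ WordRAM.HaltsWithin prog w (SetString.encodeInput t p) ω
          (C * (n + m + T.size + P.size))} ≤
            (((n + m + T.size + P.size : ℕ) : ENNReal) ^ a)⁻¹ ∧
        -- the same in terms of the two sizes alone, which bound the lengths if no set is empty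
        (n ≤ T.size → m ≤ P.size →
          WordRAM.coinMeasure w {ω | ¬ WordRAM.HaltsWithin prog w (SetString.encodeInput t p) ω
            (C * (T.size + P.size))} ≤ (((T.size + P.size : ℕ) : ENNReal) ^ a)⁻¹) := by
  -- The constant is doubled for the last claim, where `n + m` is at most the total size. It does
  -- not depend on `a`, since the time bound never fails.
  refine ⟨SetMatch.main.code, 12, fun a => ⟨24000, ?_⟩⟩
  intro q n m w T P t p hn ht hp hw
  have key := SetMatch.main_correct hn ht hp hw
  have hout : ∀ ω out, WordRAM.Outputs SetMatch.main.code w (SetString.encodeInput t p) ω out →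
      ∀ i, i ∈ out ↔ i ∈ SetString.matchPositions T P := by
    rintro ω out ⟨τ', s', h', rfl⟩
    obtain ⟨τ, -, s, h1, h2⟩ := key ω
    obtain ⟨-, rfl⟩ := h'.deterministic h1
    exact h2
  have htime : ∀ B, 12000 * (n + m + T.size + P.size) ≤ B → ∀ ω,
      WordRAM.HaltsWithin SetMatch.main.code w (SetString.encodeInput t p) ω B := by
    intro B hB ω
    obtain ⟨τ, h0, s, h1, -⟩ := key ω
    exact ⟨τ, h0.trans hB, s, h1⟩
  refine ⟨fun ω out h i hi => (hout ω out h i).2 hi, Filter.Eventually.of_forall fun ω => ?_, ?_, ?_,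
    fun h1 h2 => ?_⟩
  · obtain ⟨τ, -, s, h1, -⟩ := key ω
    exact ⟨_, τ, s, h1, rfl⟩
  · rw [Set.eq_empty_of_forall_notMem (s := {ω | _}) ?_, MeasureTheory.measure_empty]
    · exact zero_le
    · rintro ω ⟨out, h, i, hi, hi'⟩
      exact hi' ((hout ω out h i).1 hi)
  · rw [Set.eq_empty_of_forall_notMem (s := {ω | _}) ?_, MeasureTheory.measure_empty]
    · exact zero_le
    · exact fun ω h => h (htime _ (by omega) ω)
  · rw [Set.eq_empty_of_forall_notMem (s := {ω | _}) ?_, MeasureTheory.measure_empty]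
    · exact zero_le
    · exact fun ω h => h (htime _ (by omega) ω)
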